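/- **Setting.** Let $H$ be a separable infinite-dimensional real Hilbert space and $S:H\to H$ a continuous map. Assume: **(A)** There are $\alpha,\beta,C>0$, $q\in(0,1)$ and a continuous $\varPhi:H\to\mathbb R_+$ such that, for all $u,v\in H$, $$1+\|u\|^\alpha\le\varPhi(u)\le C(1+\|u\|)^\beta,\qquad \varPhi(S(u)+v)\le q\,\varPhi(u)+C\,\varPhi(v).$$ **(B)** There are a continuous function $\mathfrak p:H\to\mathbb R_+$ bounded on balls, a non-decreasing sequence $\gamma_N>0$ ($N\ge0$) with $\gamma_N\to+\infty$, and a non-decreasing sequence of finite-dimensional subspaces $H_N\subset H$ with $H_0=\{0\}$ and dense union, such that, with $\mathsf P_N$ the orthogonal projection onto $H_N$, for all $u,v\in H$ and $N\ge0$, $$\|(I-\mathsf P_N)(S(u)-S(v))\|\le\gamma_N^{-1}e^{\mathfrak p(u)+\mathfrak p(v)}\|u-v\|.$$ Let $U=\{u\in H:\sup_{N\ge0}\gamma_N\|(I-\mathsf P_N)u\|<\infty\}$ and assume $S(0)\in U$. Fix an orthonormal basis $\{e_j\}_{j\ge1}$ of $H$, a function $Q:\mathbb R_+\to\mathbb R_+$,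 and positive constants $c,\delta,\rho$ such that $Q(\|u\|)\le e^{\rho\varPhi(u)}$ for all $u\in H$. **Theorem 1.1.** There is an integer $N\ge1$, depending only on the objects fixed above (and not on the noise introduced next), with the following property. Let $\eta_1,\eta_2,\dots$ be $H$-valued random variables on a probability space satisfying: **(C)** almost surely $\eta_k=\sum_{j\ge1}b_j\xi_{jk}e_j$, where the $\xi_{jk}$ ($j,k\ge1$) are independent real random variables, the law of $\xi_{jk}$ has a positive $C^1$ density $\rho_j$ with respect to the Lebesgue measure whose total variation on $\mathbb R$ satisfies $\mathrm{Var}(\rho_j)\le1$, the numbers $b_j\ge0$ satisfy $\sum_{j\ge1}\gamma_{j-1}|b_j|<\infty$, and $\mathbb E\,e^{\delta_0(\varPhi(\eta_1)+\mathfrak p(\eta_1))}<\infty$ for some $\delta_0>0$. Let $(u_k,\mathbb P_u)$ be the Markov family defined by $u_k=S(u_{k-1})+\eta_k$ ($k\ge1$), $u_0=u$, and let $\mathfrak P_k^*$ be its Markov semigroup on the set $\mathcal P(H)$ of Borel probability measures, $(\mathfrak P_k^*\lambda)(\Gamma)=\int_H\mathbb P_u\{u_k\in\Gamma\}\,\lambda(du)$.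 Suppose that $\mathfrak p$ is stabilisable with the function $Q$ and the constants $c,\delta$; that is, $Q$ is continuous and non-decreasing and $$\mathbb E_u\exp\bigl\{\delta\bigl(\mathfrak p(u_1)+\dots+\mathfrak p(u_k)\bigr)\bigr\}\le Q(\|u\|)\,e^{ck}\qquad(k\ge1,\ u\in H).$$ If $b_j\ne0$ for $j=1,\dots,N$, then the Markov family has a unique stationary measure $\mu\in\mathcal P(H)$ (that is, $\mathfrak P_1^*\mu=\mu$). Moreover, there are constants $\kappa,C'>0$ such that $$\|\mathfrak P_k^*\lambda-\mu\|_L^*\le C'e^{-\kappa k}\int_H\varPhi\,d\lambda\qquad\text{for all }\lambda\in\mathcal P(H),\ k\ge0,$$ where $\|\mu_1-\mu_2\|_L^*=\sup\bigl\{\bigl|\int f\,d\mu_1-\int f\,d\mu_2\bigr|:\ f:H\to\mathbb R,\ \sup_H|f|+\mathrm{Lip}(f)\le1\bigr\}$ (the right-hand side of the estimate may be $+\infty$). -/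

import Mathlib

open MeasureTheory ProbabilityTheory Filter Topology
open scoped NNReal ENNReal

namespace KickedRDS

universe u v

section Model

variable {H : Type u} [NormedAddCommGroup H] {Ω : Type v}

/-- Trajectory of the random dynamical system `u_k = S(u_{k-1}) + η_k`, `u_0 = x`.
The kicks are numbered from `0`, so that `η k` is the kick acting at time `k + 1`. -/
def traj (S : H → H) (η : ℕ → Ω → H) (x : H) : ℕ → Ω → H
  | 0, _ => x
  | k + 1, ω => S (traj S η x k ω) + η k ω

variable [MeasurableSpace H] [MeasurableSpace Ω]

/-- Transition function `P_k(x, ·)`: the law of `u_k` for the trajectory issued from `x`. -/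
noncomputable def transition (S : H → H) (η : ℕ → Ω → H) (P : Measure Ω) (k : ℕ) (x : H) :
    Measure H :=
  P.map (traj S η x k)

/-- The Markov semigroup on measures,
`(𝔓_k^* lam)(Γ) = ∫ P_k(x, Γ) lam(dx)` (see `dualSemigroup_apply`). -/
noncomputable def dualSemigroup (S : H → H) (η : ℕ → Ω → H) (P : Measure Ω) (k : ℕ)
    (lam : Measure H) : Measure H :=
  lam.bind (transition S η P k)

/-- `μ` is a stationary measure of the Markov family: `𝔓_1^* μ = μ`. -/
def IsStationary (S : H → H) (η : ℕ → Ω → H) (P : Measure Ω) (μ : Measure H) : Prop :=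
  dualSemigroup S η P 1 μ = μ

/-- `p` is stabilisable with function `Q` and constants `c`, `δ`:
`𝔼_x exp(δ (p(u_1) + ⋯ + p(u_k))) ≤ Q(‖x‖) e^{c k}` for all `k ≥ 1` and all `x`. -/
structure StabilisableWith (S : H → H) (η : ℕ → Ω → H) (P : Measure Ω)
    (p : H → ℝ≥0) (Q : ℝ≥0 → ℝ≥0) (c δ : ℝ) : Prop where
  monotone : Monotone Q
  continuous : Continuous Q
  c_pos : 0 < c
  δ_pos : 0 < δ
  bound : ∀ k : ℕ, 1 ≤ k → ∀ x : H,
    ∫⁻ ω, ENNReal.ofReal (Real.exp (δ * ∑ n ∈ Finset.Icc 1 k, (p (traj S η x n ω) : ℝ))) ∂P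
      ≤ (Q ‖x‖₊ : ℝ≥0∞) * ENNReal.ofReal (Real.exp (c * k))

/-- Dual-Lipschitz (Kantorovich-Wasserstein) distance: the supremum of `|∫ f dμ - ∫ f dν|` over
`f` with `‖f‖_L = sup |f| + Lip(f) ≤ 1`. -/
noncomputable def dualLipDist (μ ν : Measure H) : ℝ≥0∞ :=
  ⨆ f ∈ {f : H → ℝ | ∃ M L : ℝ≥0, M + L ≤ 1 ∧ (∀ x, |f x| ≤ M) ∧ LipschitzWith L f},
    ENNReal.ofReal |∫ x, f x ∂μ - ∫ x, f x ∂ν|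

theorem measurable_traj [BorelSpace H] [SecondCountableTopology H] {S : H → H}
    {η : ℕ → Ω → H} (hS : Continuous S) (hη : ∀ k, Measurable (η k)) (k : ℕ) :
    Measurable fun z : H × Ω => traj S η z.1 k z.2 := by
  induction k with
  | zero => exact measurable_fst
  | succ k ih => exact (hS.measurable.comp ih).add ((hη k).comp measurable_snd)

theorem dualSemigroup_apply [BorelSpace H] [SecondCountableTopology H] {S : H → H}
    {η : ℕ → Ω → H} (hS : Continuous S) (hη : ∀ k, Measurable (η k)) (P : Measure Ω)
    [IsProbabilityMeasure P] (k : ℕ) (lam : Measure H) {Γ : Set H} (hΓ : MeasurableSet Γ) :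
    dualSemigroup S η P k lam Γ = ∫⁻ x, P {ω | traj S η x k ω ∈ Γ} ∂lam := by
  have hx : ∀ x, Measurable (traj S η x k) := fun x =>
    (measurable_traj hS hη k).comp measurable_prodMk_left
  have hm : Measurable (transition S η P k) := by
    refine Measure.measurable_of_measurable_coe _ fun s hs => ?_
    have h : (fun x => transition S η P k x s)
        = fun x => P (Prod.mk x ⁻¹' ((fun z : H × Ω => traj S η z.1 k z.2) ⁻¹' s)) := by
      funext x
      exact Measure.map_apply (hx x) hs
    rw [h]
    exact measurable_measure_prodMk_left (measurable_traj hS hη k hs)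
  rw [dualSemigroup, Measure.bind_apply hΓ hm.aemeasurable]
  exact lintegral_congr fun x => Measure.map_apply (hx x) hΓ

end Model

section Conditions

variable {H : Type u} [NormedAddCommGroup H]

/-- Condition (A), dissipativity. -/
def Dissipativity (S : H → H) (Φ : H → ℝ≥0) : Prop :=
  Continuous Φ ∧ ∃ α β C q : ℝ, 0 < α ∧ 0 < β ∧ 0 < C ∧ 0 < q ∧ q < 1 ∧
    (∀ x : H, 1 + ‖x‖ ^ α ≤ Φ x ∧ (Φ x : ℝ) ≤ C * (1 + ‖x‖) ^ β) ∧
    ∀ x y : H, (Φ (S x + y) : ℝ) ≤ q * Φ x + C * Φ y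

variable [InnerProductSpace ℝ H]

/-- Condition (B), compactness. Here `(V N).starProjection` is the orthogonal projection
`𝖯_N` of `H` onto the finite-dimensional subspace `V N`. -/
structure Compactness (S : H → H) (p : H → ℝ≥0) (γ : ℕ → ℝ) (V : ℕ → Submodule ℝ H)
    [∀ N, FiniteDimensional ℝ (V N)] : Prop where
  p_continuous : Continuous p
  p_bounded : ∀ R : ℝ, ∃ M : ℝ, ∀ x : H, ‖x‖ ≤ R → (p x : ℝ) ≤ M
  γ_pos : ∀ N, 0 < γ N
  γ_mono : Monotone γ
  γ_tendsto : Tendsto γ atTop atTop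
  V_zero : V 0 = ⊥
  V_mono : Monotone V
  V_dense : Dense (⋃ N, (V N : Set H))
  bound : ∀ (x y : H) (N : ℕ),
    ‖(S x - S y) - (V N).starProjection (S x - S y)‖
      ≤ (γ N)⁻¹ * Real.exp (p x + p y) * ‖x - y‖

/-- The space `U` of vectors `x` with `‖x - 𝖯_N x‖ ≤ C / γ_N` for all `N ≥ 0`, where `C` does not
depend on `N`. -/
def regularSpace (γ : ℕ → ℝ) (V : ℕ → Submodule ℝ H) [∀ N, FiniteDimensional ℝ (V N)] :
    Set H :=
  {x | ∃ C : ℝ, 0 < C ∧ ∀ N : ℕ, ‖x - (V N).starProjection x‖ ≤ C * (γ N)⁻¹}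

variable [MeasurableSpace H] {Ω : Type v} [MeasurableSpace Ω]

/-- Condition (C), structure of the noise: `η_k = ∑_j b_j ξ_{jk} e_j`. Indices start from `0`, so
that `e j`, `b j`, `ξ j`, `dens j` are the objects with number `j + 1` in the usual counting from
`1`. The variables `ξ j k` are jointly independent; the law of `ξ j k` has the positive `C¹`
density `dens j`, whose total variation on the real line is at most `1`. -/
structure NoiseStructure (Φ p : H → ℝ≥0) (γ : ℕ → ℝ) (e : HilbertBasis ℕ ℝ H)
    (P : Measure Ω) (η : ℕ → Ω → H) (b : ℕ → ℝ) (ξ : ℕ → ℕ → Ω → ℝ) (dens : ℕ → ℝ → ℝ) :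
    Prop where
  η_measurable : ∀ k, Measurable (η k)
  ξ_measurable : ∀ j k, Measurable (ξ j k)
  η_eq : ∀ k, ∀ᵐ ω ∂P, HasSum (fun j => (b j * ξ j k ω) • e j) (η k ω)
  ξ_indep : iIndepFun (fun (i : ℕ × ℕ) => ξ i.1 i.2) P
  ξ_law : ∀ j k, P.map (ξ j k) = volume.withDensity fun r => ENNReal.ofReal (dens j r)
  dens_contDiff : ∀ j, ContDiff ℝ 1 (dens j)
  dens_pos : ∀ j r, 0 < dens j r
  dens_variation : ∀ j, eVariationOn (dens j) Set.univ ≤ 1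
  b_nonneg : ∀ j, 0 ≤ b j
  b_summable : Summable fun j => γ j * |b j|
  exp_moment : ∃ δ : ℝ, 0 < δ ∧
    ∫⁻ x, ENNReal.ofReal (Real.exp (δ * ((Φ x : ℝ) + p x))) ∂(P.map (η 0)) < ∞

end Conditions

end KickedRDS

/-!
The proof is by a weak Harris theorem: a Markov chain with a Lyapunov function mixes exponentially
if there is a distance-like function `d ≤ 1` which a coupling of the transition probabilities
halves wherever `d < 1`, and if pairs of points in the sublevel sets of the Lyapunov function come
close for `d` with positive probability. Here `Φ` is the Lyapunov function. The theorem is proved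
in dual form (`weak_harris`): functions with increments at most `√(d (1 + β (V + V)))` are
contracted by the iterates of the Markov operator. In this way couplings are needed only for one
step and one pair of points at a time, so that neither their measurable dependence on the points
nor their composition along trajectories is needed.

The distance is built as follows. Two processes started at `x` and `y` receive noises which differ,
with a probability close to `1` for close points, by the projection `h` of `S x - S y` on the span of
the first `N` basis vectors (`exists_shifted_part`). When they do, the difference of the processes becomes
`S x - S y - h`, which by the compactness condition is at most `ε exp (p x + p y) ‖x - y‖`, with
`ε` small for large `N` (`Compactness.exists_modes`). Since the densities of the noise have bounded
variation, this fails with probability at most `Λ exp (p x + p y) ‖x - y‖`. The growth factor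
`exp (p x + p y)` is not bounded, and this is where stabilisability enters: it provides a function
`G ≥ 1` such that `W = exp (δ p) G` satisfies `∫ W dκ(x, ·) ≤ 2 exp (c - δ p x) W x`
(`exists_weight`, a resolvent of the Feynman-Kac semigroup). For `s ≤ δ / 2`, the factor
`exp (-δ p)` outweighs the growth of `‖x - y‖ ^ s`, and for
`d x y = min 1 (K ‖x - y‖ ^ s √(W x W y))` with `ε` small and `K` large the coupling
halves `d` on average (`exists_coupling_integral_le`). How small `ε` has to be depends on the fixed
objects only, and only `K` depends on the noise; therefore `N` does not.

The sublevel sets are handled by noise of small norm, which has positive probability: it drives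
both processes to a fixed sublevel set of `Φ` (`smallAt_sublevel`), and inside this set, where `p`
is bounded, the same coupling halves the norm distance as often as needed (`smallAt_closed_ball`).

The stationary measure is a limit of the laws `P_n(0, ·)`, which form a Cauchy sequence for the
dual-Lipschitz distance and are therefore tight (`exists_stationary_of_decay`).
-/

namespace KickedRDS

/-! ### A weak Harris theorem in dual form -/

section WeakHarris

variable {X : Type*} [MeasurableSpace X]

/-- `π` is a coupling of `μ` and `ν`: a measure on the square with these two marginals. -/
structure IsCoupling (π : Measure (X × X)) (μ ν : Measure X) : Prop where
  map_fst : π.map Prod.fst = μ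
  map_snd : π.map Prod.snd = ν

theorem isCoupling_prod (μ ν : Measure X) [IsProbabilityMeasure μ] [IsProbabilityMeasure ν] :
    IsCoupling (μ.prod ν) μ ν :=
  ⟨by simp [Measure.map_fst_prod], by simp [Measure.map_snd_prod]⟩

/-- The Markov operator `f ↦ ∫ f dκ(x, ·)` of a kernel, acting on real functions. -/
noncomputable def markovOp (κ : Kernel X X) (f : X → ℝ) (x : X) : ℝ := ∫ y, f y ∂κ x

/-- Bounded measurable real functions. -/
def BddMeas (f : X → ℝ) : Prop := Measurable f ∧ ∃ B : ℝ, ∀ x, |f x| ≤ B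

theorem BddMeas.integrable {f : X → ℝ} (hf : BddMeas f) (μ : Measure X) [IsFiniteMeasure μ] :
    Integrable f μ := by
  obtain ⟨hm, B, hB⟩ := hf
  exact Integrable.of_bound hm.aestronglyMeasurable B (ae_of_all _ hB)

theorem BddMeas.markovOp {κ : Kernel X X} [IsMarkovKernel κ] {f : X → ℝ} (hf : BddMeas f) :
    BddMeas (markovOp κ f) := by
  refine ⟨hf.1.stronglyMeasurable.integral_kernel.measurable, ?_⟩
  obtain ⟨hm, B, hB⟩ := hf
  refine ⟨B, fun x => ?_⟩
  have h := norm_integral_le_of_norm_le_const (μ := κ x) (f := f) (ae_of_all _ hB)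
  simpa [KickedRDS.markovOp] using h

theorem BddMeas.iterate {κ : Kernel X X} [IsMarkovKernel κ] {f : X → ℝ} (hf : BddMeas f) (n : ℕ) :
    BddMeas ((KickedRDS.markovOp κ)^[n] f) := by
  induction n with
  | zero => exact hf
  | succ n ih => rw [Function.iterate_succ_apply']; exact ih.markovOp

theorem markovOp_const_mul (κ : Kernel X X) (t : ℝ) (f : X → ℝ) :
    markovOp κ (fun x => t * f x) = fun x => t * markovOp κ f x := by
  funext x
  exact integral_const_mul t f

theorem iterate_const_mul (κ : Kernel X X) (t : ℝ) (n : ℕ) (f : X → ℝ) :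
    (markovOp κ)^[n] (fun x => t * f x) = fun x => t * (markovOp κ)^[n] f x := by
  induction n generalizing f with
  | zero => rfl
  | succ n ih => rw [Function.iterate_succ_apply, markovOp_const_mul, ih]; rfl

theorem IsCoupling.isProbabilityMeasure {π : Measure (X × X)} {μ ν : Measure X}
    [IsProbabilityMeasure μ] (h : IsCoupling π μ ν) : IsProbabilityMeasure π := by
  constructor
  have : μ Set.univ = π Set.univ := by
    rw [← h.map_fst, Measure.map_apply measurable_fst .univ]; simp
  rw [← this, measure_univ]

theorem IsCoupling.integral_fst {π : Measure (X × X)} {μ ν : Measure X} (h : IsCoupling π μ ν)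
    {f : X → ℝ} (hf : Measurable f) : ∫ z, f z.1 ∂π = ∫ x, f x ∂μ := by
  rw [← h.map_fst, integral_map measurable_fst.aemeasurable hf.aestronglyMeasurable]

theorem IsCoupling.integral_snd {π : Measure (X × X)} {μ ν : Measure X} (h : IsCoupling π μ ν)
    {f : X → ℝ} (hf : Measurable f) : ∫ z, f z.2 ∂π = ∫ x, f x ∂ν := by
  rw [← h.map_snd, integral_map measurable_snd.aemeasurable hf.aestronglyMeasurable]

theorem IsCoupling.integrable_fst {π : Measure (X × X)} {μ ν : Measure X} (h : IsCoupling π μ ν)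
    {f : X → ℝ} (hf : Integrable f μ) : Integrable (fun z => f z.1) π := by
  rw [← h.map_fst] at hf
  exact hf.comp_measurable measurable_fst

theorem IsCoupling.integrable_snd {π : Measure (X × X)} {μ ν : Measure X} (h : IsCoupling π μ ν)
    {f : X → ℝ} (hf : Integrable f ν) : Integrable (fun z => f z.2) π := by
  rw [← h.map_snd] at hf
  exact hf.comp_measurable measurable_snd

/-- A coupling of the transition laws turns a bound for the increments of `f` into one for the
increments of its image under the Markov operator. -/
theorem IsCoupling.abs_markovOp_sub_le {κ : Kernel X X} [IsMarkovKernel κ] {x y : X}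
    {π : Measure (X × X)} (hπ : IsCoupling π (κ x) (κ y)) {f : X → ℝ} (hf : BddMeas f)
    {g : X × X → ℝ} (hg : Integrable g π) (hfg : ∀ z, |f z.1 - f z.2| ≤ g z) :
    |markovOp κ f x - markovOp κ f y| ≤ ∫ z, g z ∂π := by
  have := hπ.isProbabilityMeasure
  have h1 := hπ.integrable_fst (hf.integrable _)
  have h2 := hπ.integrable_snd (hf.integrable _)
  have : markovOp κ f x - markovOp κ f y = ∫ z, (f z.1 - f z.2) ∂π := by
    rw [integral_sub h1 h2, hπ.integral_fst hf.1, hπ.integral_snd hf.1]; rfl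
  rw [this]
  exact (abs_integral_le_integral_abs).trans (integral_mono (h1.sub h2).abs hg hfg)

/-- Cauchy-Schwarz for square roots. -/
theorem integral_sqrt_mul_le {Y : Type*} [MeasurableSpace Y] {μ : Measure Y} {u v : Y → ℝ}
    (hu0 : ∀ y, 0 ≤ u y) (hv0 : ∀ y, 0 ≤ v y) (hu : Integrable u μ) (hv : Integrable v μ) :
    Integrable (fun y => √(u y * v y)) μ ∧
      ∫ y, √(u y * v y) ∂μ ≤ √((∫ y, u y ∂μ) * ∫ y, v y ∂μ) := by
  have hm : ∀ {w : Y → ℝ}, (∀ y, 0 ≤ w y) → Integrable w μ →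
      MemLp (fun y => √(w y)) (ENNReal.ofReal 2) μ := by
    intro w hw0 hw
    have h2 : ENNReal.ofReal 2 = 2 := by norm_num
    rw [h2, memLp_two_iff_integrable_sq
      (Real.continuous_sqrt.comp_aestronglyMeasurable hw.aestronglyMeasurable)]
    simpa [Real.sq_sqrt, hw0] using hw
  have hU := hm hu0 hu
  have hV := hm hv0 hv
  have h2 : ENNReal.ofReal 2 = 2 := by norm_num
  have key := integral_mul_le_Lp_mul_Lq_of_nonneg (μ := μ) Real.HolderConjugate.two_two
    (ae_of_all _ fun y => Real.sqrt_nonneg (u y)) (ae_of_all _ fun y => Real.sqrt_nonneg (v y))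
    hU hV
  have hs : ∀ y, √(u y * v y) = √(u y) * √(v y) := fun y => Real.sqrt_mul (hu0 y) _
  simp only [hs]
  rw [h2] at hU hV
  refine ⟨hU.integrable_mul hV, ?_⟩
  rw [Real.sqrt_mul (integral_nonneg hu0)]
  rw [Real.sqrt_eq_rpow (∫ y, u y ∂μ), Real.sqrt_eq_rpow (∫ y, v y ∂μ)]
  simpa [Real.sq_sqrt, hu0, hv0] using key

/-- `V` is a Lyapunov function of the kernel: `∫ V dκ(x, ·) ≤ q V(x) + C` with `q < 1`. -/
structure IsLyapunov (κ : Kernel X X) (V : X → ℝ) (q C : ℝ) : Prop where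
  measurable : Measurable V
  one_le : ∀ x, 1 ≤ V x
  integrable : ∀ x, Integrable V (κ x)
  bound : ∀ x, ∫ y, V y ∂κ x ≤ q * V x + C
  q_pos : 0 < q
  q_lt : q < 1
  C_nonneg : 0 ≤ C

section Lyapunov

variable {κ : Kernel X X} {V : X → ℝ} {q C : ℝ}

theorem IsLyapunov.integral_coupling (hV : IsLyapunov κ V q C) {x y : X}
    {π : Measure (X × X)} (hπ : IsCoupling π (κ x) (κ y)) :
    Integrable (fun z => V z.1 + V z.2) π ∧
      ∫ z, (V z.1 + V z.2) ∂π ≤ q * (V x + V y) + 2 * C := by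
  have h1 := hπ.integrable_fst (hV.integrable x)
  have h2 := hπ.integrable_snd (hV.integrable y)
  refine ⟨h1.add h2, ?_⟩
  rw [integral_add h1 h2, hπ.integral_fst hV.measurable, hπ.integral_snd hV.measurable]
  linarith [hV.bound x, hV.bound y]

theorem IsLyapunov.integral_affine [IsMarkovKernel κ] (hV : IsLyapunov κ V q C) {x y : X}
    {π : Measure (X × X)} (hπ : IsCoupling π (κ x) (κ y)) (A : ℝ) {b : ℝ} (hb : 0 ≤ b) :
    Integrable (fun z => A + b * (V z.1 + V z.2)) π ∧
      ∫ z, (A + b * (V z.1 + V z.2)) ∂π ≤ A + b * (q * (V x + V y) + 2 * C) := by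
  have := hπ.isProbabilityMeasure
  obtain ⟨h1, h2⟩ := hV.integral_coupling hπ
  refine ⟨(integrable_const A).add (h1.const_mul b), ?_⟩
  rw [integral_add (integrable_const A) (h1.const_mul b), integral_const_mul]
  simp only [integral_const, probReal_univ, smul_eq_mul, one_mul]
  gcongr

theorem IsLyapunov.two_le_add (hV : IsLyapunov κ V q C) (x y : X) : 2 ≤ V x + V y := by
  linarith [hV.one_le x, hV.one_le y]

/-- Square-root increments against the Lyapunov function are preserved by the Markov operator, the
linear coefficient being multiplied by `q`. -/
theorem IsLyapunov.markovOp_sqrt [IsMarkovKernel κ] (hV : IsLyapunov κ V q C) {f : X → ℝ}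
    (hf : BddMeas f)
    {A b : ℝ} (hA : 0 ≤ A) (hb : 0 ≤ b) (h : ∀ x y, |f x - f y| ≤ √(A + b * (V x + V y)))
    (x y : X) :
    |markovOp κ f x - markovOp κ f y| ≤ √(A + 2 * b * C + b * q * (V x + V y)) := by
  have hπ := isCoupling_prod (κ x) (κ y)
  have := hπ.isProbabilityMeasure
  obtain ⟨h1, h2⟩ := hV.integral_affine hπ A hb
  have h0 : ∀ z : X × X, 0 ≤ A + b * (V z.1 + V z.2) := fun z => by
    have := hV.two_le_add z.1 z.2
    positivity
  obtain ⟨h3, h4⟩ := integral_sqrt_mul_le (fun _ : X × X => zero_le_one) h0 (integrable_const 1) h1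
  simp only [one_mul] at h3 h4
  refine (hπ.abs_markovOp_sub_le hf h3 fun z => h z.1 z.2).trans (h4.trans ?_)
  apply Real.sqrt_le_sqrt
  simp only [integral_const, probReal_univ, smul_eq_mul, one_mul]
  linarith

/-- The bound `√(1 + b (V + V))` for the increments is preserved by the iterates up to an additive
constant of order `b`, uniformly in their number. -/
theorem IsLyapunov.iterate_sqrt [IsMarkovKernel κ] (hV : IsLyapunov κ V q C) {f : X → ℝ}
    (hf : BddMeas f)
    {b : ℝ} (hb : 0 ≤ b) (h : ∀ x y, |f x - f y| ≤ √(1 + b * (V x + V y))) (n : ℕ) (x y : X) :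
    |(markovOp κ)^[n] f x - (markovOp κ)^[n] f y|
      ≤ √(1 + 2 * b * (C / (1 - q)) + b * q ^ n * (V x + V y)) := by
  have hq : 0 < 1 - q := by linarith [hV.q_lt]
  have hC := hV.C_nonneg
  have hq0 := hV.q_pos
  -- the additive constants form a geometric sum
  have key : ∀ x y, |(markovOp κ)^[n] f x - (markovOp κ)^[n] f y|
      ≤ √(1 + 2 * b * (C / (1 - q)) * (1 - q ^ n) + b * q ^ n * (V x + V y)) := by
    induction n with
    | zero => simpa using h
    | succ n ih =>
      intro x y
      rw [Function.iterate_succ_apply']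
      have hqn : q ^ n ≤ 1 := pow_le_one₀ hq0.le hV.q_lt.le
      refine (hV.markovOp_sqrt (hf.iterate n) ?_ (by positivity) ih x y).trans (le_of_eq ?_)
      · have : 0 ≤ 1 - q ^ n := by linarith
        positivity
      · congr 1
        field_simp
        ring
  refine (key x y).trans (Real.sqrt_le_sqrt ?_)
  have h1 : 0 ≤ 2 * b * (C / (1 - q)) := by positivity
  have h2 : 0 ≤ q ^ n := by positivity
  nlinarith [mul_nonneg h1 h2]

end Lyapunov

/-- Pairs in `A` are brought together by `n` steps of the chain, in dual form: the increments over
`A` of the `n`-th image of a function which is `1`-Lipschitz for `√(d (1 + β (V + V)))` stay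
below `1` by a definite amount, up to a term of order `β`. -/
def SmallAt (κ : Kernel X X) (V : X → ℝ) (d : X → X → ℝ) (n : ℕ) (A : Set (X × X)) : Prop :=
  ∃ θ c : ℝ, 0 < θ ∧ θ ≤ 1 ∧ 0 ≤ c ∧ ∀ β : ℝ, 0 < β → β ≤ 1 → ∀ f : X → ℝ, BddMeas f →
    (∀ x y, |f x - f y| ≤ √(d x y * (1 + β * (V x + V y)))) →
    ∀ x y, (x, y) ∈ A → |(markovOp κ)^[n] f x - (markovOp κ)^[n] f y| ≤ 1 - θ + β * c

section Small

variable {κ : Kernel X X} {V : X → ℝ} {q C : ℝ} {d : X → X → ℝ}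

theorem SmallAt.mono {n : ℕ} {A B : Set (X × X)} (h : SmallAt κ V d n B) (hAB : A ⊆ B) :
    SmallAt κ V d n A := by
  obtain ⟨θ, c, h1, h2, h3, h4⟩ := h
  exact ⟨θ, c, h1, h2, h3, fun β hβ hβ1 f hf hL x y hxy => h4 β hβ hβ1 f hf hL x y (hAB hxy)⟩

theorem smallAt_zero (hV : IsLyapunov κ V q C) {A : Set (X × X)} {R : ℝ}
    (hA : ∀ x y, (x, y) ∈ A → d x y ≤ 1 / 2 ∧ V x + V y ≤ R) : SmallAt κ V d 0 A := by
  refine ⟨1 / 4, |R|, by norm_num, by norm_num, abs_nonneg R, fun β hβ _ f hf hL x y hxy => ?_⟩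
  obtain ⟨h1, h2⟩ := hA x y hxy
  have hR : V x + V y ≤ |R| := h2.trans (le_abs_self R)
  have h3 := hV.two_le_add x y
  refine (hL x y).trans ?_
  have h4 : d x y * (1 + β * (V x + V y)) ≤ 1 / 2 * (1 + β * |R|) := by
    have h5 : 1 + β * (V x + V y) ≤ 1 + β * |R| := by gcongr
    have h6 : 0 ≤ 1 + β * (V x + V y) := by positivity
    nlinarith
  have h7 : 0 ≤ β * |R| := by positivity
  rw [Real.sqrt_le_iff]
  constructor
  · linarith
  · nlinarith

/-- If from each pair of `A` one step of a suitable coupling leads to `B` with probability bounded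
below, and pairs in `B` are brought together in `n` steps, then pairs in `A` are brought together
in `n + 1` steps. -/
theorem SmallAt.step [IsMarkovKernel κ] (hV : IsLyapunov κ V q C) (hd1 : ∀ x y, d x y ≤ 1)
    {n : ℕ} {A B : Set (X × X)} (hB : MeasurableSet B) {R : ℝ}
    (hA : ∀ x y, (x, y) ∈ A → V x + V y ≤ R) {ε : ℝ} (hε : 0 < ε)
    (hAB : ∀ x y, (x, y) ∈ A → ∃ π : Measure (X × X), IsCoupling π (κ x) (κ y) ∧ ε ≤ π.real B)
    (h : SmallAt κ V d n B) : SmallAt κ V d (n + 1) A := by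
  obtain ⟨θ, c, hθ, hθ1, hc, hf0⟩ := h
  have hq : 0 < 1 - q := by linarith [hV.q_lt]
  have hq0 := hV.q_pos
  have hC := hV.C_nonneg
  set C1 := C / (1 - q) with hC1
  have hC1n : 0 ≤ C1 := by positivity
  refine ⟨θ * min ε 1, c + C1 + (|R| + 2 * C), by positivity,
    mul_le_one₀ hθ1 (by positivity) (min_le_right _ _), by positivity,
    fun β hβ hβ1 f hf hL x y hxy => ?_⟩
  obtain ⟨π, hπ, hπB⟩ := hAB x y hxy
  have := hπ.isProbabilityMeasure
  rw [Function.iterate_succ_apply']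
  set g := (markovOp κ)^[n] f with hg
  have hgb : ∀ a b, |g a - g b| ≤ 1 + β * C1 + β * (V a + V b) := by
    intro a b
    have hs : ∀ x y, |f x - f y| ≤ √(1 + β * (V x + V y)) := fun x y => by
      refine (hL x y).trans (Real.sqrt_le_sqrt ?_)
      have := hV.two_le_add x y
      have h6 : 0 ≤ 1 + β * (V x + V y) := by positivity
      nlinarith [hd1 x y]
    refine (hV.iterate_sqrt hf hβ.le hs n a b).trans ?_
    have h3 := hV.two_le_add a b
    have hqn : q ^ n ≤ 1 := pow_le_one₀ hq0.le hV.q_lt.le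
    have h4 : β * q ^ n * (V a + V b) ≤ β * (V a + V b) := by
      have : β * q ^ n ≤ β * 1 := by gcongr
      nlinarith
    have h5 : 0 ≤ β * C1 := by positivity
    have h6 : 0 ≤ β * (V a + V b) := by positivity
    rw [Real.sqrt_le_iff]
    constructor
    · linarith
    · nlinarith
  have hind : Integrable (B.indicator fun _ => θ) π :=
    (integrable_const θ).indicator hB
  obtain ⟨hi1, hi2⟩ := hV.integral_affine hπ (1 + β * (c + C1)) hβ.le
  have hfin := hπ.abs_markovOp_sub_le (hf.iterate n)
    (g := fun z => (1 + β * (c + C1) + β * (V z.1 + V z.2)) - B.indicator (fun _ => θ) z)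
    (hi1.sub hind) (fun z => by
      by_cases hz : z ∈ B
      · have h1 := hf0 β hβ hβ1 f hf hL z.1 z.2 hz
        have h3 := hV.two_le_add z.1 z.2
        have h5 : 0 ≤ β * C1 := by positivity
        have h6 : 0 ≤ β * (V z.1 + V z.2) := by positivity
        simp only [Set.indicator_of_mem hz]
        linarith
      · have h1 := hgb z.1 z.2
        have h5 : 0 ≤ β * c := by positivity
        simp only [Set.indicator_of_notMem hz]
        linarith)
  refine hfin.trans ?_
  rw [integral_sub hi1 hind, integral_indicator_const _ hB, smul_eq_mul]
  have hR : V x + V y ≤ |R| := (hA x y hxy).trans (le_abs_self R)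
  have h7 : min ε 1 * θ ≤ π.real B * θ := by
    gcongr
    exact (min_le_left _ _).trans hπB
  have h8 : q * (V x + V y) ≤ |R| := by
    have h3 := hV.two_le_add x y
    nlinarith [hV.q_lt]
  have h9 : β * (q * (V x + V y) + 2 * C) ≤ β * (|R| + 2 * C) := by gcongr
  linarith

end Small

section Contraction

variable {κ : Kernel X X} {V : X → ℝ} {q C : ℝ} {d : X → X → ℝ}

/-- One step of the Markov operator on functions whose increments are controlled by
`√(d (1 + β (V + V)))`: no increment grows by much, and those over pairs at distance less than `1`
are reduced. -/
theorem markovOp_contraction [IsMarkovKernel κ] (hV : IsLyapunov κ V q C)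
    (hdm : Measurable (Function.uncurry d)) (hd0 : ∀ x y, 0 ≤ d x y) (hd1 : ∀ x y, d x y ≤ 1)
    (hdc : ∀ x y, d x y < 1 → ∃ π : Measure (X × X), IsCoupling π (κ x) (κ y) ∧
      ∫ z, d z.1 z.2 ∂π ≤ 1 / 2 * d x y)
    {β L : ℝ} (hβ : 0 < β) (hL : 0 < L) {f : X → ℝ} (hf : BddMeas f)
    (h : ∀ x y, |f x - f y| ≤ √(L * (d x y * (1 + β * (V x + V y))))) (x y : X) :
    (d x y < 1 → |markovOp κ f x - markovOp κ f y|
        ≤ √(L * (1 / 2 * (1 + 2 * β * C)) * (d x y * (1 + β * (V x + V y))))) ∧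
      |markovOp κ f x - markovOp κ f y|
        ≤ √(L * (1 + 2 * β * C) * (d x y * (1 + β * (V x + V y)))) := by
  have hC := hV.C_nonneg
  have hVxy := hV.two_le_add x y
  have hW : ∀ z : X × X, 0 ≤ 1 + β * (V z.1 + V z.2) := fun z => by
    have := hV.two_le_add z.1 z.2
    positivity
  -- the growth of the Lyapunov factor in one step
  have hgrow : 1 + β * (q * (V x + V y) + 2 * C)
      ≤ (1 + 2 * β * C) * (1 + β * (V x + V y)) := by
    have h1 : q * (V x + V y) ≤ V x + V y := by nlinarith [hV.q_lt]
    have h2 : β * (q * (V x + V y)) ≤ β * (V x + V y) := by gcongr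
    have h3 : 0 ≤ β * C * (β * (V x + V y)) := by positivity
    nlinarith
  have hnear : d x y < 1 → |markovOp κ f x - markovOp κ f y|
      ≤ √(L * (1 / 2 * (1 + 2 * β * C)) * (d x y * (1 + β * (V x + V y)))) := by
    intro hxy
    obtain ⟨π, hπ, hπd⟩ := hdc x y hxy
    have := hπ.isProbabilityMeasure
    have hdi : Integrable (fun z : X × X => d z.1 z.2) π :=
      Integrable.of_bound hdm.aestronglyMeasurable 1 (ae_of_all _ fun z => by
        simpa [Real.norm_eq_abs, abs_of_nonneg (hd0 z.1 z.2)] using hd1 z.1 z.2)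
    obtain ⟨h1, h2⟩ := hV.integral_affine hπ 1 hβ.le
    obtain ⟨h3, h4⟩ := integral_sqrt_mul_le (fun z : X × X => hd0 z.1 z.2) hW hdi h1
    refine (hπ.abs_markovOp_sub_le hf (h3.const_mul √L) fun z => ?_).trans ?_
    · rw [← Real.sqrt_mul hL.le]
      exact h z.1 z.2
    · rw [integral_const_mul]
      refine (mul_le_mul_of_nonneg_left h4 (Real.sqrt_nonneg L)).trans ?_
      rw [← Real.sqrt_mul hL.le]
      apply Real.sqrt_le_sqrt
      have h5 : (∫ z, d z.1 z.2 ∂π) * ∫ z, (1 + β * (V z.1 + V z.2)) ∂π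
          ≤ (1 / 2 * d x y) * ((1 + 2 * β * C) * (1 + β * (V x + V y))) :=
        mul_le_mul hπd (h2.trans hgrow) (integral_nonneg hW)
          (by have := hd0 x y; positivity)
      calc _ ≤ L * ((1 / 2 * d x y) * ((1 + 2 * β * C) * (1 + β * (V x + V y)))) := by gcongr
        _ = _ := by ring
  refine ⟨hnear, ?_⟩
  rcases lt_or_ge (d x y) 1 with hxy | hxy
  · refine (hnear hxy).trans (Real.sqrt_le_sqrt ?_)
    have h1 : 0 ≤ d x y * (1 + β * (V x + V y)) := mul_nonneg (hd0 x y) (by positivity)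
    gcongr
    have : 0 ≤ β * C := by positivity
    linarith
  · have h1 := hV.markovOp_sqrt hf (A := L) (b := L * β) hL.le (by positivity)
      (fun a b => (h a b).trans (Real.sqrt_le_sqrt ?_)) x y
    · refine h1.trans (Real.sqrt_le_sqrt ?_)
      rw [le_antisymm (hd1 x y) hxy]
      calc _ = L * (1 + β * (q * (V x + V y) + 2 * C)) := by ring
        _ ≤ L * ((1 + 2 * β * C) * (1 + β * (V x + V y))) := by gcongr
        _ = _ := by ring
    · calc L * (d a b * (1 + β * (V a + V b))) ≤ L * (1 * (1 + β * (V a + V b))) := by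
            gcongr
            · exact hW (a, b)
            · exact hd1 a b
        _ = _ := by ring

theorem iterate_growth [IsMarkovKernel κ] (hV : IsLyapunov κ V q C)
    (hdm : Measurable (Function.uncurry d)) (hd0 : ∀ x y, 0 ≤ d x y) (hd1 : ∀ x y, d x y ≤ 1)
    (hdc : ∀ x y, d x y < 1 → ∃ π : Measure (X × X), IsCoupling π (κ x) (κ y) ∧
      ∫ z, d z.1 z.2 ∂π ≤ 1 / 2 * d x y)
    {β L : ℝ} (hβ : 0 < β) (hL : 0 < L) {f : X → ℝ} (hf : BddMeas f)
    (h : ∀ x y, |f x - f y| ≤ √(L * (d x y * (1 + β * (V x + V y))))) (n : ℕ) (x y : X) :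
    |(markovOp κ)^[n] f x - (markovOp κ)^[n] f y|
      ≤ √(L * (1 + 2 * β * C) ^ n * (d x y * (1 + β * (V x + V y)))) := by
  have hC := hV.C_nonneg
  induction n generalizing x y with
  | zero => simpa using h x y
  | succ n ih =>
    rw [Function.iterate_succ_apply']
    refine ((markovOp_contraction hV hdm hd0 hd1 hdc hβ (by positivity) (hf.iterate n) ih
      x y).2).trans (le_of_eq ?_)
    rw [pow_succ, mul_assoc L]

/-- The contraction behind the weak Harris theorem: for small `β`, a fixed number of steps of the
Markov operator strictly reduces the Lipschitz constant for `√(d (1 + β (V + V)))`. The three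
cases are: pairs at distance less than `1`, where the coupling contracts `d`; pairs with a large
value of `V`, where the Lyapunov property gains a factor of order `β`; and the remaining pairs,
where the smallness condition applies. -/
theorem exists_contraction [IsMarkovKernel κ] (hV : IsLyapunov κ V q C)
    (hdm : Measurable (Function.uncurry d)) (hd0 : ∀ x y, 0 ≤ d x y) (hd1 : ∀ x y, d x y ≤ 1)
    (hdc : ∀ x y, d x y < 1 → ∃ π : Measure (X × X), IsCoupling π (κ x) (κ y) ∧
      ∫ z, d z.1 z.2 ∂π ≤ 1 / 2 * d x y)
    (hsmall : ∀ R : ℝ, ∃ n, SmallAt κ V d (n + 1) {z | V z.1 + V z.2 ≤ R}) :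
    ∃ (β r : ℝ) (m : ℕ), 0 < β ∧ β ≤ 1 ∧ 0 < r ∧ r < 1 ∧ 1 ≤ m ∧
      ∀ f : X → ℝ, BddMeas f →
        (∀ x y, |f x - f y| ≤ √(d x y * (1 + β * (V x + V y)))) →
        ∀ x y, |(markovOp κ)^[m] f x - (markovOp κ)^[m] f y|
          ≤ √(r * (d x y * (1 + β * (V x + V y)))) := by
  have hC := hV.C_nonneg
  have hq0 := hV.q_pos
  have hq : 0 < 1 - q := by linarith [hV.q_lt]
  set C1 := C / (1 - q) with hC1
  have hC1n : 0 ≤ C1 := by positivity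
  obtain ⟨n, θ, c, hθ, hθ1, hc, hs⟩ := hsmall (4 * C1 / (1 - q))
  -- all the requirements on `β` hold near `0`
  have hev : ∀ᶠ β : ℝ in 𝓝[>] 0, (1 + 2 * β * C) ^ (n + 1) < 3 / 2 ∧ β * c < θ / 2 ∧ β < 1 := by
    apply Filter.Eventually.filter_mono nhdsWithin_le_nhds
    refine Filter.Eventually.and ?_ (Filter.Eventually.and ?_ ?_)
    · have : ContinuousAt (fun β : ℝ => (1 + 2 * β * C) ^ (n + 1)) 0 := by fun_prop
      exact this.eventually_lt_const (by norm_num)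
    · have : ContinuousAt (fun β : ℝ => β * c) 0 := by fun_prop
      exact this.eventually_lt_const (by simpa using hθ)
    · exact eventually_lt_nhds one_pos
  obtain ⟨β, ⟨hβ1, hβ2, hβ3⟩, hβ⟩ := (hev.and self_mem_nhdsWithin).exists
  have hθ' : 0 < β * (1 - q) / 4 := by positivity
  have hθ'' : β * (1 - q) / 4 < 1 := by
    have : β * (1 - q) < 1 * 1 := mul_lt_mul'' hβ3 (by linarith) hβ.le hq.le
    linarith
  refine ⟨β, max (3 / 4) (max (1 - β * (1 - q) / 4) (1 - θ / 2)), n + 1, hβ, hβ3.le,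
    lt_max_of_lt_left (by norm_num), max_lt (by norm_num) (max_lt (by linarith) (by linarith)),
    by lia, fun f hf hL x y => ?_⟩
  set r := max (3 / 4 : ℝ) (max (1 - β * (1 - q) / 4) (1 - θ / 2)) with hr
  have hr1 : 3 / 4 ≤ r := le_max_left _ _
  have hr2 : 1 - β * (1 - q) / 4 ≤ r := (le_max_left _ _).trans (le_max_right _ _)
  have hr3 : 1 - θ / 2 ≤ r := (le_max_right _ _).trans (le_max_right _ _)
  have hL' : ∀ x y, |f x - f y| ≤ √(1 * (d x y * (1 + β * (V x + V y)))) := by simpa using hL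
  have hVxy := hV.two_le_add x y
  have hW : 0 ≤ 1 + β * (V x + V y) := by positivity
  rcases lt_or_ge (d x y) 1 with hxy | hxy
  · rw [Function.iterate_succ_apply']
    refine ((markovOp_contraction hV hdm hd0 hd1 hdc hβ (by positivity) (hf.iterate n)
      (iterate_growth hV hdm hd0 hd1 hdc hβ one_pos hf hL' n) x y).1 hxy).trans
      (Real.sqrt_le_sqrt ?_)
    refine mul_le_mul_of_nonneg_right ?_ (mul_nonneg (hd0 x y) hW)
    have : 1 * (1 + 2 * β * C) ^ n * (1 / 2 * (1 + 2 * β * C))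
        = 1 / 2 * (1 + 2 * β * C) ^ (n + 1) := by ring
    rw [this]
    linarith
  · have hdxy : d x y = 1 := le_antisymm (hd1 x y) hxy
    rw [hdxy, one_mul]
    rcases le_or_gt (V x + V y) (4 * C1 / (1 - q)) with hR | hR
    · have h1 := hs β hβ hβ3.le f hf hL x y hR
      refine h1.trans ?_
      apply Real.le_sqrt_of_sq_le
      have h2 : r * 1 ≤ r * (1 + β * (V x + V y)) := by
        gcongr
        have : 0 ≤ β * (V x + V y) := by positivity
        linarith
      have h3 : 0 ≤ 1 - θ + β * c := by
        have : 0 ≤ β * c := by positivity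
        linarith
      nlinarith
    · have h1 := hV.iterate_sqrt hf hβ.le (fun x y => (hL x y).trans (Real.sqrt_le_sqrt (by
        have h3 := hV.two_le_add x y
        have h6 : 0 ≤ 1 + β * (V x + V y) := by positivity
        nlinarith [hd1 x y]))) (n + 1) x y
      refine h1.trans (Real.sqrt_le_sqrt ?_)
      rw [div_lt_iff₀ hq] at hR
      have h2 : β * q ^ (n + 1) * (V x + V y) ≤ β * q * (V x + V y) := by
        gcongr
        exact pow_le_of_le_one hq0.le hV.q_lt.le (by lia)
      have h3 : β * (4 * C1) ≤ β * ((V x + V y) * (1 - q)) := by gcongr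
      have h4 : (1 - β * (1 - q) / 4) * (1 + β * (V x + V y)) ≤ r * (1 + β * (V x + V y)) := by
        gcongr
      have h5 : β * (1 - q) / 4 * (1 + β * (V x + V y))
          ≤ β * (1 - q) / 4 * (2 * (V x + V y)) := by
        gcongr
        nlinarith
      nlinarith

/-- The weak Harris theorem: exponential decay of the increments of the iterates of the Markov
operator, for functions which are `1`-Lipschitz with respect to `d`. -/
theorem weak_harris [IsMarkovKernel κ] (hV : IsLyapunov κ V q C)
    (hdm : Measurable (Function.uncurry d)) (hd0 : ∀ x y, 0 ≤ d x y) (hd1 : ∀ x y, d x y ≤ 1)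
    (hdc : ∀ x y, d x y < 1 → ∃ π : Measure (X × X), IsCoupling π (κ x) (κ y) ∧
      ∫ z, d z.1 z.2 ∂π ≤ 1 / 2 * d x y)
    (hsmall : ∀ R : ℝ, ∃ n, SmallAt κ V d (n + 1) {z | V z.1 + V z.2 ≤ R}) :
    ∃ E a : ℝ, 0 < E ∧ 0 < a ∧ ∀ f : X → ℝ, BddMeas f → (∀ x y, |f x - f y| ≤ d x y) →
      ∀ (n : ℕ) (x y : X), |(markovOp κ)^[n] f x - (markovOp κ)^[n] f y|
        ≤ E * Real.exp (-a * n) * (V x + V y) := by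
  obtain ⟨β, r, m, hβ, hβ1, hr, hr1, hm, hcon⟩ := exists_contraction hV hdm hd0 hd1 hdc hsmall
  have hC := hV.C_nonneg
  set K := 1 + 2 * β * C with hK
  have hK1 : 1 ≤ K := by
    have : 0 ≤ β * C := by positivity
    linarith
  -- the contraction for an arbitrary Lipschitz constant, by scaling
  have hscale : ∀ L : ℝ, 0 < L → ∀ f : X → ℝ, BddMeas f →
      (∀ x y, |f x - f y| ≤ √(L * (d x y * (1 + β * (V x + V y))))) →
      ∀ x y, |(markovOp κ)^[m] f x - (markovOp κ)^[m] f y|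
        ≤ √(L * r * (d x y * (1 + β * (V x + V y)))) := by
    intro L hL f hf hfL x y
    have hsL : 0 < √L := Real.sqrt_pos.mpr hL
    have hb : BddMeas fun x => (√L)⁻¹ * f x := by
      obtain ⟨h1, B, hB⟩ := hf
      refine ⟨h1.const_mul _, (√L)⁻¹ * B, fun x => ?_⟩
      rw [abs_mul, abs_of_pos (inv_pos.mpr hsL)]
      gcongr
      exact hB x
    have h := hcon (fun x => (√L)⁻¹ * f x) hb (fun x y => by
      rw [← mul_sub, abs_mul, abs_of_pos (inv_pos.mpr hsL), inv_mul_le_iff₀ hsL,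
        ← Real.sqrt_mul hL.le]
      exact hfL x y) x y
    rw [iterate_const_mul] at h
    simp only at h
    rw [← mul_sub, abs_mul, abs_of_pos (inv_pos.mpr hsL), inv_mul_le_iff₀ hsL,
      ← Real.sqrt_mul hL.le] at h
    rwa [mul_assoc]
  have hiter : ∀ (k j : ℕ) (f : X → ℝ), BddMeas f →
      (∀ x y, |f x - f y| ≤ √(1 * (d x y * (1 + β * (V x + V y))))) →
      ∀ x y, |(markovOp κ)^[m * k + j] f x - (markovOp κ)^[m * k + j] f y|
        ≤ √(K ^ j * r ^ k * (d x y * (1 + β * (V x + V y)))) := by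
    intro k j f hf hfL
    induction k with
    | zero => simpa using iterate_growth hV hdm hd0 hd1 hdc hβ one_pos hf hfL j
    | succ k ih =>
      intro x y
      have h := hscale (K ^ j * r ^ k) (by positivity) _ (hf.iterate (m * k + j)) ih x y
      rw [← Function.iterate_add_apply] at h
      have e : m * (k + 1) + j = m + (m * k + j) := by ring
      rw [e]
      refine h.trans (le_of_eq ?_)
      rw [pow_succ, mul_assoc (K ^ j)]
  have hm0 : (0 : ℝ) < m := by exact_mod_cast hm
  have hs0 : 0 < √r := Real.sqrt_pos.mpr hr
  have hs1 : √r < 1 := by rw [Real.sqrt_lt' one_pos]; simpa using hr1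
  have hlog : Real.log √r < 0 := Real.log_neg hs0 hs1
  refine ⟨√(K ^ m) * Real.exp (-Real.log √r) * 2, -Real.log √r / m, by positivity,
    by apply div_pos _ hm0; linarith, fun f hf hfd n x y => ?_⟩
  have h := hiter (n / m) (n % m) f hf (fun x y => by
    rw [one_mul]
    have h1 := hd0 x y
    have h2 := hd1 x y
    have h3 := hV.two_le_add x y
    have h4 : 0 ≤ β * (V x + V y) := by positivity
    refine (hfd x y).trans (Real.le_sqrt_of_sq_le ?_)
    nlinarith [mul_nonneg h1 h4]) x y
  rw [Nat.div_add_mod] at h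
  refine h.trans ?_
  have h3 := hV.two_le_add x y
  have hW : 0 ≤ β * (V x + V y) := by positivity
  rw [Real.sqrt_mul (by positivity), Real.sqrt_mul (by positivity)]
  have hkn : -Real.log √r / m * n ≤ -Real.log √r * ((n / m : ℕ) + 1 : ℝ) := by
    rw [div_mul_eq_mul_div, div_le_iff₀ hm0]
    have : (n : ℝ) ≤ ((n / m : ℕ) + 1 : ℝ) * m := by
      have h1 : n ≤ (n / m + 1) * m := by
        have := Nat.div_add_mod n m
        have := Nat.mod_lt n (show 0 < m by lia)
        nlinarith
      exact_mod_cast h1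
    nlinarith
  have hrk : √(r ^ (n / m)) ≤ Real.exp (-Real.log √r) * Real.exp (-(-Real.log √r / m) * n) := by
    have e1 : √(r ^ (n / m)) = (√r) ^ (n / m) := by
      rw [Real.sqrt_eq_iff_mul_self_eq (by positivity) (by positivity), ← mul_pow,
        Real.mul_self_sqrt hr.le]
    have e2 : (√r) ^ (n / m) = Real.exp (Real.log √r * (n / m : ℕ)) := by
      rw [mul_comm, Real.exp_nat_mul, Real.exp_log hs0]
    rw [e1, e2, ← Real.exp_add]
    apply Real.exp_le_exp.mpr
    linarith
  have hKj : √(K ^ (n % m)) ≤ √(K ^ m) :=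
    Real.sqrt_le_sqrt (pow_le_pow_right₀ hK1 (Nat.mod_lt n (by lia)).le)
  have hlast : √(d x y * (1 + β * (V x + V y))) ≤ 2 * (V x + V y) := by
    rw [Real.sqrt_le_iff]
    refine ⟨by linarith, ?_⟩
    have h5 : β * (V x + V y) ≤ V x + V y := by nlinarith
    nlinarith [hd0 x y, hd1 x y]
  calc _ ≤ √(K ^ m) * (Real.exp (-Real.log √r) * Real.exp (-(-Real.log √r / m) * n))
        * (2 * (V x + V y)) := by gcongr
    _ = _ := by ring

end Contraction

end WeakHarris

/-! ### Stationary measures from exponential decay of increments -/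

section Stationary

section Push

variable {X : Type*} [MeasurableSpace X] {κ : Kernel X X}

theorem integral_bind_eq [IsMarkovKernel κ] (μ : Measure X) [IsProbabilityMeasure μ]
    {f : X → ℝ} (hf : BddMeas f) :
    ∫ x, f x ∂(μ.bind κ) = ∫ x, markovOp κ f x ∂μ := by
  have : IsProbabilityMeasure (μ.bind κ) :=
    isProbabilityMeasure_bind κ.measurable.aemeasurable (ae_of_all _ fun x => inferInstance)
  have hi := hf.integrable (μ.bind κ)
  rw [Measure.comp_eq_comp_const_apply] at hi ⊢
  rw [Kernel.integral_comp hi]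
  simp [markovOp]

/-- The law at time `n` of the chain with initial law `μ`. -/
noncomputable def lawAt (κ : Kernel X X) (μ : Measure X) (n : ℕ) : Measure X :=
  (fun ν : Measure X => ν.bind κ)^[n] μ

theorem lawAt_succ (μ : Measure X) (n : ℕ) : lawAt κ μ (n + 1) = (lawAt κ μ n).bind κ :=
  Function.iterate_succ_apply' _ _ _

instance isProbabilityMeasure_lawAt [IsMarkovKernel κ] (μ : Measure X)
    [IsProbabilityMeasure μ] (n : ℕ) :
    IsProbabilityMeasure (lawAt κ μ n) := by
  induction n with
  | zero => exact ‹IsProbabilityMeasure μ›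
  | succ n ih =>
    rw [lawAt_succ]
    exact isProbabilityMeasure_bind κ.measurable.aemeasurable (ae_of_all _ fun x => inferInstance)

theorem integral_lawAt [IsMarkovKernel κ] (μ : Measure X) [IsProbabilityMeasure μ]
    {f : X → ℝ} (hf : BddMeas f) (n : ℕ) :
    ∫ x, f x ∂(lawAt κ μ n) = ∫ x, (markovOp κ)^[n] f x ∂μ := by
  induction n generalizing f with
  | zero => rfl
  | succ n ih => rw [lawAt_succ, integral_bind_eq _ hf, ih hf.markovOp]; rfl

theorem IsLyapunov.lawAt_dirac [IsMarkovKernel κ] {V : X → ℝ} {q C : ℝ}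
    (hV : IsLyapunov κ V q C) (x : X) (n : ℕ) :
    Integrable V (lawAt κ (Measure.dirac x) n) ∧
      ∫ y, V y ∂(lawAt κ (Measure.dirac x) n) ≤ V x + C / (1 - q) := by
  have hq : 0 < 1 - q := by linarith [hV.q_lt]
  have hq0 := hV.q_pos
  have hC := hV.C_nonneg
  have hV0 : ∀ y, 0 ≤ V y := fun y => zero_le_one.trans (hV.one_le y)
  have hC1 : 0 ≤ C / (1 - q) := by positivity
  have hm : Measurable fun y => ENNReal.ofReal (V y) := hV.measurable.ennreal_ofReal
  have key : ∫⁻ y, ENNReal.ofReal (V y) ∂(lawAt κ (Measure.dirac x) n)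
      ≤ ENNReal.ofReal (V x + C / (1 - q)) := by
    induction n with
    | zero =>
      simp only [lawAt, Function.iterate_zero, id]
      rw [lintegral_dirac' _ hm]
      exact ENNReal.ofReal_le_ofReal (by linarith)
    | succ n ih =>
      rw [lawAt_succ, Measure.lintegral_bind κ.measurable.aemeasurable hm.aemeasurable]
      calc ∫⁻ a, ∫⁻ y, ENNReal.ofReal (V y) ∂κ a ∂(lawAt κ (Measure.dirac x) n)
          ≤ ∫⁻ a, (ENNReal.ofReal q * ENNReal.ofReal (V a) + ENNReal.ofReal C)
              ∂(lawAt κ (Measure.dirac x) n) := by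
            refine lintegral_mono fun a => ?_
            rw [← ofReal_integral_eq_lintegral_ofReal (hV.integrable a) (ae_of_all _ hV0),
              ← ENNReal.ofReal_mul hq0.le,
              ← ENNReal.ofReal_add (mul_nonneg hq0.le (hV0 a)) hC]
            exact ENNReal.ofReal_le_ofReal (hV.bound a)
        _ = ENNReal.ofReal q * ∫⁻ a, ENNReal.ofReal (V a) ∂(lawAt κ (Measure.dirac x) n)
              + ENNReal.ofReal C := by
            rw [lintegral_add_right _ measurable_const, lintegral_const_mul _ hm]
            simp
        _ ≤ ENNReal.ofReal q * ENNReal.ofReal (V x + C / (1 - q)) + ENNReal.ofReal C := by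
            gcongr
        _ = ENNReal.ofReal (q * (V x + C / (1 - q)) + C) := by
            rw [← ENNReal.ofReal_mul hq0.le,
              ← ENNReal.ofReal_add (mul_nonneg hq0.le (add_nonneg (hV0 x) hC1)) hC]
        _ ≤ ENNReal.ofReal (V x + C / (1 - q)) := by
            apply ENNReal.ofReal_le_ofReal
            have : q * (C / (1 - q)) + C = C / (1 - q) := by field_simp; ring
            nlinarith [hV0 x]
  have hint : Integrable V (lawAt κ (Measure.dirac x) n) := by
    refine ⟨hV.measurable.aestronglyMeasurable, ?_⟩
    rw [hasFiniteIntegral_iff_ofReal (ae_of_all _ hV0)]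
    exact key.trans_lt ENNReal.ofReal_lt_top
  refine ⟨hint, ?_⟩
  rw [integral_eq_lintegral_of_nonneg_ae (ae_of_all _ hV0) hint.aestronglyMeasurable]
  exact ENNReal.toReal_le_of_le_ofReal (add_nonneg (hV0 x) hC1) key

end Push

variable {X : Type*} [MetricSpace X] [MeasurableSpace X] [BorelSpace X]

/-- Probability measures are determined by the integrals of the Lipschitz functions of the unit
ball. -/
theorem eq_of_forall_lipschitz_integral_eq {μ ν : ProbabilityMeasure X}
    (h : ∀ f : X → ℝ, (∀ x, |f x| ≤ 1) → LipschitzWith 1 f →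
      ∫ x, f x ∂(μ : Measure X) = ∫ x, f x ∂(ν : Measure X)) : μ = ν := by
  have : Tendsto (fun _ : ℕ => μ) atTop (𝓝 ν) := by
    rw [tendsto_iff_forall_lipschitz_integral_tendsto]
    rintro f ⟨B, hB⟩ ⟨L, hL⟩
    have hne : Nonempty X := by
      by_contra hX
      rw [not_nonempty_iff] at hX
      have := measure_univ (μ := (μ : Measure X))
      simp [Set.eq_empty_of_isEmpty] at this
    obtain ⟨x0⟩ := hne
    -- rescaling to a function of the unit ball
    have hB0 : 0 ≤ B := (dist_nonneg).trans (hB x0 x0)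
    set t : ℝ := (1 + |f x0| + B + L)⁻¹ with ht
    have hs : 0 < 1 + |f x0| + B + L := by positivity
    have ht0 : 0 < t := by positivity
    have h1 := h (fun x => t * f x) (fun x => by
      rw [abs_mul, abs_of_pos ht0, ht, inv_mul_le_iff₀ hs]
      have h2 := hB x x0
      rw [Real.dist_eq] at h2
      have h3 := abs_add_le (f x - f x0) (f x0)
      rw [sub_add_cancel] at h3
      have : (0 : ℝ) ≤ L := L.2
      linarith) (by
      apply LipschitzWith.of_dist_le_mul
      intro x y
      rw [Real.dist_eq, ← mul_sub, abs_mul, abs_of_pos ht0, ht, inv_mul_le_iff₀ hs,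
        ← Real.dist_eq]
      refine (hL.dist_le_mul x y).trans ?_
      simp only [NNReal.coe_one, one_mul]
      gcongr
      have := abs_nonneg (f x0)
      linarith)
    rw [integral_const_mul, integral_const_mul] at h1
    rw [mul_left_cancel₀ ht0.ne' h1]
    exact tendsto_const_nhds
  exact tendsto_nhds_unique tendsto_const_nhds this

variable [CompleteSpace X] [SecondCountableTopology X]

theorem isTightMeasureSet_finite (μ : ℕ → Measure X) [∀ n, IsProbabilityMeasure (μ n)]
    (N : ℕ) {ε : ℝ≥0∞} (hε : 0 < ε) : ∃ K, IsCompact K ∧ ∀ n ≤ N, μ n Kᶜ ≤ ε := by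
  have h : ∀ n, ∃ K, IsCompact K ∧ μ n Kᶜ ≤ ε := fun n => by
    obtain ⟨K, hK, h⟩ := isTightMeasureSet_iff_exists_isCompact_measure_compl_le.mp
      (isTightMeasureSet_singleton (μ := μ n)) ε hε
    exact ⟨K, hK, h _ rfl⟩
  choose K hK h using h
  refine ⟨⋃ n ∈ Set.Iic N, K n, (Set.finite_Iic N).isCompact_biUnion fun n _ => hK n,
    fun n hn => (measure_mono ?_).trans (h n)⟩
  exact Set.compl_subset_compl.mpr (Set.subset_biUnion_of_mem (u := K) (Set.mem_Iic.mpr hn))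

/-- A sequence of probability measures which is Cauchy for the dual-Lipschitz distance is tight. -/
theorem isTightMeasureSet_of_cauchy (μ : ℕ → Measure X) [∀ n, IsProbabilityMeasure (μ n)]
    (h : ∀ ε > 0, ∃ N, ∀ n ≥ N, ∀ f : X → ℝ, (∀ x, |f x| ≤ 1) → LipschitzWith 1 f →
      |∫ x, f x ∂μ n - ∫ x, f x ∂μ N| ≤ ε) :
    IsTightMeasureSet (Set.range μ) := by
  -- mass escapes from small neighbourhoods of a compact set only up to `ε`
  have step : ∀ δ : ℝ, 0 < δ → δ ≤ 1 → ∀ ε : ℝ≥0∞, 0 < ε →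
      ∃ K, IsCompact K ∧ ∀ n, μ n (Metric.thickening δ K)ᶜ ≤ ε := by
    intro δ hδ hδ1 ε' hε'
    obtain ⟨ε, hε, hεε'⟩ : ∃ ε : ℝ, 0 < ε ∧ ENNReal.ofReal ε ≤ ε' := by
      obtain ⟨r, hr, hr'⟩ := ENNReal.lt_iff_exists_nnreal_btwn.mp hε'
      exact ⟨r, by exact_mod_cast hr, by simpa using hr'.le⟩
    obtain ⟨N, hN⟩ := h (δ * ε / 2) (by positivity)
    obtain ⟨K, hK, hKN⟩ := isTightMeasureSet_finite μ N
      (ε := ENNReal.ofReal (ε / 2)) (by simpa using hε)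
    refine ⟨K, hK, fun n => le_trans ?_ hεε'⟩
    have hKN' : ∀ n ≤ N, (μ n).real Kᶜ ≤ ε / 2 := fun n hn =>
      ENNReal.toReal_le_of_le_ofReal (by positivity) (hKN n hn)
    rcases le_total n N with hn | hn
    · refine (measure_mono ?_).trans ((hKN n hn).trans (ENNReal.ofReal_le_ofReal (by linarith)))
      exact Set.compl_subset_compl.mpr (Metric.self_subset_thickening hδ K)
    · set g : X → ℝ := fun x => δ * (thickenedIndicator hδ K x : ℝ) with hg
      have hg0 : ∀ x, 0 ≤ g x := fun x => by positivity
      have hgδ : ∀ x, g x ≤ δ := fun x => by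
        have : (thickenedIndicator hδ K x : ℝ) ≤ 1 := by
          exact_mod_cast thickenedIndicator_le_one hδ K x
        simp only [hg]
        nlinarith
      have hgL : LipschitzWith 1 g := by
        apply LipschitzWith.of_dist_le_mul
        intro x y
        have h1 := (lipschitzWith_thickenedIndicator hδ K).dist_le_mul x y
        rw [NNReal.dist_eq] at h1
        simp only [NNReal.coe_inv, Real.coe_toNNReal δ hδ.le] at h1
        rw [Real.dist_eq, ← mul_sub, abs_mul, abs_of_pos hδ]
        calc δ * |(thickenedIndicator hδ K x : ℝ) - thickenedIndicator hδ K y|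
            ≤ δ * (δ⁻¹ * dist x y) := by gcongr
          _ = _ := by simp [mul_inv_cancel_left₀ hδ.ne']
      have hgb : BddMeas g := ⟨hgL.continuous.measurable, δ, fun x => by
        rw [abs_of_nonneg (hg0 x)]; exact hgδ x⟩
      have h1 := hN n hn g (fun x => by
        rw [abs_of_nonneg (hg0 x)]; exact (hgδ x).trans hδ1) hgL
      have hmK : MeasurableSet K := hK.isClosed.measurableSet
      have h2 : δ * (1 - ε / 2) ≤ ∫ x, g x ∂μ N := by
        have h3 : δ * (1 - ε / 2) ≤ ∫ x, K.indicator (fun _ => δ) x ∂μ N := by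
          rw [integral_indicator_const _ hmK, smul_eq_mul, mul_comm]
          have h4 := probReal_compl_eq_one_sub (μ := μ N) hmK
          have h5 := hKN' N le_rfl
          gcongr
          linarith
        refine h3.trans (integral_mono ((integrable_const δ).indicator hmK)
          (hgb.integrable _) fun x => ?_)
        by_cases hx : x ∈ K
        · have h4 : g x = δ := by
            simp only [hg, thickenedIndicator_one hδ K hx, NNReal.coe_one, mul_one]
          simp [Set.indicator_of_mem hx, h4]
        · simpa [Set.indicator_of_notMem hx] using hg0 x
      have hmT : MeasurableSet (Metric.thickening δ K) := Metric.isOpen_thickening.measurableSet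
      have h6 : ∫ x, g x ∂μ n ≤ δ * (1 - (μ n).real (Metric.thickening δ K)ᶜ) := by
        have h7 : ∫ x, (Metric.thickening δ K).indicator (fun _ => δ) x ∂μ n
            = δ * (1 - (μ n).real (Metric.thickening δ K)ᶜ) := by
          rw [integral_indicator_const _ hmT, smul_eq_mul, probReal_compl_eq_one_sub hmT]
          ring
        rw [← h7]
        refine integral_mono (hgb.integrable _) ((integrable_const δ).indicator hmT) fun x => ?_
        by_cases hx : x ∈ Metric.thickening δ K
        · simpa [Set.indicator_of_mem hx] using hgδ x
        · have h4 : g x = 0 := by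
            simp only [hg, thickenedIndicator_zero hδ K hx, NNReal.coe_zero, mul_zero]
          simp [Set.indicator_of_notMem hx, h4]
      have h8 : (μ n).real (Metric.thickening δ K)ᶜ ≤ ε := by
        rw [abs_le] at h1
        have : δ * (μ n).real (Metric.thickening δ K)ᶜ ≤ δ * ε := by nlinarith [h1.1]
        exact le_of_mul_le_mul_left this hδ
      exact (ENNReal.le_ofReal_iff_toReal_le (measure_ne_top _ _) hε.le).mpr h8
  rw [isTightMeasureSet_iff_exists_isCompact_measure_compl_le]
  intro ε hε
  obtain ⟨ε', hε', hsum⟩ := ENNReal.exists_pos_sum_of_countable' hε.ne' ℕ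
  choose K hK hμK using fun i : ℕ =>
    step (1 / (i + 1)) (by positivity) (by
      rw [div_le_one (by positivity)]; linarith [(i.cast_nonneg : (0 : ℝ) ≤ i)]) (ε' i) (hε' i)
  set L : Set X := ⋂ i : ℕ, Metric.cthickening (1 / (i + 1)) (K i) with hL
  refine ⟨L, ?_, ?_⟩
  · rw [isCompact_iff_totallyBounded_isComplete]
    refine ⟨?_, (isClosed_iInter fun i => Metric.isClosed_cthickening).isComplete⟩
    rw [Metric.totallyBounded_iff]
    intro r hr
    obtain ⟨i, hi⟩ := exists_nat_one_div_lt (show 0 < r / 2 by positivity)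
    obtain ⟨t, ht, hKt⟩ := Metric.totallyBounded_iff.mp (hK i).totallyBounded (r / 2)
      (by positivity)
    refine ⟨t, ht, fun x hx => ?_⟩
    have hx1 : x ∈ Metric.thickening (r / 2) (K i) :=
      Metric.cthickening_subset_thickening' (by positivity) hi _ (Set.mem_iInter.mp hx i)
    obtain ⟨z, hz, hxz⟩ := Metric.mem_thickening_iff.mp hx1
    obtain ⟨y, hy, hzy⟩ := Set.mem_iUnion₂.mp (hKt hz)
    refine Set.mem_iUnion₂.mpr ⟨y, hy, ?_⟩
    rw [Metric.mem_ball] at hzy ⊢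
    linarith [dist_triangle x z y]
  · rintro _ ⟨n, rfl⟩
    have hsub : Lᶜ ⊆ ⋃ i : ℕ, (Metric.thickening (1 / (i + 1 : ℝ)) (K i))ᶜ := by
      rw [hL, Set.compl_iInter]
      exact Set.iUnion_mono fun i =>
        Set.compl_subset_compl.mpr (Metric.thickening_subset_cthickening _ _)
    calc μ n Lᶜ ≤ ∑' i : ℕ, μ n (Metric.thickening (1 / (i + 1 : ℝ)) (K i))ᶜ :=
          (measure_mono hsub).trans (measure_iUnion_le _)
      _ ≤ ∑' i, ε' i := ENNReal.tsum_le_tsum fun i => hμK i n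
      _ ≤ ε := hsum.le

/-- A Feller chain with a Lyapunov function, whose Markov operator reduces the increments of
bounded Lipschitz functions at an exponential rate, has a unique stationary measure, and its
averages converge to the stationary ones at this rate. -/
theorem exists_stationary_of_decay {κ : Kernel X X} [IsMarkovKernel κ] {V : X → ℝ} {q C : ℝ}
    (hV : IsLyapunov κ V q C) (x0 : X)
    (hfeller : ∀ f : X → ℝ, Continuous f → BddMeas f → Continuous (markovOp κ f))
    {E a : ℝ} (hE : 0 < E) (ha : 0 < a)
    (hdecay : ∀ f : X → ℝ, (∀ x, |f x| ≤ 1) → LipschitzWith 1 f → ∀ (n : ℕ) (x y : X),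
      |(markovOp κ)^[n] f x - (markovOp κ)^[n] f y| ≤ E * Real.exp (-a * n) * (V x + V y)) :
    ∃ μ : ProbabilityMeasure X, (μ : Measure X).bind κ = μ ∧
      (∀ ν : ProbabilityMeasure X, (ν : Measure X).bind κ = ν → ν = μ) ∧
      ∃ E' : ℝ, 0 < E' ∧ ∀ f : X → ℝ, (∀ x, |f x| ≤ 1) → LipschitzWith 1 f →
        ∀ (n : ℕ) (x : X), |(markovOp κ)^[n] f x - ∫ y, f y ∂(μ : Measure X)|
          ≤ E' * Real.exp (-a * n) * V x := by
  have hq : 0 < 1 - q := by linarith [hV.q_lt]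
  have hC := hV.C_nonneg
  have hC1 : 0 ≤ C / (1 - q) := by positivity
  have hV0 : ∀ y, 0 ≤ V y := fun y => zero_le_one.trans (hV.one_le y)
  have hbm : ∀ f : X → ℝ, (∀ x, |f x| ≤ 1) → LipschitzWith 1 f → BddMeas f :=
    fun f hf hL => ⟨hL.continuous.measurable, 1, hf⟩
  set m : ℕ → Measure X := lawAt κ (Measure.dirac x0) with hm
  set D := V x0 + C / (1 - q) with hD
  have hD0 : 0 ≤ D := add_nonneg (hV0 x0) hC1
  -- comparison of the values of an iterate with its average over the law at time `k`
  have hcomp : ∀ f : X → ℝ, (∀ x, |f x| ≤ 1) → LipschitzWith 1 f → ∀ (n k : ℕ) (x : X),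
      |(markovOp κ)^[n] f x - ∫ y, (markovOp κ)^[n] f y ∂m k|
        ≤ E * Real.exp (-a * n) * (V x + D) := by
    intro f hf hL n k x
    obtain ⟨h1, h2⟩ := hV.lawAt_dirac x0 k
    have hi := ((hbm f hf hL).iterate (κ := κ) n).integrable (m k)
    have e : (markovOp κ)^[n] f x - ∫ y, (markovOp κ)^[n] f y ∂m k
        = ∫ y, ((markovOp κ)^[n] f x - (markovOp κ)^[n] f y) ∂m k := by
      rw [integral_sub (integrable_const _) hi]
      simp [hm]
    rw [e]
    refine (abs_integral_le_integral_abs).trans ?_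
    have hr : Integrable (fun y => E * Real.exp (-a * n) * (V x + V y)) (m k) :=
      ((integrable_const (V x)).add h1).const_mul _
    refine (integral_mono ((integrable_const _).sub hi).abs hr fun y =>
      hdecay f hf hL n x y).trans ?_
    rw [integral_const_mul, integral_add (integrable_const _) h1]
    simp only [integral_const, probReal_univ, smul_eq_mul, one_mul]
    gcongr
  have hadd : ∀ f : X → ℝ, BddMeas f → ∀ n k : ℕ,
      ∫ y, f y ∂m (k + n) = ∫ y, (markovOp κ)^[n] f y ∂m k := by
    intro f hf n k
    rw [hm, integral_lawAt _ hf, integral_lawAt _ (hf.iterate n), Function.iterate_add_apply]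
  have hm0 : ∀ f : X → ℝ, BddMeas f → ∀ n : ℕ, ∫ y, f y ∂m n = (markovOp κ)^[n] f x0 := by
    intro f hf n
    rw [hm, integral_lawAt _ hf, integral_dirac' _ _ (hf.iterate n).1.stronglyMeasurable]
  have hexp : Tendsto (fun n : ℕ => Real.exp (-a * n)) atTop (𝓝 0) := by
    apply Real.tendsto_exp_atBot.comp
    exact (tendsto_natCast_atTop_atTop).const_mul_atTop_of_neg (by linarith)
  have htight : IsTightMeasureSet (Set.range m) := by
    refine isTightMeasureSet_of_cauchy m fun ε hε => ?_
    have h1 : Tendsto (fun n : ℕ => E * Real.exp (-a * n) * (V x0 + D)) atTop (𝓝 0) := by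
      simpa using (hexp.const_mul E).mul_const (V x0 + D)
    obtain ⟨N, hN⟩ := (h1.eventually_lt_const hε).exists
    refine ⟨N, fun n hn f hf hL => ?_⟩
    have h2 := hcomp f hf hL N (n - N) x0
    have hfb := hbm f hf hL
    rw [← hm0 f hfb, ← hadd f hfb, Nat.sub_add_cancel hn, abs_sub_comm] at h2
    exact h2.trans hN.le
  set P : ℕ → ProbabilityMeasure X := fun n => ⟨m n, inferInstance⟩ with hP
  have hcpt : IsCompact (closure (Set.range P)) := by
    apply isCompact_closure_of_isTightMeasureSet
    refine htight.subset ?_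
    rintro _ ⟨_, ⟨n, rfl⟩, rfl⟩
    exact ⟨n, rfl⟩
  obtain ⟨μ, -, hμ⟩ := isCompact_iff_ultrafilter_le_nhds.mp hcpt ((hyperfilter ℕ).map P) (by
    rw [Filter.le_principal_iff]
    exact Filter.mem_of_superset (Filter.mem_map.mpr (by simp)) subset_closure)
  have hlim : Tendsto P (hyperfilter ℕ) (𝓝 μ) := hμ
  have hlim' : ∀ f : X → ℝ, Continuous f → BddMeas f →
      Tendsto (fun n => ∫ y, f y ∂m n) (hyperfilter ℕ) (𝓝 (∫ y, f y ∂(μ : Measure X))) := by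
    intro f hf hb
    obtain ⟨-, B, hB⟩ := hb
    exact (ProbabilityMeasure.tendsto_iff_forall_integral_tendsto.mp hlim)
      (BoundedContinuousFunction.ofNormedAddCommGroup f hf B hB)
  have hatTop : (hyperfilter ℕ : Filter ℕ) ≤ atTop := by
    rw [← Nat.cofinite_eq_atTop]
    exact hyperfilter_le_cofinite
  have hcont : ∀ f : X → ℝ, (∀ x, |f x| ≤ 1) → LipschitzWith 1 f → ∀ n,
      Continuous ((markovOp κ)^[n] f) := by
    intro f hf hL n
    induction n with
    | zero => exact hL.continuous
    | succ n ih =>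
      rw [Function.iterate_succ_apply']
      exact hfeller _ ih ((hbm f hf hL).iterate n)
  -- the averages of `f` and of its image under the Markov operator agree in the limit
  have hinv : ∀ f : X → ℝ, (∀ x, |f x| ≤ 1) → LipschitzWith 1 f →
      ∫ y, markovOp κ f y ∂(μ : Measure X) = ∫ y, f y ∂(μ : Measure X) := by
    intro f hf hL
    have hfb := hbm f hf hL
    have h1 := hlim' f hL.continuous hfb
    have h2 := hlim' _ (hfeller f hL.continuous hfb) hfb.markovOp
    have h3 : Tendsto (fun n => ∫ y, markovOp κ f y ∂m n - ∫ y, f y ∂m n)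
        (hyperfilter ℕ) (𝓝 0) := by
      refine squeeze_zero_norm (a := fun n : ℕ => E * Real.exp (-a * n) * (V x0 + D)) ?_ ?_
      · intro n
        have h4 := hcomp f hf hL n 1 x0
        rw [← hm0 f hfb, ← hadd f hfb, Nat.add_comm 1 n, abs_sub_comm,
          hadd f hfb 1 n] at h4
        exact h4
      · have : Tendsto (fun n : ℕ => E * Real.exp (-a * n) * (V x0 + D)) atTop (𝓝 0) := by
          simpa using (hexp.const_mul E).mul_const (V x0 + D)
        exact this.mono_left hatTop
    exact sub_eq_zero.mp (tendsto_nhds_unique (h2.sub h1) h3)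
  have hbind : (μ : Measure X).bind κ = μ := by
    have hp : IsProbabilityMeasure ((μ : Measure X).bind κ) :=
      isProbabilityMeasure_bind κ.measurable.aemeasurable (ae_of_all _ fun x => inferInstance)
    have := eq_of_forall_lipschitz_integral_eq (μ := ⟨(μ : Measure X).bind κ, hp⟩) (ν := μ)
      (fun f hf hL => by
        rw [← hinv f hf hL]
        exact integral_bind_eq _ (hbm f hf hL))
    exact congrArg (fun ν : ProbabilityMeasure X => (ν : Measure X)) this
  have hstat : ∀ ν : ProbabilityMeasure X, (ν : Measure X).bind κ = ν → ∀ f : X → ℝ, BddMeas f →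
      ∀ n, ∫ y, (markovOp κ)^[n] f y ∂(ν : Measure X) = ∫ y, f y ∂(ν : Measure X) := by
    intro ν hν f hf n
    induction n with
    | zero => rfl
    | succ n ih =>
      rw [Function.iterate_succ_apply', ← integral_bind_eq _ (hf.iterate n), hν, ih]
  have hrate : ∀ f : X → ℝ, (∀ x, |f x| ≤ 1) → LipschitzWith 1 f → ∀ (n : ℕ) (x : X),
      |(markovOp κ)^[n] f x - ∫ y, f y ∂(μ : Measure X)|
        ≤ E * (1 + D) * Real.exp (-a * n) * V x := by
    intro f hf hL n x
    have h1 := hlim' _ (hcont f hf hL n) ((hbm f hf hL).iterate n)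
    rw [hstat μ hbind f (hbm f hf hL) n] at h1
    have h2 := ((tendsto_const_nhds (x := (markovOp κ)^[n] f x)).sub h1).abs
    refine (le_of_tendsto h2 (Eventually.of_forall fun k => hcomp f hf hL n k x)).trans ?_
    have h3 : V x + D ≤ (1 + D) * V x := by nlinarith [hV.one_le x]
    calc _ ≤ E * Real.exp (-a * n) * ((1 + D) * V x) := by gcongr
      _ = _ := by ring
  refine ⟨μ, hbind, fun ν hν => ?_, E * (1 + D), by positivity, hrate⟩
  refine eq_of_forall_lipschitz_integral_eq fun f hf hL => ?_
  have hfb := hbm f hf hL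
  have h1 : Tendsto (fun n => ∫ y, (markovOp κ)^[n] f y ∂(ν : Measure X)) atTop
      (𝓝 (∫ _, (∫ z, f z ∂(μ : Measure X)) ∂(ν : Measure X))) := by
    refine tendsto_integral_of_dominated_convergence (fun _ => 1)
      (fun n => (hfb.iterate n).1.aestronglyMeasurable) (integrable_const _) (fun n => ?_) ?_
    · refine ae_of_all _ fun x => ?_
      induction n generalizing x with
      | zero => exact hf x
      | succ n ih =>
        rw [Function.iterate_succ_apply']
        have := norm_integral_le_of_norm_le_const (μ := κ x) (ae_of_all _ ih)
        simpa [markovOp] using this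
    · refine ae_of_all _ fun x => ?_
      rw [tendsto_iff_norm_sub_tendsto_zero]
      refine squeeze_zero (fun _ => norm_nonneg _) (fun n => hrate f hf hL n x) ?_
      simpa using (hexp.const_mul (E * (1 + D))).mul_const (V x)
  simp only [hstat ν hν f hfb, integral_const, probReal_univ, one_smul] at h1
  exact tendsto_nhds_unique tendsto_const_nhds h1

end Stationary

/-! ### Couplings from common parts, and shifts of one-dimensional densities -/

section Overlap

/-- A measure on the square whose marginals lie below `μ` and `ν` extends to a coupling of `μ` and
`ν`, by adding a multiple of the product of the remaining parts. -/
theorem exists_coupling_of_le {X : Type*} [MeasurableSpace X] {μ ν : Measure X}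
    [IsProbabilityMeasure μ] [IsProbabilityMeasure ν] {σ : Measure (X × X)}
    (h1 : σ.map Prod.fst ≤ μ) (h2 : σ.map Prod.snd ≤ ν) :
    ∃ π : Measure (X × X), IsCoupling π μ ν ∧ σ ≤ π := by
  have u1 : (σ.map Prod.fst) Set.univ = σ Set.univ := by
    rw [Measure.map_apply measurable_fst .univ]; simp
  have u2 : (σ.map Prod.snd) Set.univ = σ Set.univ := by
    rw [Measure.map_apply measurable_snd .univ]; simp
  have hσ1 : σ Set.univ ≤ 1 := by
    rw [← u1, ← measure_univ (μ := μ)]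
    exact h1 _
  have : IsFiniteMeasure σ := ⟨hσ1.trans_lt ENNReal.one_lt_top⟩
  rcases hσ1.eq_or_lt with h | h
  · refine ⟨σ, ⟨?_, ?_⟩, le_rfl⟩
    · exact Measure.eq_of_le_of_measure_univ_eq h1 (by rw [u1, h, measure_univ])
    · exact Measure.eq_of_le_of_measure_univ_eq h2 (by rw [u2, h, measure_univ])
  · have hpos : 1 - σ Set.univ ≠ 0 := (tsub_pos_of_lt h).ne'
    have hfin : 1 - σ Set.univ ≠ ∞ := ENNReal.sub_ne_top ENNReal.one_ne_top
    have m1 : (μ - σ.map Prod.fst) Set.univ = 1 - σ Set.univ := by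
      rw [Measure.sub_apply .univ h1, measure_univ, u1]
    have m2 : (ν - σ.map Prod.snd) Set.univ = 1 - σ Set.univ := by
      rw [Measure.sub_apply .univ h2, measure_univ, u2]
    refine ⟨σ + (1 - σ Set.univ)⁻¹ • (μ - σ.map Prod.fst).prod (ν - σ.map Prod.snd),
      ⟨?_, ?_⟩, Measure.le_add_right le_rfl⟩
    · rw [Measure.map_add _ _ measurable_fst, Measure.map_smul, Measure.map_fst_prod, m2,
        smul_smul, ENNReal.inv_mul_cancel hpos hfin, one_smul, add_comm,
        Measure.sub_add_cancel_of_le h1]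
    · rw [Measure.map_add _ _ measurable_snd, Measure.map_smul, Measure.map_snd_prod, m1,
        smul_smul, ENNReal.inv_mul_cancel hpos hfin, one_smul, add_comm,
        Measure.sub_add_cancel_of_le h2]

theorem pi_mono_of_le {ι : Type*} [Fintype ι] {α : ι → Type*} [∀ i, MeasurableSpace (α i)]
    {μ ν : ∀ i, Measure (α i)} [∀ i, SigmaFinite (ν i)]
    (h : ∀ i, ν i ≤ μ i) : Measure.pi ν ≤ Measure.pi μ := by
  have key : (Measure.pi ν).toOuterMeasure ≤ OuterMeasure.pi fun i => (μ i).toOuterMeasure := by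
    rw [OuterMeasure.le_pi]
    intro s _
    change Measure.pi ν (Set.pi Set.univ s) ≤ _
    rw [Measure.pi_pi]
    exact Finset.prod_le_prod' fun i _ => h i (s i)
  refine Measure.le_iff.mpr fun s hs => ?_
  have e : Measure.pi μ s = OuterMeasure.pi (fun i => (μ i).toOuterMeasure) s := by
    rw [Measure.pi, toMeasure_apply _ _ hs]
  rw [e]
  exact key s

/-- A function of total variation at most `1` is moved in `L¹` by a translation by at most the
length of the translation. -/
theorem lintegral_abs_translate_sub_le {f : ℝ → ℝ} (hf : eVariationOn f Set.univ ≤ 1) (a : ℝ) :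
    ∫⁻ x, ENNReal.ofReal |f (x + a) - f x| ≤ ENNReal.ofReal |a| := by
  wlog ha : 0 ≤ a generalizing a
  · have h := this (-a) (by linarith)
    rw [abs_neg] at h
    refine le_trans (le_of_eq ?_) h
    rw [← lintegral_add_right_eq_self (fun x => ENNReal.ofReal |f (x + -a) - f x|) a]
    refine lintegral_congr fun x => ?_
    rw [abs_sub_comm]
    simp
  -- the increments of `f` are dominated by those of its variation function
  set v : ℝ → ℝ := fun x => (eVariationOn f (Set.Iic x)).toReal with hv
  have hfin : ∀ s : Set ℝ, eVariationOn f s ≠ ∞ := fun s =>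
    ((eVariationOn.mono f (Set.subset_univ s)).trans hf).trans_lt ENNReal.one_lt_top |>.ne
  have hv0 : ∀ x, 0 ≤ v x := fun x => ENNReal.toReal_nonneg
  have hv1 : ∀ x, v x ≤ 1 := fun x =>
    ENNReal.toReal_le_of_le_ofReal zero_le_one
      (by simpa using (eVariationOn.mono f (Set.subset_univ _)).trans hf)
  have hvm : Monotone v := fun x y hxy =>
    ENNReal.toReal_mono (hfin _) (eVariationOn.mono f (Set.Iic_subset_Iic.mpr hxy))
  have hinc : ∀ x, |f (x + a) - f x| ≤ v (x + a) - v x := by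
    intro x
    have h1 := eVariationOn.add_le_union f (s := Set.Iic x) (t := Set.Icc x (x + a))
      (fun y hy z hz => le_trans hy hz.1)
    have h2 : Set.Iic x ∪ Set.Icc x (x + a) ⊆ Set.Iic (x + a) := by
      rintro y (hy | hy)
      · exact (Set.mem_Iic.mp hy).trans (by linarith)
      · exact hy.2
    have h3 := h1.trans (eVariationOn.mono f h2)
    have h4 := eVariationOn.edist_le f (s := Set.Icc x (x + a)) (x := x + a) (y := x)
      ⟨by linarith, le_rfl⟩ ⟨le_rfl, by linarith⟩
    have h5 := ENNReal.toReal_mono (hfin _) h3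
    rw [ENNReal.toReal_add (hfin _) (hfin _)] at h5
    have h6 := ENNReal.toReal_mono (hfin _) h4
    rw [edist_dist, ENNReal.toReal_ofReal dist_nonneg, Real.dist_eq] at h6
    simp only [hv]
    linarith
  have hvi : ∀ c d : ℝ, IntervalIntegrable v volume c d := fun c d => hvm.intervalIntegrable
  have hvia : ∀ c d : ℝ, IntervalIntegrable (fun x => v (x + a)) volume c d := fun c d =>
    (hvm.comp (fun _ _ h => by simpa using h)).intervalIntegrable
  have hloc : ∀ n : ℕ, ∫⁻ x in Set.Ioc (-(n : ℝ)) n, ENNReal.ofReal |f (x + a) - f x|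
      ≤ ENNReal.ofReal |a| := by
    intro n
    have hn : -(n : ℝ) ≤ n := by linarith [(n.cast_nonneg : (0 : ℝ) ≤ n)]
    calc ∫⁻ x in Set.Ioc (-(n : ℝ)) n, ENNReal.ofReal |f (x + a) - f x|
        ≤ ∫⁻ x in Set.Ioc (-(n : ℝ)) n, ENNReal.ofReal (v (x + a) - v x) :=
          lintegral_mono fun x => ENNReal.ofReal_le_ofReal (hinc x)
      _ = ENNReal.ofReal (∫ x in (-(n : ℝ))..n, (v (x + a) - v x)) := by
          rw [intervalIntegral.integral_of_le hn, ofReal_integral_eq_lintegral_ofReal]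
          · exact ((hvia _ _).sub (hvi _ _)).1
          · exact ae_of_all _ fun x => (abs_nonneg _).trans (hinc x)
      _ ≤ ENNReal.ofReal |a| := by
          apply ENNReal.ofReal_le_ofReal
          rw [intervalIntegral.integral_sub (hvia _ _) (hvi _ _),
            intervalIntegral.integral_comp_add_right v a,
            intervalIntegral.integral_interval_sub_interval_comm (hvi _ _) (hvi _ _) (hvi _ _),
            intervalIntegral.integral_symm, abs_of_nonneg ha]
          have h1 : 0 ≤ ∫ x in (-(n : ℝ))..(-(n : ℝ) + a), v x :=
            intervalIntegral.integral_nonneg (by linarith) fun x _ => hv0 x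
          have h2 : ∫ x in (n : ℝ)..(n + a), v x ≤ ∫ x in (n : ℝ)..(n + a), (1 : ℝ) :=
            intervalIntegral.integral_mono_on (by linarith) (hvi _ _)
              (by simp) fun x _ => hv1 x
          rw [intervalIntegral.integral_const] at h2
          rw [intervalIntegral.integral_symm (n : ℝ) (n + a)]
          simp only [smul_eq_mul, mul_one] at h2
          linarith
  have hU : (⋃ n : ℕ, Set.Ioc (-(n : ℝ)) n) = Set.univ := by
    refine Set.eq_univ_of_forall fun x => Set.mem_iUnion.mpr ?_
    obtain ⟨n, hn⟩ := exists_nat_gt |x|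
    exact ⟨n, (abs_lt.mp hn).1, (abs_lt.mp hn).2.le⟩
  rw [← setLIntegral_univ, ← hU, setLIntegral_iUnion_of_directed]
  · exact iSup_le hloc
  · refine Monotone.directed_le fun m n hmn => ?_
    have : (m : ℝ) ≤ n := by exact_mod_cast hmn
    exact Set.Ioc_subset_Ioc (by linarith) this

/-- The measure with density `ρ`. -/
noncomputable def densMeasure (ρ : ℝ → ℝ) : Measure ℝ :=
  volume.withDensity fun r => ENNReal.ofReal (ρ r)

/-- The common part of the measure with density `ρ` and its translate by `-a`. -/
noncomputable def overlap (ρ : ℝ → ℝ) (a : ℝ) : Measure ℝ :=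
  volume.withDensity fun r => ENNReal.ofReal (min (ρ r) (ρ (r + a)))

theorem overlap_le (ρ : ℝ → ℝ) (a : ℝ) : overlap ρ a ≤ densMeasure ρ :=
  withDensity_mono (ae_of_all _ fun _ => ENNReal.ofReal_le_ofReal (min_le_left _ _))

theorem overlap_map_le {ρ : ℝ → ℝ} (hρ : Continuous ρ) (a : ℝ) :
    (overlap ρ a).map (fun x => x + a) ≤ densMeasure ρ := by
  refine Measure.le_iff.mpr fun s hs => ?_
  have hm : Measurable fun x : ℝ => x + a := measurable_add_const a
  rw [Measure.map_apply hm hs, overlap, withDensity_apply _ (hm hs), densMeasure,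
    withDensity_apply _ hs]
  calc _ ≤ ∫⁻ x in (fun x => x + a) ⁻¹' s, ENNReal.ofReal (ρ (x + a)) :=
        lintegral_mono fun x => ENNReal.ofReal_le_ofReal (min_le_right _ _)
    _ = _ := (measurePreserving_add_right volume a).setLIntegral_comp_preimage hs
        (by fun_prop : Measurable fun x => ENNReal.ofReal (ρ x))

theorem isFiniteMeasure_overlap (ρ : ℝ → ℝ) [IsProbabilityMeasure (densMeasure ρ)] (a : ℝ) :
    IsFiniteMeasure (overlap ρ a) :=
  isFiniteMeasure_of_le _ (overlap_le ρ a)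

theorem one_sub_le_overlap {ρ : ℝ → ℝ} [IsProbabilityMeasure (densMeasure ρ)] (hρ : Continuous ρ)
    (hvar : eVariationOn ρ Set.univ ≤ 1) (a : ℝ) :
    1 - |a| ≤ (overlap ρ a).real Set.univ := by
  have := isFiniteMeasure_overlap ρ a
  have h1 : (1 : ℝ≥0∞) ≤ overlap ρ a Set.univ + ENNReal.ofReal |a| := by
    rw [← measure_univ (μ := densMeasure ρ), densMeasure, overlap,
      withDensity_apply _ .univ, withDensity_apply _ .univ, setLIntegral_univ, setLIntegral_univ]
    calc ∫⁻ x, ENNReal.ofReal (ρ x)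
        ≤ ∫⁻ x, (ENNReal.ofReal (min (ρ x) (ρ (x + a)))
            + ENNReal.ofReal |ρ (x + a) - ρ x|) := by
          refine lintegral_mono fun x => ?_
          refine le_trans (ENNReal.ofReal_le_ofReal ?_) ENNReal.ofReal_add_le
          rcases le_total (ρ x) (ρ (x + a)) with h | h
          · rw [min_eq_left h]; linarith [abs_nonneg (ρ (x + a) - ρ x)]
          · rw [min_eq_right h]; linarith [neg_abs_le (ρ (x + a) - ρ x)]
      _ = (∫⁻ x, ENNReal.ofReal (min (ρ x) (ρ (x + a))))
            + ∫⁻ x, ENNReal.ofReal |ρ (x + a) - ρ x| := by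
          rw [lintegral_add_left (by fun_prop)]
      _ ≤ _ := by
          gcongr
          exact lintegral_abs_translate_sub_le hvar a
  have h2 := ENNReal.toReal_mono
    (ENNReal.add_ne_top.mpr ⟨measure_ne_top _ _, ENNReal.ofReal_ne_top⟩) h1
  rw [ENNReal.toReal_add (measure_ne_top _ _) ENNReal.ofReal_ne_top,
    ENNReal.toReal_ofReal (abs_nonneg a), ENNReal.toReal_one] at h2
  rw [Measure.real]
  linarith

/-- A positive continuous density and its translates by bounded shifts have a common part which
charges every neighbourhood of the origin, uniformly in the shift. -/
theorem exists_le_overlap {ρ : ℝ → ℝ} [IsProbabilityMeasure (densMeasure ρ)] (hρ : Continuous ρ)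
    (hpos : ∀ x, 0 < ρ x) (A : ℝ) {τ : ℝ} (hτ : 0 < τ) :
    ∃ c : ℝ, 0 < c ∧ ∀ a : ℝ, |a| ≤ A → c ≤ (overlap ρ a).real (Set.Ioo (-τ) τ) := by
  obtain ⟨x0, -, hx0⟩ := (isCompact_Icc (a := -(τ + |A|)) (b := τ + |A|)).exists_isMinOn
    ⟨0, by constructor <;> linarith [abs_nonneg A]⟩ hρ.continuousOn
  refine ⟨ρ x0 * (2 * τ), mul_pos (hpos x0) (by positivity), fun a ha => ?_⟩
  have := isFiniteMeasure_overlap ρ a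
  have hA : |a| ≤ |A| := ha.trans (le_abs_self A)
  have h1 : ENNReal.ofReal (ρ x0 * (2 * τ)) ≤ overlap ρ a (Set.Ioo (-τ) τ) := by
    rw [overlap, withDensity_apply _ measurableSet_Ioo]
    calc ENNReal.ofReal (ρ x0 * (2 * τ))
        = ∫⁻ _ in Set.Ioo (-τ) τ, ENNReal.ofReal (ρ x0) := by
          rw [setLIntegral_const, Real.volume_Ioo, ← ENNReal.ofReal_mul (hpos x0).le]
          congr 1
          ring
      _ ≤ _ := by
          refine setLIntegral_mono' measurableSet_Ioo fun x hx => ENNReal.ofReal_le_ofReal ?_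
          have hx' := abs_le.mp hA
          refine le_min (hx0 ⟨?_, ?_⟩) (hx0 ⟨?_, ?_⟩) <;> linarith [hx.1, hx.2, abs_nonneg A]
  exact (ENNReal.ofReal_le_iff_le_toReal (measure_ne_top _ _)).mp h1

end Overlap

/-! ### The law of the noise -/

section Indep

variable {Ω : Type*} {ι : Type*} {ξ : ι → Ω → ℝ}

/-- The `σ`-algebra generated by the variables `ξ i`, `i ∈ A`. -/
@[reducible]
def sigmaOf (ξ : ι → Ω → ℝ) (A : Set ι) : MeasurableSpace Ω :=
  ⨆ i ∈ A, MeasurableSpace.comap (ξ i) inferInstance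

theorem measurable_sigmaOf {A : Set ι} {i : ι} (hi : i ∈ A) : Measurable[sigmaOf ξ A] (ξ i) :=
  measurable_iff_comap_le.mpr
    (le_iSup₂ (f := fun i (_ : i ∈ A) => MeasurableSpace.comap (ξ i) inferInstance) i hi)

theorem indepFun_of_sigmaOf [MeasurableSpace Ω] {P : Measure Ω} (hξm : ∀ i, Measurable (ξ i))
    (hξ : iIndepFun ξ P) {A B : Set ι} (hAB : Disjoint A B) {α β : Type*}
    [MeasurableSpace α] [MeasurableSpace β] {X : Ω → α} {Y : Ω → β}
    (hX : Measurable[sigmaOf ξ A] X) (hY : Measurable[sigmaOf ξ B] Y) :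
    IndepFun X Y P := by
  rw [IndepFun_iff_Indep]
  exact indep_of_indep_of_le
    (indep_iSup_of_disjoint (fun i => (hξm i).comap_le) hξ.iIndep hAB)
    (measurable_iff_comap_le.mp hX) (measurable_iff_comap_le.mp hY)

end Indep

section Series

variable {H : Type*} [NormedAddCommGroup H] [InnerProductSpace ℝ H]

/-- The sum of the series `∑ b_j x_j e_j`, with an arbitrary value where it diverges. -/
noncomputable def kickSeries (e : ℕ → H) (b : ℕ → ℝ) (x : ℕ → ℝ) : H :=
  limUnder atTop fun n => ∑ j ∈ Finset.range n, (b j * x j) • e j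

theorem kickSeries_eq {e : ℕ → H} {b x : ℕ → ℝ} {y : H}
    (h : HasSum (fun j => (b j * x j) • e j) y) : kickSeries e b x = y :=
  h.tendsto_sum_nat.limUnder_eq

theorem hasSum_tail {e : ℕ → H} {b x : ℕ → ℝ} {y : H}
    (h : HasSum (fun j => (b j * x j) • e j) y) (J : ℕ) :
    HasSum (fun j => (b j * (if j < J then 0 else x j)) • e j)
      (y - ∑ j ∈ Finset.range J, (b j * x j) • e j) := by
  have h1 : HasSum (fun j => if j < J then (b j * x j) • e j else 0)
      (∑ j ∈ Finset.range J, (b j * x j) • e j) := by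
    have : ∑ j ∈ Finset.range J, (b j * x j) • e j
        = ∑ j ∈ Finset.range J, if j < J then (b j * x j) • e j else 0 :=
      Finset.sum_congr rfl fun j hj => by rw [if_pos (Finset.mem_range.mp hj)]
    rw [this]
    exact hasSum_sum_of_ne_finset_zero fun j hj => by
      rw [if_neg (by simpa using hj)]
  convert h.sub h1 using 2 with j
  split_ifs <;> simp

variable [MeasurableSpace H] [BorelSpace H] [SecondCountableTopology H]

theorem measurable_kickSeries [CompleteSpace H] (e : ℕ → H) (b : ℕ → ℝ) :
    Measurable (kickSeries e b) := by
  refine (StronglyMeasurable.limUnder (f := fun (n : ℕ) (x : ℕ → ℝ) =>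
    ∑ j ∈ Finset.range n, (b j * x j) • e j) fun n => ?_).measurable
  have : Measurable fun x : ℕ → ℝ => ∑ j ∈ Finset.range n, (b j * x j) • e j := by fun_prop
  exact this.stronglyMeasurable

/-- Superposition of the first `J` modes of the noise and a remainder. -/
def joinModes (e : ℕ → H) (b : ℕ → ℝ) (J : ℕ) (z : (Fin J → ℝ) × H) : H :=
  ∑ j : Fin J, (b j * z.1 j) • e j + z.2

theorem measurable_joinModes (e : ℕ → H) (b : ℕ → ℝ) (J : ℕ) :
    Measurable (joinModes e b J) := by
  unfold joinModes
  fun_prop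

/-- The first `J` modes of the noise and the remainder are independent. -/
theorem map_eq_joinModes [CompleteSpace H] {Ω : Type*} [MeasurableSpace Ω] {P : Measure Ω}
    [IsProbabilityMeasure P] {e : ℕ → H} {b : ℕ → ℝ} {ξ : ℕ → Ω → ℝ}
    (hξm : ∀ j, Measurable (ξ j)) (hξ : iIndepFun ξ P)
    {η : Ω → H} (hη : Measurable η)
    (hsum : ∀ᵐ ω ∂P, HasSum (fun j => (b j * ξ j ω) • e j) (η ω)) (J : ℕ) :
    P.map η = ((Measure.pi fun j : Fin J => P.map (ξ j)).prod
      (P.map fun ω => η ω - ∑ j ∈ Finset.range J, (b j * ξ j ω) • e j)).map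
        (joinModes e b J) := by
  have htm : Measurable fun ω => η ω - ∑ j ∈ Finset.range J, (b j * ξ j ω) • e j := by
    fun_prop
  have hhm : Measurable fun ω (j : Fin J) => ξ j ω := by fun_prop
  have hind : IndepFun (fun ω (j : Fin J) => ξ j ω)
      (fun ω => η ω - ∑ j ∈ Finset.range J, (b j * ξ j ω) • e j) P := by
    have h1 : IndepFun (fun ω (j : Fin J) => ξ j ω)
        (fun ω => kickSeries e b fun j => if j < J then 0 else ξ j ω) P := by
      refine indepFun_of_sigmaOf hξm hξ (A := {j | j < J}) (B := {j | J ≤ j}) ?_ ?_ ?_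
      · rw [Set.disjoint_left]
        intro j h1 h2
        exact absurd (show j < J from h1) (not_lt.mpr h2)
      · refine @measurable_pi_lambda _ _ _ (sigmaOf ξ _) _ _ fun j => measurable_sigmaOf j.2
      · refine (measurable_kickSeries e b).comp
          (@measurable_pi_lambda _ _ _ (sigmaOf ξ _) _ _ fun j => ?_)
        by_cases hj : j < J
        · simp only [if_pos hj]
          exact @measurable_const _ _ _ (sigmaOf ξ _) _
        · simp only [if_neg hj]
          exact measurable_sigmaOf (not_lt.mp hj)
    refine h1.congr (ae_eq_refl _) ?_
    filter_upwards [hsum] with ω hω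
    exact kickSeries_eq (hasSum_tail hω J)
  have hlaw : P.map (fun ω (j : Fin J) => ξ j ω) = Measure.pi fun j : Fin J => P.map (ξ j) :=
    iIndepFun.map_fun_eq_pi_map (f := fun (j : Fin J) => ξ j) (fun j => (hξm j).aemeasurable)
      (hξ.precomp Fin.val_injective)
  rw [← hlaw, ← hind.map_prod_eq_prod_map_map hhm.aemeasurable htm.aemeasurable,
    Measure.map_map (measurable_joinModes e b J) (hhm.prodMk htm)]
  congr 1
  funext ω
  simp [joinModes, Finset.sum_range]

/-- The remainder of the noise beyond a late mode is small with positive probability. -/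
theorem exists_small_tail {Ω : Type*} [MeasurableSpace Ω] {P : Measure Ω} [IsProbabilityMeasure P]
    {e : ℕ → H} {b : ℕ → ℝ} {ξ : ℕ → Ω → ℝ} (hξm : ∀ j, Measurable (ξ j))
    {η : Ω → H} (hη : Measurable η)
    (hsum : ∀ᵐ ω ∂P, HasSum (fun j => (b j * ξ j ω) • e j) (η ω)) (N : ℕ) {r : ℝ} (hr : 0 < r) :
    ∃ J, N ≤ J ∧ 0 < (P.map fun ω => η ω - ∑ j ∈ Finset.range J, (b j * ξ j ω) • e j).real
      (Metric.ball 0 r) := by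
  have htm : ∀ J, Measurable fun ω => η ω - ∑ j ∈ Finset.range J, (b j * ξ j ω) • e j := by
    intro J
    fun_prop
  have h1 := tendstoInMeasure_of_tendsto_ae (μ := P)
    (f := fun J ω => η ω - ∑ j ∈ Finset.range J, (b j * ξ j ω) • e j) (g := fun _ => 0)
    (fun J => (htm J).aestronglyMeasurable) (by
      filter_upwards [hsum] with ω hω
      simpa using (tendsto_const_nhds (x := η ω)).sub hω.tendsto_sum_nat)
  have h2 := h1 (ENNReal.ofReal r) (by simpa using hr)
  obtain ⟨J, hJ, hNJ⟩ := ((h2.eventually_lt_const one_pos).and (eventually_ge_atTop N)).exists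
  refine ⟨J, hNJ, ?_⟩
  have : IsProbabilityMeasure (P.map fun ω => η ω - ∑ j ∈ Finset.range J, (b j * ξ j ω) • e j) :=
    Measure.isProbabilityMeasure_map (htm J).aemeasurable
  have h3 : (P.map fun ω => η ω - ∑ j ∈ Finset.range J, (b j * ξ j ω) • e j)
      (Metric.ball 0 r)ᶜ < 1 := by
    rw [Measure.map_apply (htm J) Metric.isOpen_ball.measurableSet.compl]
    convert hJ using 2
    ext ω
    simp only [Set.mem_preimage, Set.mem_compl_iff, Metric.mem_ball, not_lt, Set.mem_ofPred_eq]
    rw [edist_dist, ENNReal.ofReal_le_ofReal_iff dist_nonneg]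
  have h4 := probReal_compl_eq_one_sub
    (μ := P.map fun ω => η ω - ∑ j ∈ Finset.range J, (b j * ξ j ω) • e j)
    (Metric.isOpen_ball (x := (0 : H)) (ε := r)).measurableSet
  have h5 : (P.map fun ω => η ω - ∑ j ∈ Finset.range J, (b j * ξ j ω) • e j).real
      (Metric.ball 0 r)ᶜ < 1 := by
    have := (ENNReal.toReal_lt_toReal (measure_ne_top _ _) ENNReal.one_ne_top).mpr h3
    simpa [Measure.real] using this
  linarith

theorem one_sub_sum_le_prod {ι : Type*} (s : Finset ι) (u t : ι → ℝ) (h0 : ∀ i, 0 ≤ u i)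
    (h1 : ∀ i, u i ≤ 1) (h : ∀ i, 1 - t i ≤ u i) : 1 - ∑ i ∈ s, t i ≤ ∏ i ∈ s, u i := by
  classical
  induction s using Finset.induction_on with
  | empty => simp
  | insert i s hi ih =>
    rw [Finset.sum_insert hi, Finset.prod_insert hi]
    have h2 : ∏ i ∈ s, u i ≤ 1 := Finset.prod_le_one (fun i _ => h0 i) fun i _ => h1 i
    nlinarith [h i, h1 i]

/-- A law whose first `J` modes are independent with regular densities has, for each shift along
the first `N ≤ J` modes with nonzero amplitudes, a large part whose translate is again a part of
the law; this part charges a neighbourhood of the origin. -/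
theorem exists_shifted_part {e : ℕ → H} (he : ∀ j, ‖e j‖ = 1) {b : ℕ → ℝ} {dens : ℕ → ℝ → ℝ}
    (hd : ∀ j, Continuous (dens j)) (hdp : ∀ j x, 0 < dens j x)
    (hdv : ∀ j, eVariationOn (dens j) Set.univ ≤ 1)
    (hprob : ∀ j, IsProbabilityMeasure (densMeasure (dens j)))
    {N J : ℕ} (hNJ : N ≤ J) (hb : ∀ j < N, b j ≠ 0) (ζ : Measure H) [IsProbabilityMeasure ζ]
    {r : ℝ} (hr : 0 < r) (hζ : 0 < ζ.real (Metric.ball 0 (r / 2))) {m : Measure H}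
    (hm : m = ((Measure.pi fun j : Fin J => densMeasure (dens j)).prod ζ).map (joinModes e b J)) :
    ∃ Λ : ℝ, 0 < Λ ∧ ∀ L : ℝ, ∃ k : ℝ, 0 < k ∧ ∀ (c : ℕ → ℝ) (t : ℝ), 0 ≤ t →
      (∀ j < N, |c j| ≤ t) → ∃ ν : Measure H, ν ≤ m ∧
        ν.map (fun z => z + ∑ j ∈ Finset.range N, c j • e j) ≤ m ∧
        1 - Λ * t ≤ ν.real Set.univ ∧ (t ≤ L → k ≤ ν.real (Metric.ball 0 r)) := by
  set Λ : ℝ := 1 + ∑ j ∈ Finset.range N, |b j|⁻¹ with hΛ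
  have hΛ0 : 0 ≤ ∑ j ∈ Finset.range N, |b j|⁻¹ := Finset.sum_nonneg fun j _ => by positivity
  have hΛp : 0 < Λ := by linarith
  refine ⟨Λ, hΛp, fun L => ?_⟩
  set τ : ℕ → ℝ := fun j => r / (2 * (J + 1) * (|b j| + 1)) with hτ
  have hτp : ∀ j, 0 < τ j := fun j => by positivity
  choose k hk0 hk using fun j : ℕ => exists_le_overlap (hd j) (hdp j) (Λ * |L|) (hτp j)
  refine ⟨(∏ j : Fin J, k j) * ζ.real (Metric.ball 0 (r / 2)),
    mul_pos (Finset.prod_pos fun j _ => hk0 j) hζ, fun c t ht hct => ?_⟩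
  -- the shift in the `j`-th coordinate of the product space
  set a : ℕ → ℝ := fun j => if j < N then c j / b j else 0 with ha
  have haΛ : ∀ j, |a j| ≤ Λ * t := by
    intro j
    by_cases hj : j < N
    · simp only [ha, if_pos hj, div_eq_mul_inv, abs_mul, abs_inv]
      have h1 : |b j|⁻¹ ≤ Λ := by
        have := Finset.single_le_sum (f := fun j => |b j|⁻¹) (fun i _ => by positivity)
          (Finset.mem_range.mpr hj)
        linarith
      rw [mul_comm]
      exact mul_le_mul h1 (hct j hj) (abs_nonneg _) hΛp.le
    · simp only [ha, if_neg hj, abs_zero]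
      positivity
  have hsuma : ∑ j : Fin J, |a j| ≤ Λ * t := by
    rw [← Finset.sum_range (fun j => |a j|), ← Finset.sum_subset (Finset.range_mono hNJ)
      (fun j _ hj => by simp [ha, Finset.mem_range.not.mp hj])]
    calc ∑ j ∈ Finset.range N, |a j| ≤ ∑ j ∈ Finset.range N, |b j|⁻¹ * t := by
          refine Finset.sum_le_sum fun j hj => ?_
          have hj' := Finset.mem_range.mp hj
          simp only [ha, if_pos hj', div_eq_mul_inv, abs_mul, abs_inv]
          rw [mul_comm]
          exact mul_le_mul_of_nonneg_left (hct j hj') (by positivity)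
      _ = (∑ j ∈ Finset.range N, |b j|⁻¹) * t := by rw [Finset.sum_mul]
      _ ≤ Λ * t := by gcongr; linarith
  have hshift : ∀ z : (Fin J → ℝ) × H, joinModes e b J z + ∑ j ∈ Finset.range N, c j • e j
      = joinModes e b J (fun j => z.1 j + a j, z.2) := by
    intro z
    have h1 : ∑ j ∈ Finset.range N, c j • e j = ∑ j : Fin J, (b j * a j) • e j := by
      rw [← Finset.sum_range (fun j => (b j * a j) • e j),
        ← Finset.sum_subset (Finset.range_mono hNJ)
          (fun j _ hj => by simp [ha, Finset.mem_range.not.mp hj])]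
      refine Finset.sum_congr rfl fun j hj => ?_
      have hj' := Finset.mem_range.mp hj
      simp only [ha, if_pos hj']
      rw [mul_div_cancel₀ _ (hb j hj')]
    simp only [joinModes, h1, mul_add, add_smul, Finset.sum_add_distrib]
    abel
  have hfin : ∀ j, IsFiniteMeasure (overlap (dens j) (a j)) := fun j =>
    isFiniteMeasure_overlap (dens j) (a j)
  have hjm := measurable_joinModes e b J
  set ν0 : Measure (Fin J → ℝ) := Measure.pi fun j : Fin J => overlap (dens j) (a j) with hν0
  have hνle : (ν0.prod ζ).map (joinModes e b J) ≤ m := by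
    rw [hm]
    exact Measure.map_mono (Measure.prod_mono (pi_mono_of_le fun j => overlap_le _ _) le_rfl) hjm
  have hmp : IsProbabilityMeasure m := by
    rw [hm]
    exact Measure.isProbabilityMeasure_map hjm.aemeasurable
  refine ⟨(ν0.prod ζ).map (joinModes e b J), hνle, ?_, ?_, fun htL => ?_⟩
  · have hsm : Measurable fun z : H => z + ∑ j ∈ Finset.range N, c j • e j :=
      measurable_add_const _
    have ham : Measurable fun x : Fin J → ℝ => fun j => x j + a j := by fun_prop
    have h1 : (fun z : H => z + ∑ j ∈ Finset.range N, c j • e j) ∘ joinModes e b J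
        = joinModes e b J ∘ Prod.map (fun x : Fin J → ℝ => fun j => x j + a j) id := by
      funext z
      exact hshift z
    have hfin' : ∀ j : Fin J, IsFiniteMeasure ((overlap (dens j) (a j)).map fun x => x + a j) :=
      fun j => inferInstance
    have h2 : ν0.map (fun x : Fin J → ℝ => fun j => x j + a j)
        = Measure.pi fun j : Fin J => (overlap (dens j) (a j)).map fun x => x + a j :=
      Measure.pi_map_pi (f := fun (j : Fin J) (x : ℝ) => x + a j)
        (fun j => (measurable_add_const _).aemeasurable)
    rw [Measure.map_map hsm hjm, h1, ← Measure.map_map hjm (ham.prodMap measurable_id),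
      ← Measure.map_prod_map ν0 ζ ham measurable_id, Measure.map_id, h2, hm]
    exact Measure.map_mono (Measure.prod_mono
      (pi_mono_of_le fun j => overlap_map_le (hd j) _) le_rfl) hjm
  · have h1 : ((ν0.prod ζ).map (joinModes e b J)).real Set.univ
        = ∏ j : Fin J, (overlap (dens j) (a j)).real Set.univ := by
      rw [Measure.real, Measure.map_apply hjm .univ, Set.preimage_univ, ← Set.univ_prod_univ,
        Measure.prod_prod, measure_univ (μ := ζ), mul_one, hν0, Measure.pi_univ,
        ENNReal.toReal_prod]
      rfl
    rw [h1]
    have h2 := one_sub_sum_le_prod Finset.univ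
      (fun j : Fin J => (overlap (dens j) (a j)).real Set.univ) (fun j => |a j|)
      (fun j => measureReal_nonneg) (fun j => by
        have := ENNReal.toReal_mono (measure_ne_top _ _) (overlap_le (dens j) (a j) Set.univ)
        simpa [Measure.real] using this)
      (fun j => one_sub_le_overlap (hd j) (hdv j) (a j))
    linarith
  · have hfν : IsFiniteMeasure ((ν0.prod ζ).map (joinModes e b J)) :=
      isFiniteMeasure_of_le _ hνle
    have h1 : (Set.univ.pi fun j : Fin J => Set.Ioo (-τ j) (τ j)) ×ˢ Metric.ball (0 : H) (r / 2)
        ⊆ joinModes e b J ⁻¹' Metric.ball 0 r := by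
      rintro ⟨x, z⟩ ⟨hx, hz⟩
      simp only [Set.mem_preimage, Metric.mem_ball, dist_zero_right, joinModes] at hz ⊢
      have h2 : ∀ j : Fin J, ‖(b j * x j) • e j‖ ≤ r / (2 * (J + 1)) := by
        intro j
        have hxj := hx j trivial
        simp only [Set.mem_Ioo] at hxj
        have h3 : |x j| ≤ τ j := (abs_lt.mpr hxj).le
        rw [norm_smul, he, mul_one, Real.norm_eq_abs, abs_mul]
        calc |b j| * |x j| ≤ (|b j| + 1) * τ j := by gcongr; linarith
          _ = r / (2 * (J + 1)) := by simp only [hτ]; field_simp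
      have h4 : ‖∑ j : Fin J, (b j * x j) • e j‖ ≤ r / 2 := by
        refine (norm_sum_le _ _).trans ((Finset.sum_le_sum fun j _ => h2 j).trans ?_)
        rw [Finset.sum_const, Finset.card_univ, Fintype.card_fin, nsmul_eq_mul,
          mul_div_assoc', div_le_div_iff₀ (by positivity) (by positivity)]
        nlinarith
      linarith [norm_add_le (∑ j : Fin J, (b j * x j) • e j) z]
    have h2 : (ν0.prod ζ) ((Set.univ.pi fun j : Fin J => Set.Ioo (-τ j) (τ j))
        ×ˢ Metric.ball (0 : H) (r / 2))
        ≤ ((ν0.prod ζ).map (joinModes e b J)) (Metric.ball 0 r) := by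
      rw [Measure.map_apply hjm Metric.isOpen_ball.measurableSet]
      exact measure_mono h1
    have h3 := ENNReal.toReal_mono (measure_ne_top _ _) h2
    rw [Measure.prod_prod, hν0, Measure.pi_pi, ENNReal.toReal_mul, ENNReal.toReal_prod] at h3
    refine le_trans ?_ h3
    refine mul_le_mul_of_nonneg_right ?_ measureReal_nonneg
    refine Finset.prod_le_prod (fun j _ => (hk0 j).le) fun j _ => hk j (a j) ?_
    calc |a j| ≤ Λ * t := haΛ j
      _ ≤ Λ * |L| := by gcongr; exact htL.trans (le_abs_self L)

end Series

/-! ### The Markov property and the Feynman-Kac weight -/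

section Auxiliary

theorem measurable_traj_of_lt {H : Type*} [NormedAddCommGroup H] [MeasurableSpace H]
    [MeasurableAdd₂ H] {Ω : Type*} [MeasurableSpace Ω] {S : H → H}
    (hS : Measurable S) {η : ℕ → Ω → H} (x : H) {k : ℕ} (hη : ∀ i < k, Measurable (η i)) {n : ℕ}
    (hn : n ≤ k) : Measurable (traj S η x n) := by
  induction n with
  | zero => exact measurable_const
  | succ n ih => exact (hS.comp (ih (by lia))).add (hη n (by lia))

theorem traj_congr {H : Type*} [NormedAddCommGroup H] {Ω : Type*} {S : H → H}
    {η η' : ℕ → Ω → H} (x : H) {ω : Ω} (h : ∀ i, η i ω = η' i ω) (n : ℕ) :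
    traj S η x n ω = traj S η' x n ω := by
  induction n with
  | zero => rfl
  | succ n ih => simp only [traj, ih, h]

/-- The Feynman-Kac operator `g ↦ ∫ exp (δ p) g dκ(x, ·)`. -/
noncomputable def feynmanKac {H : Type*} [MeasurableSpace H] (κ : Kernel H H) (p : H → ℝ≥0)
    (δ : ℝ) (g : H → ℝ≥0∞) (x : H) : ℝ≥0∞ :=
  ∫⁻ y, ENNReal.ofReal (Real.exp (δ * p y)) * g y ∂κ x

theorem measurable_feynmanKac {H : Type*} [MeasurableSpace H] {κ : Kernel H H} {p : H → ℝ≥0}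
    (hp : Measurable p) (δ : ℝ) {g : H → ℝ≥0∞} (hg : Measurable g) :
    Measurable (feynmanKac κ p δ g) := by
  have : Measurable fun y => ENNReal.ofReal (Real.exp (δ * p y)) * g y := by fun_prop
  exact this.lintegral_kernel

end Auxiliary

section Markov

variable {H : Type*} [NormedAddCommGroup H] [MeasurableSpace H] [BorelSpace H]
  [SecondCountableTopology H]

/-- The one-step transition kernel `x ↦ law of S x + η`, where `η` has law `m`. -/
noncomputable def kickKernel (S : H → H) (hS : Continuous S) (m : Measure H) [SFinite m] :
    Kernel H H where
  toFun x := m.map fun z => S x + z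
  measurable' := by
    have hm : Measurable fun z : H × H => S z.1 + z.2 :=
      (hS.measurable.comp measurable_fst).add measurable_snd
    refine Measure.measurable_of_measurable_coe _ fun s hs => ?_
    have h : (fun x => (m.map fun z => S x + z) s)
        = fun x => m (Prod.mk x ⁻¹' ((fun z : H × H => S z.1 + z.2) ⁻¹' s)) := by
      funext x
      exact Measure.map_apply (measurable_const_add _) hs
    rw [h]
    exact measurable_measure_prodMk_left (hm hs)

theorem kickKernel_apply (S : H → H) (hS : Continuous S) (m : Measure H) [SFinite m] (x : H) :
    kickKernel S hS m x = m.map fun z => S x + z := rfl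

instance (S : H → H) (hS : Continuous S) (m : Measure H) [IsProbabilityMeasure m] :
    IsMarkovKernel (kickKernel S hS m) :=
  ⟨fun x => by
    rw [kickKernel_apply]
    exact Measure.isProbabilityMeasure_map (measurable_const_add _).aemeasurable⟩

theorem lintegral_kickKernel (S : H → H) (hS : Continuous S) (m : Measure H) [SFinite m] (x : H)
    {g : H → ℝ≥0∞} (hg : Measurable g) :
    ∫⁻ y, g y ∂(kickKernel S hS m x) = ∫⁻ z, g (S x + z) ∂m := by
  rw [kickKernel_apply, lintegral_map hg (measurable_const_add _)]

variable {Ω : Type*} [MeasurableSpace Ω] {P : Measure Ω} [IsProbabilityMeasure P]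

/-- The kicks have a common law, and each kick is independent of the past of the trajectory. -/
structure IsKick (S : H → H) (P : Measure Ω) (η : ℕ → Ω → H) (m : Measure H) : Prop where
  measurable : ∀ k, Measurable (η k)
  law : ∀ k, P.map (η k) = m
  indep : ∀ (x : H) (k : ℕ), IndepFun (fun ω (n : Fin (k + 1)) => traj S η x n ω) (η k) P

variable {S : H → H} {η : ℕ → Ω → H} {m : Measure H}

/-- Integration over the last kick first. -/
theorem IsKick.lintegral (hS : Continuous S) (h : IsKick S P η m) (x : H) (k : ℕ)
    {Ψ : (Fin (k + 1) → H) × H → ℝ≥0∞} (hΨ : Measurable Ψ) :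
    ∫⁻ ω, Ψ (fun n => traj S η x n ω, η k ω) ∂P
      = ∫⁻ ω, ∫⁻ z, Ψ (fun n => traj S η x n ω, z) ∂m ∂P := by
  have hpm : Measurable fun ω (n : Fin (k + 1)) => traj S η x n ω :=
    measurable_pi_lambda _ fun n => measurable_traj_of_lt hS.measurable x
      (fun i _ => h.measurable i) le_rfl
  have : IsProbabilityMeasure m := by
    rw [← h.law k]
    exact Measure.isProbabilityMeasure_map (h.measurable k).aemeasurable
  have h1 := (h.indep x k).map_prod_eq_prod_map_map hpm.aemeasurable (h.measurable k).aemeasurable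
  rw [h.law k] at h1
  rw [← lintegral_map (f := Ψ) hΨ (hpm.prodMk (h.measurable k)), h1, lintegral_prod _
    hΨ.aemeasurable, lintegral_map hΨ.lintegral_prod_right' hpm]

theorem IsKick.transition_succ (hS : Continuous S) [SFinite m] (h : IsKick S P η m) (x : H)
    (k : ℕ) : transition S η P (k + 1) x = (transition S η P k x).bind (kickKernel S hS m) := by
  have htm : ∀ n, Measurable (traj S η x n) := fun n =>
    measurable_traj_of_lt hS.measurable x (fun i _ => h.measurable i) le_rfl
  have hSm := hS.measurable
  ext s hs
  rw [transition, Measure.map_apply (htm _) hs,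
    Measure.bind_apply hs (kickKernel S hS m).measurable.aemeasurable, transition,
    lintegral_map ((kickKernel S hS m).measurable_coe hs) (htm k)]
  have h1 := h.lintegral hS x k
    (Ψ := fun z => s.indicator 1 (S (z.1 (Fin.last k)) + z.2)) (by
      refine (measurable_one.indicator hs).comp ?_
      fun_prop)
  have h2 : ∀ ω, S (traj S η x k ω) + η k ω = traj S η x (k + 1) ω := fun ω => rfl
  simp only [Fin.val_last, h2] at h1
  rw [← lintegral_indicator_one (htm (k + 1) hs)]
  refine Eq.trans (lintegral_congr fun ω => rfl) (h1.trans (lintegral_congr fun ω => ?_))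
  rw [kickKernel_apply, Measure.map_apply (measurable_const_add _) hs,
    ← lintegral_indicator_one (measurable_const_add _ hs)]
  rfl

theorem IsKick.dualSemigroup_eq (hS : Continuous S) [SFinite m] (h : IsKick S P η m)
    (lam : Measure H) (k : ℕ) : dualSemigroup S η P k lam = lawAt (kickKernel S hS m) lam k := by
  have htr : ∀ k, Measurable (transition S η P k) := by
    intro k
    refine Measure.measurable_of_measurable_coe _ fun s hs => ?_
    have h1 : (fun x => transition S η P k x s)
        = fun x => P (Prod.mk x ⁻¹' ((fun z : H × Ω => traj S η z.1 k z.2) ⁻¹' s)) := by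
      funext x
      exact Measure.map_apply (measurable_traj_of_lt hS.measurable x
        (fun i _ => h.measurable i) le_rfl) hs
    rw [h1]
    exact measurable_measure_prodMk_left (measurable_traj hS h.measurable k hs)
  induction k with
  | zero =>
    have h1 : transition S η P 0 = Measure.dirac := by
      funext x
      change P.map (fun _ => x) = _
      rw [Measure.map_const, measure_univ, one_smul]
    rw [dualSemigroup, h1, Measure.bind_dirac]
    rfl
  | succ k ih =>
    rw [lawAt_succ, ← ih, dualSemigroup, dualSemigroup,
      Measure.bind_bind (htr k).aemeasurable (kickKernel S hS m).measurable.aemeasurable]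
    congr 1
    funext x
    exact h.transition_succ hS x k

/-- The exponential functional of the trajectory is given by the iterates of the Feynman-Kac
operator. -/
theorem IsKick.feynmanKac_iterate (hS : Continuous S) [SFinite m] (h : IsKick S P η m)
    {p : H → ℝ≥0} (hp : Measurable p) (δ : ℝ) (x : H) (k : ℕ) {g : H → ℝ≥0∞} (hg : Measurable g) :
    ∫⁻ ω, ENNReal.ofReal (Real.exp (δ * ∑ n ∈ Finset.Icc 1 k, (p (traj S η x n ω) : ℝ)))
        * g (traj S η x k ω) ∂P
      = (feynmanKac (kickKernel S hS m) p δ)^[k] g x := by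
  induction k generalizing g with
  | zero => simp [traj]
  | succ k ih =>
    have hSm := hS.measurable
    rw [Function.iterate_succ_apply, ← ih (measurable_feynmanKac hp δ hg)]
    have hw : Measurable fun y => ENNReal.ofReal (Real.exp (δ * p y)) * g y := by fun_prop
    have h1 := h.lintegral hS x k (Ψ := fun z =>
      -- the sum over the past leaves out the time `0`
      ENNReal.ofReal (Real.exp (δ * ∑ n : Fin (k + 1), if (n : ℕ) = 0 then 0 else (p (z.1 n) : ℝ)))
        * (ENNReal.ofReal (Real.exp (δ * p (S (z.1 (Fin.last k)) + z.2)))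
          * g (S (z.1 (Fin.last k)) + z.2))) (by
        refine Measurable.mul ?_ (hw.comp (g := fun y =>
          ENNReal.ofReal (Real.exp (δ * p y)) * g y) (by fun_prop))
        have : ∀ n : Fin (k + 1), Measurable fun z : (Fin (k + 1) → H) × H =>
            if (n : ℕ) = 0 then (0 : ℝ) else (p (z.1 n) : ℝ) := by
          intro n
          split_ifs
          · exact measurable_const
          · fun_prop
        fun_prop)
    have hsum : ∀ ω, ∑ n : Fin (k + 1), (if (n : ℕ) = 0 then 0 else (p (traj S η x n ω) : ℝ))
        = ∑ n ∈ Finset.Icc 1 k, (p (traj S η x n ω) : ℝ) := by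
      intro ω
      rw [← Finset.sum_range (fun n => if n = 0 then (0 : ℝ) else (p (traj S η x n ω) : ℝ)),
        Finset.sum_range_succ', Finset.range_eq_Ico,
        Finset.sum_Ico_add' (fun n => if n = 0 then (0 : ℝ) else (p (traj S η x n ω) : ℝ)) 0 k 1]
      simp only [if_true, add_zero]
      exact Finset.sum_congr (by ext n; simp [Nat.succ_le_iff]) fun n hn =>
        if_neg (by have := (Finset.mem_Icc.mp hn).1; lia)
    have h2 : ∀ ω, S (traj S η x k ω) + η k ω = traj S η x (k + 1) ω := fun ω => rfl
    simp only [Fin.val_last, hsum, h2] at h1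
    refine Eq.trans (lintegral_congr fun ω => ?_) (h1.trans (lintegral_congr fun ω => ?_))
    · rw [Finset.sum_Icc_succ_top (by lia), mul_add, Real.exp_add,
        ENNReal.ofReal_mul (Real.exp_nonneg _), mul_assoc]
    · rw [lintegral_const_mul _ (by fun_prop), feynmanKac,
        lintegral_kickKernel S hS m _ hw]

/-- For a stabilisable functional, the resolvent `∑ a ^ k 𝔼 exp (δ (p(u_1) + ⋯ + p(u_k)))` of the
Feynman-Kac semigroup is a weight which the twisted chain multiplies at most by `1 / a`. -/
theorem exists_weight (hS : Continuous S) [IsProbabilityMeasure m] (h : IsKick S P η m)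
    {p : H → ℝ≥0} (hp : Measurable p) {Q : ℝ≥0 → ℝ≥0} {c δ : ℝ}
    (hstab : StabilisableWith S η P p Q c δ) :
    ∃ G : H → ℝ, Measurable G ∧ (∀ x, 1 ≤ G x) ∧ (∀ x, G x ≤ 1 + Q ‖x‖₊) ∧
      ∀ x, Integrable (fun y => Real.exp (δ * p y) * G y) (kickKernel S hS m x) ∧
        ∫ y, Real.exp (δ * p y) * G y ∂(kickKernel S hS m x) ≤ 2 * Real.exp c * G x := by
  set κ := kickKernel S hS m with hκ
  set L := feynmanKac κ p δ with hL
  set a : ℝ≥0∞ := ENNReal.ofReal (Real.exp (-c) / 2) with ha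
  have ha' : ENNReal.ofReal (2 * Real.exp c) * a = 1 := by
    rw [ha, ← ENNReal.ofReal_mul (by positivity), Real.exp_neg]
    rw [show 2 * Real.exp c * ((Real.exp c)⁻¹ / 2) = 1 by field_simp, ENNReal.ofReal_one]
  have hLm : ∀ k, Measurable (L^[k] 1) := by
    intro k
    induction k with
    | zero => exact measurable_one
    | succ k ih => rw [Function.iterate_succ_apply']; exact measurable_feynmanKac hp δ ih
  set G : H → ℝ≥0∞ := fun x => ∑' k, a ^ k * L^[k] 1 x with hG
  have hGm : Measurable G := Measurable.tsum fun k => (hLm k).const_mul _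
  -- the resolvent identity
  have hGrec : ∀ x, G x = 1 + a * L G x := by
    intro x
    have h1 : L G x = ∑' k, a ^ k * L^[k + 1] 1 x := by
      rw [hL]
      simp only [feynmanKac, hG, ← ENNReal.tsum_mul_left]
      rw [lintegral_tsum fun k => by
        have := hLm k
        exact Measurable.aemeasurable (by fun_prop)]
      refine tsum_congr fun k => ?_
      rw [Function.iterate_succ_apply']
      simp only [feynmanKac]
      have := hLm k
      rw [← lintegral_const_mul _ (by fun_prop)]
      refine lintegral_congr fun y => ?_
      ring
    rw [h1, ← ENNReal.tsum_mul_left]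
    simp only [hG]
    rw [tsum_eq_zero_add' ENNReal.summable]
    simp only [pow_zero, Function.iterate_zero, id, Pi.one_apply, one_mul]
    congr 1
    refine tsum_congr fun k => ?_
    rw [pow_succ]
    ring
  have hGle : ∀ x, G x ≤ 1 + Q ‖x‖₊ := by
    intro x
    simp only [hG]
    rw [tsum_eq_zero_add' ENNReal.summable]
    simp only [pow_zero, Function.iterate_zero, id, Pi.one_apply, one_mul]
    gcongr
    calc ∑' k, a ^ (k + 1) * L^[k + 1] 1 x
        ≤ ∑' k : ℕ, (Q ‖x‖₊ : ℝ≥0∞) * (2⁻¹ : ℝ≥0∞) ^ (k + 1) := by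
          refine ENNReal.tsum_le_tsum fun k => ?_
          have h1 := hstab.bound (k + 1) (by lia) x
          have h2 := h.feynmanKac_iterate hS hp δ x (k + 1) (g := 1) measurable_one
          simp only [Pi.one_apply, mul_one] at h2
          rw [h2] at h1
          calc a ^ (k + 1) * L^[k + 1] 1 x
              ≤ a ^ (k + 1) * (Q ‖x‖₊ * ENNReal.ofReal (Real.exp (c * (k + 1 : ℕ)))) := by
                gcongr
            _ = Q ‖x‖₊ * (2⁻¹ : ℝ≥0∞) ^ (k + 1) := by
                rw [mul_left_comm, ha, ← ENNReal.ofReal_pow (by positivity),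
                  ← ENNReal.ofReal_mul (by positivity), div_pow, ← Real.exp_nat_mul,
                  div_mul_eq_mul_div, ← Real.exp_add]
                have e1 : ((k + 1 : ℕ) : ℝ) * -c + c * ((k + 1 : ℕ) : ℝ) = 0 := by ring
                rw [e1, Real.exp_zero, one_div, ← inv_pow, ENNReal.ofReal_pow (by norm_num)]
                congr 2
                rw [ENNReal.ofReal_inv_of_pos two_pos]
                norm_num
      _ = Q ‖x‖₊ := by
          rw [ENNReal.tsum_mul_left, ENNReal.tsum_geometric_add_one]
          simp only [ENNReal.one_sub_inv_two, inv_inv]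
          rw [ENNReal.inv_mul_cancel two_ne_zero (by norm_num), mul_one]
  have hGfin : ∀ x, G x ≠ ∞ := fun x => ((hGle x).trans_lt (by
    exact ENNReal.add_lt_top.mpr ⟨ENNReal.one_lt_top, ENNReal.coe_lt_top⟩)).ne
  have hLG : ∀ x, L G x ≤ ENNReal.ofReal (2 * Real.exp c) * G x := by
    intro x
    calc L G x = ENNReal.ofReal (2 * Real.exp c) * (a * L G x) := by
          rw [← mul_assoc, ha', one_mul]
      _ ≤ ENNReal.ofReal (2 * Real.exp c) * G x := by
          gcongr
          rw [hGrec x]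
          exact le_add_self
  have hlint : ∀ x, ∫⁻ y, ENNReal.ofReal (Real.exp (δ * p y) * (G y).toReal) ∂κ x
      ≤ ENNReal.ofReal (2 * Real.exp c * (G x).toReal) := by
    intro x
    have e : ∀ y, ENNReal.ofReal (Real.exp (δ * p y) * (G y).toReal)
        = ENNReal.ofReal (Real.exp (δ * p y)) * G y := fun y => by
      rw [ENNReal.ofReal_mul (Real.exp_nonneg _), ENNReal.ofReal_toReal (hGfin y)]
    simp only [e]
    rw [ENNReal.ofReal_mul (by positivity), ENNReal.ofReal_toReal (hGfin x)]
    exact hLG x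
  have hm : Measurable fun y => Real.exp (δ * p y) * (G y).toReal := by
    have := hGm.ennreal_toReal
    fun_prop
  have hn : ∀ y, 0 ≤ Real.exp (δ * p y) * (G y).toReal := fun y => by positivity
  refine ⟨fun x => (G x).toReal, hGm.ennreal_toReal, fun x => ?_, fun x => ?_, fun x => ⟨?_, ?_⟩⟩
  · have := ENNReal.toReal_mono (hGfin x) (show 1 ≤ G x by rw [hGrec x]; exact le_self_add)
    simpa using this
  · have := ENNReal.toReal_mono (by simp) (hGle x)
    rwa [ENNReal.toReal_add (by simp) (by simp), ENNReal.toReal_one, ENNReal.coe_toReal] at this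
  · refine ⟨hm.aestronglyMeasurable, ?_⟩
    rw [hasFiniteIntegral_iff_ofReal (ae_of_all _ hn)]
    exact (hlint x).trans_lt ENNReal.ofReal_lt_top
  · rw [integral_eq_lintegral_of_nonneg_ae (ae_of_all _ hn) hm.aestronglyMeasurable]
    exact ENNReal.toReal_le_of_le_ofReal (by positivity) (hlint x)

end Markov

section NoiseKick

variable {H : Type*} [NormedAddCommGroup H] [InnerProductSpace ℝ H] [CompleteSpace H]
  [MeasurableSpace H] [BorelSpace H] [SecondCountableTopology H]
  {Ω : Type*} [MeasurableSpace Ω] {P : Measure Ω}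

/-- The kicks are measurable functions of the rows `(ξ j k)_j`, which are independent for different
`k` and have the same law. -/
theorem NoiseStructure.isKick {S : H → H} (hS : Continuous S) {Φ p : H → ℝ≥0} {γ : ℕ → ℝ}
    {e : HilbertBasis ℕ ℝ H} {η : ℕ → Ω → H} {b : ℕ → ℝ} {ξ : ℕ → ℕ → Ω → ℝ} {dens : ℕ → ℝ → ℝ}
    (h : NoiseStructure Φ p γ e P η b ξ dens) : IsKick S P η (P.map (η 0)) := by
  have hser : ∀ k, ∀ᵐ ω ∂P, kickSeries e b (fun j => ξ j k ω) = η k ω := fun k => by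
    filter_upwards [h.η_eq k] with ω hω using kickSeries_eq hω
  have hrow : ∀ k, P.map (fun ω j => ξ j k ω)
      = Measure.infinitePi fun j => densMeasure (dens j) := by
    intro k
    have h1 : iIndepFun (fun j => ξ j k) P :=
      h.ξ_indep.precomp (g := fun j => (j, k)) (fun i j hij => (Prod.mk.inj hij).1)
    rw [h1.map_fun_eq_infinitePi_map fun j => h.ξ_measurable j k]
    simp only [h.ξ_law]
    rfl
  have hrm : ∀ k, Measurable fun ω j => ξ j k ω := fun k =>
    measurable_pi_lambda _ fun j => h.ξ_measurable j k
  have hlaw : ∀ k, P.map (η k)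
      = (Measure.infinitePi fun j => densMeasure (dens j)).map (kickSeries e b) := by
    intro k
    rw [← hrow k, Measure.map_map (measurable_kickSeries e b) (hrm k)]
    exact Measure.map_congr ((hser k).mono fun ω hω => hω.symm)
  refine ⟨h.η_measurable, fun k => by rw [hlaw, hlaw], fun x k => ?_⟩
  -- versions of the kicks which are measurable with respect to the rows on the whole space
  obtain ⟨η', hη'⟩ : ∃ η' : ℕ → Ω → H, η' = fun k ω => kickSeries e b (fun j => ξ j k ω) :=
    ⟨_, rfl⟩
  obtain ⟨ζ, hζ⟩ : ∃ ζ : ℕ × ℕ → Ω → ℝ, ζ = fun i => ξ i.1 i.2 := ⟨_, rfl⟩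
  have hη'm : ∀ (A : Set (ℕ × ℕ)) (k : ℕ), (∀ j, (j, k) ∈ A) → Measurable[sigmaOf ζ A] (η' k) := by
    intro A k hA
    rw [hη']
    refine (measurable_kickSeries e b).comp
      (@measurable_pi_lambda _ _ _ (sigmaOf ζ A) _ _ fun j => ?_)
    have := measurable_sigmaOf (ξ := ζ) (hA j)
    rwa [hζ] at this ⊢
  have hpast : Measurable[sigmaOf ζ {i | i.2 < k}] fun ω (n : Fin (k + 1)) => traj S η' x n ω :=
    @measurable_pi_lambda _ _ _ (sigmaOf ζ _) _ _ fun n =>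
      @measurable_traj_of_lt H _ _ _ Ω (sigmaOf ζ _) S hS.measurable η' x k
        (fun i hi => hη'm _ i fun j => hi) n (Nat.lt_succ_iff.mp n.2)
  have hnow : Measurable[sigmaOf ζ {i | i.2 = k}] (η' k) := hη'm _ k fun j => rfl
  have hdisj : Disjoint {i : ℕ × ℕ | i.2 < k} {i | i.2 = k} := by
    rw [Set.disjoint_left]
    intro i (h1 : i.2 < k) (h2 : i.2 = k)
    lia
  have hζm : ∀ i, Measurable (ζ i) := fun i => by rw [hζ]; exact h.ξ_measurable i.1 i.2
  have hζi : iIndepFun ζ P := by rw [hζ]; exact h.ξ_indep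
  have hind := indepFun_of_sigmaOf hζm hζi hdisj hpast hnow
  rw [hη'] at hind
  refine hind.congr ?_ (hser k)
  filter_upwards [ae_all_iff.mpr hser] with ω hω
  funext n
  exact traj_congr x hω n

end NoiseKick

/-! ### Finitely many modes of the increments of the map -/

section Modes

variable {H : Type*} [NormedAddCommGroup H] [InnerProductSpace ℝ H]

theorem norm_sub_sum_inner_le {e : ℕ → H} (he : Orthonormal ℝ e) (N : ℕ) (w : H) :
    ‖w - ∑ j ∈ Finset.range N, inner ℝ (e j) w • e j‖ ≤ ‖w‖ := by
  set P := ∑ j ∈ Finset.range N, inner ℝ (e j) w • e j with hP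
  have h1 : inner ℝ (w - P) P = 0 := by
    rw [hP, inner_sum]
    refine Finset.sum_eq_zero fun j hj => ?_
    rw [inner_smul_right, inner_sub_left, sum_inner]
    have : ∑ i ∈ Finset.range N, inner ℝ (inner ℝ (e i) w • e i) (e j) = inner ℝ w (e j) := by
      rw [Finset.sum_eq_single_of_mem j hj]
      · rw [inner_smul_left, real_inner_self_eq_norm_sq, he.1 j, real_inner_comm w]
        simp
      · intro i _ hij
        rw [inner_smul_left, he.2 hij, mul_zero]
    rw [this, sub_self, mul_zero]
  have h2 := norm_add_mul_self_real (w - P) P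
  rw [sub_add_cancel, h1] at h2
  nlinarith [norm_nonneg (w - P), norm_nonneg P, norm_nonneg w]

theorem eventually_norm_sub_sum_inner_le [CompleteSpace H] (e : HilbertBasis ℕ ℝ H)
    (V : Submodule ℝ H) [FiniteDimensional ℝ V] {ε : ℝ} (hε : 0 < ε) :
    ∀ᶠ N in atTop, ∀ v ∈ V, ‖v - ∑ j ∈ Finset.range N, inner ℝ (e j) v • e j‖ ≤ ε * ‖v‖ := by
  set f := stdOrthonormalBasis ℝ V with hf
  have h1 : ∀ w : H, Tendsto (fun N => ‖w - ∑ j ∈ Finset.range N, inner ℝ (e j) w • e j‖) atTop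
      (𝓝 0) := by
    intro w
    have h := (e.hasSum_repr w).tendsto_sum_nat
    have h2 := (tendsto_const_nhds (x := w)).sub h
    rw [sub_self] at h2
    simpa only [norm_zero, e.repr_apply_apply] using h2.norm
  have h2 : Tendsto (fun N => ∑ i,
      ‖(f i : H) - ∑ j ∈ Finset.range N, inner ℝ (e j) (f i : H) • e j‖) atTop (𝓝 0) := by
    simpa using tendsto_finsetSum Finset.univ fun i _ => h1 (f i : H)
  filter_upwards [h2.eventually (ge_mem_nhds hε)] with N hN v hv
  have hrep : v = ∑ i, inner ℝ (f i) (⟨v, hv⟩ : V) • (f i : H) := by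
    have := congrArg (Subtype.val) (f.sum_repr' ⟨v, hv⟩)
    simpa using this.symm
  have hlin : v - ∑ j ∈ Finset.range N, inner ℝ (e j) v • e j
      = ∑ i, inner ℝ (f i) (⟨v, hv⟩ : V)
        • ((f i : H) - ∑ j ∈ Finset.range N, inner ℝ (e j) (f i : H) • e j) := by
    simp only [smul_sub, Finset.sum_sub_distrib, ← hrep, Finset.smul_sum, smul_smul]
    rw [Finset.sum_comm]
    congr 1
    refine Finset.sum_congr rfl fun j _ => ?_
    rw [← Finset.sum_smul]
    congr 1
    conv_lhs => rw [hrep]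
    simp only [inner_sum, inner_smul_right]
  calc ‖v - ∑ j ∈ Finset.range N, inner ℝ (e j) v • e j‖
      ≤ ∑ i, ‖v‖ * ‖(f i : H) - ∑ j ∈ Finset.range N, inner ℝ (e j) (f i : H) • e j‖ := by
        rw [hlin]
        refine (norm_sum_le _ _).trans (Finset.sum_le_sum fun i _ => ?_)
        rw [norm_smul]
        gcongr
        refine (norm_inner_le_norm _ _).trans ?_
        rw [f.orthonormal.1 i, one_mul]
        rfl
    _ ≤ ε * ‖v‖ := by
        rw [← Finset.mul_sum, mul_comm]
        gcongr

variable {S : H → H} {p : H → ℝ≥0} {γ : ℕ → ℝ} {V : ℕ → Submodule ℝ H}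
  [∀ N, FiniteDimensional ℝ (V N)]

/-- The case `N = 0` of the compactness condition, where the projection vanishes. -/
theorem Compactness.norm_sub_le (hB : Compactness S p γ V) (x y : H) :
    ‖S x - S y‖ ≤ (γ 0)⁻¹ * (Real.exp (p x + p y) * ‖x - y‖) := by
  have h := hB.bound x y 0
  have h0 : (V 0).starProjection (S x - S y) = 0 := by
    rw [Submodule.starProjection_apply_eq_zero_iff, hB.V_zero]
    simp
  rw [h0, sub_zero] at h
  rwa [← mul_assoc]

/-- The compactness condition holds for the spectral projections of any Hilbert basis: the
projection on `V n` captures the increments of `S` up to `(γ n)⁻¹`, and a finite-dimensional `V n`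
is almost contained in the span of the first vectors of the basis. -/
theorem Compactness.exists_modes [CompleteSpace H] (hB : Compactness S p γ V)
    (e : HilbertBasis ℕ ℝ H) {ε : ℝ} (hε : 0 < ε) :
    ∃ N, 1 ≤ N ∧ ∀ x y : H,
      ‖(S x - S y) - ∑ j ∈ Finset.range N, inner ℝ (e j) (S x - S y) • e j‖
        ≤ ε * (Real.exp (p x + p y) * ‖x - y‖) := by
  have hγ0 := hB.γ_pos 0
  obtain ⟨n, hn⟩ := (hB.γ_tendsto.eventually (eventually_ge_atTop (2 / ε))).exists
  have hn' : (γ n)⁻¹ ≤ ε / 2 := by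
    rw [inv_le_comm₀ (hB.γ_pos n) (by positivity), inv_div]
    exact hn
  obtain ⟨N, hN, hN1⟩ := ((eventually_norm_sub_sum_inner_le e (V n)
    (show 0 < ε / 2 * γ 0 by positivity)).and (eventually_ge_atTop 1)).exists
  refine ⟨N, hN1, fun x y => ?_⟩
  set w := S x - S y with hw
  set E := Real.exp (p x + p y) * ‖x - y‖ with hE
  set v := (V n).starProjection w with hv
  have hE0 : 0 ≤ E := by positivity
  have h1 : ‖w - v‖ ≤ ε / 2 * E := by
    refine (hB.bound x y n).trans ?_
    rw [mul_assoc]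
    gcongr
  have h2 : ‖v‖ ≤ (γ 0)⁻¹ * E :=
    ((V n).norm_starProjection_apply_le w).trans (hB.norm_sub_le x y)
  have h3 : w - ∑ j ∈ Finset.range N, inner ℝ (e j) w • e j
      = ((w - v) - ∑ j ∈ Finset.range N, inner ℝ (e j) (w - v) • e j)
        + (v - ∑ j ∈ Finset.range N, inner ℝ (e j) v • e j) := by
    simp only [inner_sub_right, sub_smul, Finset.sum_sub_distrib]
    abel
  rw [h3]
  calc _ ≤ ‖w - v‖ + ε / 2 * γ 0 * ‖v‖ := (norm_add_le _ _).trans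
        (add_le_add (norm_sub_sum_inner_le e.orthonormal N _)
          (hN v (Submodule.starProjection_apply_mem _ _)))
    _ ≤ ε / 2 * E + ε / 2 * γ 0 * ((γ 0)⁻¹ * E) := by gcongr
    _ = ε * E := by field_simp; ring

end Modes

/-! ### Couplings of the transition probabilities -/

section Squeezing

variable {H : Type*} [NormedAddCommGroup H] [MeasurableSpace H]

/-- The noise with law `m` can be split so that its major part, transported by a shift `h`, makes
the images of `x` and `y` come close: the increment of `S` is reduced by the factor `ε`, the mass
of the part transported is at least `1 - Λ t`, and the mass of noise smaller than `r` in this part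
is bounded from below. Here `t = exp (p x + p y) ‖x - y‖`. -/
def SqueezingKick (S : H → H) (p : H → ℝ≥0) (m : Measure H) (ε Λ r : ℝ) : Prop :=
  ∀ L : ℝ, ∃ k : ℝ, 0 < k ∧ ∀ x y : H, ∃ (h : H) (ν : Measure H), ν ≤ m ∧
    ν.map (fun z => z + h) ≤ m ∧
    ‖S x - S y - h‖ ≤ ε * (Real.exp (p x + p y) * ‖x - y‖) ∧
    1 - Λ * (Real.exp (p x + p y) * ‖x - y‖) ≤ ν.real Set.univ ∧
    (Real.exp (p x + p y) * ‖x - y‖ ≤ L → k ≤ ν.real (Metric.ball 0 r))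

variable [BorelSpace H] [SecondCountableTopology H] {S : H → H} {hS : Continuous S}
  {m : Measure H} [IsProbabilityMeasure m]

/-- The part `ν` of the noise drives the process from `x`, and its translate by `h` drives the one
from `y`. -/
theorem exists_coupling_of_shift (x y h : H) {ν : Measure H} (hν : ν ≤ m)
    (hνh : ν.map (fun z => z + h) ≤ m) :
    ∃ π : Measure (H × H), IsCoupling π (kickKernel S hS m x) (kickKernel S hS m y) ∧
      ν.map (fun z => (S x + z, S y + (z + h))) ≤ π := by
  have hm : Measurable fun z => (S x + z, S y + (z + h)) := by fun_prop
  refine exists_coupling_of_le ?_ ?_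
  · rw [Measure.map_map measurable_fst hm, kickKernel_apply]
    exact Measure.map_mono hν (measurable_const_add _)
  · rw [Measure.map_map measurable_snd hm, kickKernel_apply]
    have h1 := Measure.map_mono hνh (measurable_const_add (S y))
    rwa [Measure.map_map (measurable_const_add _) (measurable_add_const _)] at h1

end Squeezing

/-! ### The contracting distance -/

section Contraction

variable {H : Type*} [NormedAddCommGroup H]

/-- The power `s` of the norm distance, multiplied by `K` and by the geometric mean of the weight
`W` at the two points, and truncated at `1`. -/
noncomputable def weightedDist (K s : ℝ) (W : H → ℝ) (x y : H) : ℝ :=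
  min 1 (K * (‖x - y‖ ^ s * √(W x * W y)))

variable [MeasurableSpace H] [BorelSpace H] [SecondCountableTopology H]

theorem measurable_weightedDist (K s : ℝ) {W : H → ℝ} (hW : Measurable W) :
    Measurable (Function.uncurry (weightedDist K s W)) := by
  unfold weightedDist Function.uncurry
  fun_prop

variable {S : H → H} {hS : Continuous S} {m : Measure H} [IsProbabilityMeasure m]
  {p : H → ℝ≥0} {W : H → ℝ} {δ A : ℝ}

/-- Cauchy-Schwarz for the weight along a pair of processes driven by the same noise, up to a
shift. -/
theorem integral_sqrt_shift_le (hA : 0 ≤ A) (hW0 : ∀ x, 0 ≤ W x) (hWm : Measurable W)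
    (hWκ : ∀ x, Integrable W (kickKernel S hS m x) ∧
      ∫ y, W y ∂kickKernel S hS m x ≤ A * Real.exp (-(δ * p x)) * W x)
    (x y h : H) {ν : Measure H} (hν : ν ≤ m) (hνh : ν.map (fun z => z + h) ≤ m) :
    Integrable (fun z => √(W (S x + z) * W (S y + (z + h)))) ν ∧
      ∫ z, √(W (S x + z) * W (S y + (z + h))) ∂ν
        ≤ A * Real.exp (-(δ / 2 * (p x + p y))) * √(W x * W y) := by
  have hi : ∀ x, Integrable (fun z => W (S x + z)) m ∧
      ∫ z, W (S x + z) ∂m ≤ A * Real.exp (-(δ * p x)) * W x := by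
    intro x
    obtain ⟨h1, h2⟩ := hWκ x
    rw [kickKernel_apply] at h1 h2
    rw [integral_map (measurable_const_add _).aemeasurable hWm.aestronglyMeasurable] at h2
    exact ⟨(integrable_map_measure hWm.aestronglyMeasurable
      (measurable_const_add _).aemeasurable).mp h1, h2⟩
  have hx1 := (hi x).1.mono_measure hν
  have hx2 := (integral_mono_measure hν (ae_of_all _ fun z => hW0 (S x + z)) (hi x).1).trans
    (hi x).2
  have hym : AEStronglyMeasurable (fun z => W (S y + z)) (ν.map fun z => z + h) :=
    (hWm.comp (measurable_const_add _)).aestronglyMeasurable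
  have hy1 : Integrable (fun z => W (S y + (z + h))) ν :=
    (integrable_map_measure hym (measurable_add_const _).aemeasurable).mp
      ((hi y).1.mono_measure hνh)
  have hy2 : ∫ z, W (S y + (z + h)) ∂ν ≤ A * Real.exp (-(δ * p y)) * W y := by
    rw [← integral_map (φ := fun z => z + h) (measurable_add_const _).aemeasurable hym]
    exact (integral_mono_measure hνh (ae_of_all _ fun z => hW0 (S y + z)) (hi y).1).trans (hi y).2
  obtain ⟨h1, h2⟩ := integral_sqrt_mul_le (fun z => hW0 (S x + z)) (fun z => hW0 (S y + (z + h)))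
    hx1 hy1
  refine ⟨h1, h2.trans ?_⟩
  have hy3 : 0 ≤ ∫ z, W (S y + (z + h)) ∂ν := integral_nonneg fun z => hW0 _
  have hx0 := hW0 x
  have h3 : (A * Real.exp (-(δ * p x)) * W x) * (A * Real.exp (-(δ * p y)) * W y)
      = (A * Real.exp (-(δ / 2 * (p x + p y)))) ^ 2 * (W x * W y) := by
    rw [mul_pow, ← Real.exp_nat_mul, show ((2 : ℕ) : ℝ) * -(δ / 2 * ((p x : ℝ) + p y))
      = -(δ * p x) + -(δ * p y) by push_cast; ring, Real.exp_add]
    ring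
  calc √((∫ z, W (S x + z) ∂ν) * ∫ z, W (S y + (z + h)) ∂ν)
      ≤ √((A * Real.exp (-(δ * p x)) * W x) * (A * Real.exp (-(δ * p y)) * W y)) := by gcongr
    _ = A * Real.exp (-(δ / 2 * (p x + p y))) * √(W x * W y) := by
        rw [h3, Real.sqrt_mul (by positivity), Real.sqrt_sq (by positivity)]

theorem integral_le_integral_add_of_le {X : Type*} [MeasurableSpace X] {σ π : Measure X}
    [IsProbabilityMeasure π] (hσ : σ ≤ π) {f : X → ℝ} (hf : Measurable f) (hf0 : ∀ x, 0 ≤ f x)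
    (hf1 : ∀ x, f x ≤ 1) : ∫ x, f x ∂π ≤ ∫ x, f x ∂σ + (1 - σ.real Set.univ) := by
  have hσf : IsFiniteMeasure σ := isFiniteMeasure_of_le π hσ
  have hi : ∀ τ : Measure X, IsFiniteMeasure τ → Integrable f τ := fun τ _ =>
    Integrable.of_bound hf.aestronglyMeasurable 1 (ae_of_all _ fun x => by
      rw [Real.norm_of_nonneg (hf0 x)]; exact hf1 x)
  have hsum := Measure.sub_add_cancel_of_le hσ
  have hfin : IsFiniteMeasure (π - σ) := isFiniteMeasure_of_le π (Measure.sub_le)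
  have h1 : (π - σ).real Set.univ = 1 - σ.real Set.univ := by
    have h2 : ((π - σ) + σ).real Set.univ = 1 := by rw [hsum]; exact probReal_univ
    rw [measureReal_add_apply] at h2
    linarith
  calc ∫ x, f x ∂π = ∫ x, f x ∂(π - σ) + ∫ x, f x ∂σ := by
        conv_lhs => rw [← hsum]
        exact integral_add_measure (hi _ hfin) (hi _ hσf)
    _ ≤ ∫ _, (1 : ℝ) ∂(π - σ) + ∫ x, f x ∂σ := by
        gcongr
        exacts [hi _ hfin, integrable_const _, hf1]
    _ = ∫ x, f x ∂σ + (1 - σ.real Set.univ) := by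
        rw [integral_const, smul_eq_mul, mul_one, h1, add_comm]

/-- A coupling of the transition probabilities which halves the weighted distance. The part of the
noise that is not transported contributes at most `min 1 (Λ t) ≤ (Λ t) ^ s`, which a large `K`
makes small with respect to the distance; for the part transported, the loss `exp (p x + p y)` in
the increment of `S` is compensated by the gain of the weight. -/
theorem exists_coupling_integral_le {s ε Λ r K : ℝ} (hA : 0 ≤ A) (hs : 0 < s) (hs1 : s ≤ 1)
    (hsδ : s ≤ δ / 2) (hWp : ∀ x, Real.exp (δ * p x) ≤ W x) (hWm : Measurable W)
    (hWκ : ∀ x, Integrable W (kickKernel S hS m x) ∧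
      ∫ y, W y ∂kickKernel S hS m x ≤ A * Real.exp (-(δ * p x)) * W x)
    (hε : 0 ≤ ε) (hΛ : 0 ≤ Λ) (hAε : A * ε ^ s ≤ 1 / 4) (hK : 4 * Λ ^ s ≤ K)
    (hkick : SqueezingKick S p m ε Λ r) {x y : H} (hxy : weightedDist K s W x y < 1) :
    ∃ π : Measure (H × H), IsCoupling π (kickKernel S hS m x) (kickKernel S hS m y) ∧
      ∫ z, weightedDist K s W z.1 z.2 ∂π ≤ 1 / 2 * weightedDist K s W x y := by
  have hK0 : 0 ≤ K := le_trans (by positivity) hK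
  have hW0 : ∀ x, 0 ≤ W x := fun x => (Real.exp_nonneg _).trans (hWp x)
  have hd0 : ∀ x y, 0 ≤ weightedDist K s W x y := fun x y => le_min zero_le_one (by positivity)
  obtain ⟨k, -, hk⟩ := hkick 0
  obtain ⟨h, ν, hν, hνh, h1, h2, -⟩ := hk x y
  obtain ⟨π, hπ, hσπ⟩ := exists_coupling_of_shift (hS := hS) x y h hν hνh
  have := hπ.isProbabilityMeasure
  have hφ : Measurable fun z => (S x + z, S y + (z + h)) := by fun_prop
  have hdm : Measurable fun z : H × H => weightedDist K s W z.1 z.2 :=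
    measurable_weightedDist K s hWm
  refine ⟨π, hπ, ?_⟩
  set D := ‖x - y‖ ^ s * √(W x * W y) with hD
  have hD0 : 0 ≤ D := by positivity
  have hdD : weightedDist K s W x y = K * D := by
    unfold weightedDist at hxy ⊢
    exact min_eq_right (by
      by_contra hc
      rw [min_eq_left (not_le.mp hc).le] at hxy
      exact lt_irrefl _ hxy)
  set t := Real.exp (p x + p y) * ‖x - y‖ with ht
  have ht0 : 0 ≤ t := by positivity
  have hE : Real.exp (δ / 2 * (p x + p y)) ≤ √(W x * W y) := by
    refine Real.le_sqrt_of_sq_le ?_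
    rw [← Real.exp_nat_mul, show ((2 : ℕ) : ℝ) * (δ / 2 * ((p x : ℝ) + p y))
      = δ * p x + δ * p y by push_cast; ring, Real.exp_add]
    exact mul_le_mul (hWp x) (hWp y) (Real.exp_nonneg _) (hW0 x)
  have hts : t ^ s ≤ Real.exp (δ / 2 * (p x + p y)) * ‖x - y‖ ^ s := by
    rw [ht, Real.mul_rpow (Real.exp_nonneg _) (norm_nonneg _), ← Real.exp_mul, mul_comm _ s]
    gcongr
  have hsplit := integral_le_integral_add_of_le hσπ hdm (fun z => hd0 z.1 z.2)
    (fun z => min_le_left _ _)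
  have hmass : 1 - (ν.map fun z => (S x + z, S y + (z + h))).real Set.univ ≤ Λ ^ s * D := by
    rw [map_measureReal_apply hφ .univ, Set.preimage_univ]
    have h3 : 1 - ν.real Set.univ ≤ (Λ * t) ^ s := by
      rcases le_total (Λ * t) 1 with hc | hc
      · refine le_trans (by linarith) (Real.self_le_rpow_of_le_one (by positivity) hc hs1)
      · exact le_trans (by linarith [measureReal_nonneg (μ := ν) (s := Set.univ)])
          (Real.one_le_rpow hc hs.le)
    refine h3.trans ?_
    rw [Real.mul_rpow hΛ ht0]
    gcongr
    calc t ^ s ≤ Real.exp (δ / 2 * (p x + p y)) * ‖x - y‖ ^ s := hts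
      _ ≤ √(W x * W y) * ‖x - y‖ ^ s := by gcongr
      _ = D := mul_comm _ _
  have hmove : ∫ z, weightedDist K s W z.1 z.2 ∂(ν.map fun z => (S x + z, S y + (z + h)))
      ≤ K * (A * ε ^ s * D) := by
    obtain ⟨h3, h4⟩ := integral_sqrt_shift_le (hS := hS) hA hW0 hWm hWκ x y h hν hνh
    rw [integral_map hφ.aemeasurable hdm.aestronglyMeasurable]
    have hνf : IsFiniteMeasure ν := isFiniteMeasure_of_le m hν
    calc ∫ z, weightedDist K s W (S x + z) (S y + (z + h)) ∂ν
        ≤ ∫ z, K * ((ε * t) ^ s * √(W (S x + z) * W (S y + (z + h)))) ∂ν := by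
          refine integral_mono_of_nonneg (ae_of_all _ fun z => hd0 _ _)
            ((h3.const_mul _).const_mul _) (ae_of_all _ fun z => (min_le_right _ _).trans ?_)
          have h5 : S x + z - (S y + (z + h)) = S x - S y - h := by abel
          have h6 : ‖S x - S y - h‖ ^ s ≤ (ε * t) ^ s := by gcongr
          rw [h5]
          exact mul_le_mul_of_nonneg_left
            (mul_le_mul_of_nonneg_right h6 (Real.sqrt_nonneg _)) hK0
      _ = K * ((ε * t) ^ s * ∫ z, √(W (S x + z) * W (S y + (z + h))) ∂ν) := by
          rw [integral_const_mul, integral_const_mul]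
      _ ≤ K * ((ε ^ s * (Real.exp (δ / 2 * (p x + p y)) * ‖x - y‖ ^ s))
            * (A * Real.exp (-(δ / 2 * (p x + p y))) * √(W x * W y))) := by
          rw [Real.mul_rpow hε ht0]
          gcongr
      _ = K * (A * ε ^ s * D) := by
          rw [Real.exp_neg, hD]
          have := Real.exp_pos (δ / 2 * ((p x : ℝ) + p y))
          field_simp
  rw [hdD]
  have h6 : A * ε ^ s * D ≤ 1 / 4 * D := by gcongr
  have h7 : K * (A * ε ^ s * D) ≤ K * (1 / 4 * D) := by gcongr
  have h8 : 4 * Λ ^ s * D ≤ K * D := by gcongr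
  have h9 : ∫ z, weightedDist K s W z.1 z.2 ∂π
      ≤ ∫ z, weightedDist K s W z.1 z.2 ∂(ν.map fun z => (S x + z, S y + (z + h)))
        + (1 - (ν.map fun z => (S x + z, S y + (z + h))).real Set.univ) := hsplit
  linarith

end Contraction

/-! ### Smallness of the sublevel sets -/

section Sublevel

/-- Noise smaller than `r` which leads to `B` bounds the mass of `B` from below. -/
theorem le_real_of_map_le {H : Type*} [NormedAddCommGroup H] [MeasurableSpace H] [BorelSpace H]
    {S : H → H} {r : ℝ} {ν : Measure H} {x y h : H} {π : Measure (H × H)}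
    [IsProbabilityMeasure π] (hπ : ν.map (fun z => (S x + z, S y + (z + h))) ≤ π)
    {B : Set (H × H)} (hB : MeasurableSet B)
    (hin : ∀ z ∈ Metric.ball (0 : H) r, (S x + z, S y + (z + h)) ∈ B) :
    ν.real (Metric.ball 0 r) ≤ π.real B := by
  have hφ : Measurable fun z => (S x + z, S y + (z + h)) := by fun_prop
  refine ENNReal.toReal_mono (measure_ne_top _ _) ?_
  calc ν (Metric.ball 0 r) ≤ ν ((fun z => (S x + z, S y + (z + h))) ⁻¹' B) := measure_mono hin
    _ = ν.map (fun z => (S x + z, S y + (z + h))) B := (Measure.map_apply hφ hB).symm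
    _ ≤ π B := hπ B

variable {H : Type*} [NormedAddCommGroup H] [MeasurableSpace H] [BorelSpace H]
  [SecondCountableTopology H] {S : H → H} {hS : Continuous S} {m : Measure H}
  [IsProbabilityMeasure m] {p Φ : H → ℝ≥0} {q C C' F r ε Λ R₀ r₀ M : ℝ} {d : H → H → ℝ}

/-- Pairs of points of a sublevel set of `Φ` are brought close to each other in finitely many steps.
The transported noise halves the distance at each step; as long as it is smaller than `r`, the first
process stays in the sublevel set, hence in the ball of radius `r₀`, and the second one, at distance
at most `2 r₀`, in the ball of radius `3 r₀`. -/
theorem smallAt_closed_ball (hV : IsLyapunov (kickKernel S hS m) (fun x => (Φ x : ℝ)) q C')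
    (hΦc : Continuous Φ) (hΦ : ∀ x z, (Φ (S x + z) : ℝ) ≤ q * Φ x + C * Φ z) (hC : 0 ≤ C)
    (hF : ∀ z ∈ Metric.ball (0 : H) r, (Φ z : ℝ) ≤ F) (hR₀ : q * R₀ + C * F ≤ R₀)
    (hr₀ : ∀ x, (Φ x : ℝ) ≤ R₀ → ‖x‖ ≤ r₀) (hr₀0 : 0 ≤ r₀)
    (hM : ∀ x, ‖x‖ ≤ 3 * r₀ → (p x : ℝ) ≤ M)
    (hε : 0 ≤ ε) (hεM : ε * Real.exp (2 * M) ≤ 1 / 2) {F' : ℝ}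
    (hΦb : ∀ x, ‖x‖ ≤ 3 * r₀ → (Φ x : ℝ) ≤ F')
    (hd1 : ∀ x y, d x y ≤ 1)
    (hd : ∃ n : ℕ, ∀ x y, ‖x‖ ≤ r₀ → ‖y‖ ≤ 3 * r₀ → ‖x - y‖ ≤ 2 * r₀ * (1 / 2) ^ n → d x y ≤ 1 / 2)
    (hkick : SqueezingKick S p m ε Λ r) :
    ∃ n, SmallAt (kickKernel S hS m) (fun x => (Φ x : ℝ)) d n
      {z | (Φ z.1 : ℝ) ≤ R₀ ∧ (Φ z.2 : ℝ) ≤ R₀} := by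
  obtain ⟨n, hn⟩ := hd
  set B : ℕ → Set (H × H) := fun j =>
    {z | (Φ z.1 : ℝ) ≤ R₀ ∧ ‖z.1 - z.2‖ ≤ 2 * r₀ * (1 / 2) ^ j} with hB
  have hBm : ∀ j, MeasurableSet (B j) := fun j => by
    have h1 : Continuous fun z : H × H => (Φ z.1 : ℝ) := by fun_prop
    have h2 : Continuous fun z : H × H => ‖z.1 - z.2‖ := by fun_prop
    exact (measurableSet_le h1.measurable measurable_const).inter
      (measurableSet_le h2.measurable measurable_const)
  have hball : ∀ j x y, (x, y) ∈ B j → ‖x‖ ≤ r₀ ∧ ‖y‖ ≤ 3 * r₀ := by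
    rintro j x y ⟨h1, h2⟩
    have h3 := hr₀ x h1
    refine ⟨h3, ?_⟩
    have h4 : 2 * r₀ * (1 / 2 : ℝ) ^ j ≤ 2 * r₀ * 1 := by
      gcongr
      exact pow_le_one₀ (by norm_num) (by norm_num)
    have h5 : ‖y‖ ≤ ‖x‖ + ‖x - y‖ := by
      have := norm_sub_le x (x - y)
      rwa [sub_sub_cancel] at this
    have h6 : ‖x - y‖ ≤ 2 * r₀ * (1 / 2 : ℝ) ^ j := h2
    linarith
  have hVb : ∀ j x y, (x, y) ∈ B j → (Φ x : ℝ) + Φ y ≤ R₀ + F' := fun j x y hxy =>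
    add_le_add hxy.1 (hΦb y (hball j x y hxy).2)
  obtain ⟨k, hk0, hk⟩ := hkick (Real.exp (2 * M) * (2 * r₀))
  have hstep : ∀ i j, i + j = n → SmallAt (kickKernel S hS m) (fun x => (Φ x : ℝ)) d i (B j) := by
    intro i
    induction i with
    | zero =>
      intro j hj
      refine smallAt_zero (R := R₀ + F') hV fun x y hxy => ⟨?_, hVb j x y hxy⟩
      obtain ⟨h1, h2⟩ := hball j x y hxy
      refine hn x y h1 h2 ?_
      rw [← hj, zero_add]
      exact hxy.2
    | succ i ih =>
      intro j hj
      refine SmallAt.step hV hd1 (hBm (j + 1)) (hVb j) hk0 (fun x y hxy => ?_) (ih (j + 1) (by lia))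
      obtain ⟨h, ν, hν, hνh, h1, -, h3⟩ := hk x y
      obtain ⟨π, hπ, hσπ⟩ := exists_coupling_of_shift (hS := hS) x y h hν hνh
      have := hπ.isProbabilityMeasure
      obtain ⟨hx, hy⟩ := hball j x y hxy
      have hE : Real.exp (p x + p y) * ‖x - y‖ ≤ Real.exp (2 * M) * ‖x - y‖ := by
        gcongr
        linarith [hM x (by linarith), hM y hy]
      refine ⟨π, hπ, (h3 (hE.trans ?_)).trans (le_real_of_map_le hσπ (hBm _) ?_)⟩
      · gcongr
        refine hxy.2.trans (mul_le_of_le_one_right (by positivity) ?_)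
        exact pow_le_one₀ (by norm_num) (by norm_num)
      · intro z hz
        refine ⟨?_, ?_⟩
        · have h4 := hΦ x z
          have h5 := mul_le_mul_of_nonneg_left (hF z hz) hC
          have h6 := mul_le_mul_of_nonneg_left (show (Φ x : ℝ) ≤ R₀ from hxy.1) hV.q_pos.le
          change (Φ (S x + z) : ℝ) ≤ R₀
          linarith
        · change ‖S x + z - (S y + (z + h))‖ ≤ _
          have h5 : S x + z - (S y + (z + h)) = S x - S y - h := by abel
          rw [h5]
          calc ‖S x - S y - h‖ ≤ ε * (Real.exp (2 * M) * ‖x - y‖) := h1.trans (by gcongr)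
            _ ≤ 1 / 2 * ‖x - y‖ := by
                rw [← mul_assoc]
                gcongr
            _ ≤ 1 / 2 * (2 * r₀ * (1 / 2) ^ j) := by
                gcongr
                exact hxy.2
            _ = 2 * r₀ * (1 / 2) ^ (j + 1) := by ring
  refine ⟨n, (hstep n 0 (by lia)).mono fun z hz => ⟨hz.1, ?_⟩⟩
  have h1 := norm_sub_le z.1 z.2
  have h2 := hr₀ z.1 hz.1
  have h3 := hr₀ z.2 hz.2
  rw [pow_zero, mul_one]
  linarith

/-- Synchronous small noise drives every sublevel set of `Φ` into the sublevel set of level `R₀`. -/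
theorem smallAt_sublevel (hV : IsLyapunov (kickKernel S hS m) (fun x => (Φ x : ℝ)) q C')
    (hΦc : Continuous Φ) (hΦ : ∀ x z, (Φ (S x + z) : ℝ) ≤ q * Φ x + C * Φ z) (hC : 0 ≤ C)
    (hF : ∀ z ∈ Metric.ball (0 : H) r, (Φ z : ℝ) ≤ F) (hR₀ : q * R₀ + C * F + (1 - q) ≤ R₀)
    (hd1 : ∀ x y, d x y ≤ 1) (hkick : SqueezingKick S p m ε Λ r) {n : ℕ}
    (hn : SmallAt (kickKernel S hS m) (fun x => (Φ x : ℝ)) d n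
      {z | (Φ z.1 : ℝ) ≤ R₀ ∧ (Φ z.2 : ℝ) ≤ R₀}) (R : ℝ) :
    ∃ n, SmallAt (kickKernel S hS m) (fun x => (Φ x : ℝ)) d (n + 1)
      {z | (Φ z.1 : ℝ) + Φ z.2 ≤ R} := by
  have hq := hV.q_pos
  have hq1 : 0 < 1 - q := by linarith [hV.q_lt]
  set B : ℕ → Set (H × H) := fun j =>
    {z | (Φ z.1 : ℝ) ≤ R₀ + j * (1 - q) ∧ (Φ z.2 : ℝ) ≤ R₀ + j * (1 - q)} with hB
  have hBm : ∀ j, MeasurableSet (B j) := fun j => by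
    have h1 : Continuous fun z : H × H => (Φ z.1 : ℝ) := by fun_prop
    have h2 : Continuous fun z : H × H => (Φ z.2 : ℝ) := by fun_prop
    exact (measurableSet_le h1.measurable measurable_const).inter
      (measurableSet_le h2.measurable measurable_const)
  obtain ⟨k, hk0, hk⟩ := hkick 0
  have hstep : ∀ j, SmallAt (kickKernel S hS m) (fun x => (Φ x : ℝ)) d (n + j) (B j) := by
    intro j
    induction j with
    | zero => simpa [hB] using hn
    | succ j ih =>
      refine SmallAt.step hV hd1 (hBm j) (R := 2 * (R₀ + (j + 1 : ℕ) * (1 - q)))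
        (fun x y hxy => by linarith [hxy.1, hxy.2]) hk0 (fun x y hxy => ?_) ih
      -- both processes are driven by the same noise
      obtain ⟨π, hπ, hσπ⟩ := exists_coupling_of_shift (hS := hS) x y 0 (le_refl m) (by simp)
      have := hπ.isProbabilityMeasure
      obtain ⟨h, ν, hν, -, -, -, h3⟩ := hk 0 0
      refine ⟨π, hπ, (h3 (by simp)).trans ((?_ : _ ≤ m.real (Metric.ball 0 r)).trans
        (le_real_of_map_le hσπ (hBm _) ?_))⟩
      · exact ENNReal.toReal_mono (measure_ne_top _ _) (hν _)
      · have key : ∀ w z, z ∈ Metric.ball (0 : H) r → (Φ w : ℝ) ≤ R₀ + (j + 1 : ℕ) * (1 - q) →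
            (Φ (S w + z) : ℝ) ≤ R₀ + j * (1 - q) := by
          intro w z hz hw
          have h4 := hΦ w z
          have h5 := mul_le_mul_of_nonneg_left (hF z hz) hC
          have h6 := mul_le_mul_of_nonneg_left hw hq.le
          have h7 : q * ((j : ℝ) * (1 - q)) ≤ j * (1 - q) :=
            mul_le_of_le_one_left (by positivity) hV.q_lt.le
          push_cast at h6
          nlinarith
        intro z hz
        rw [add_zero]
        exact ⟨key x z hz hxy.1, key y z hz hxy.2⟩
  obtain ⟨j, hj⟩ := exists_nat_ge ((R - R₀) / (1 - q))
  rw [div_le_iff₀ hq1] at hj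
  refine ⟨n + j, (hstep (j + 1)).mono fun z (hz : (Φ z.1 : ℝ) + Φ z.2 ≤ R) => ?_⟩
  have h1 : (0 : ℝ) ≤ Φ z.1 := (Φ z.1).2
  have h2 : (0 : ℝ) ≤ Φ z.2 := (Φ z.2).2
  refine ⟨?_, ?_⟩ <;> (push_cast; nlinarith)

end Sublevel

/-! ### Mixing -/

section Noise

variable {H : Type*} [NormedAddCommGroup H] [InnerProductSpace ℝ H] [CompleteSpace H]
  [MeasurableSpace H] [BorelSpace H] [SecondCountableTopology H]
  {Ω : Type*} [MeasurableSpace Ω] {P : Measure Ω} [IsProbabilityMeasure P]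

/-- If the noise excites the modes which capture the increments of `S`, then it is squeezing. -/
theorem NoiseStructure.exists_squeezingKick {S : H → H} {Φ p : H → ℝ≥0} {γ : ℕ → ℝ}
    {V : ℕ → Submodule ℝ H} [∀ N, FiniteDimensional ℝ (V N)] (hB : Compactness S p γ V)
    {e : HilbertBasis ℕ ℝ H} {η : ℕ → Ω → H} {b : ℕ → ℝ} {ξ : ℕ → ℕ → Ω → ℝ} {dens : ℕ → ℝ → ℝ}
    (h : NoiseStructure Φ p γ e P η b ξ dens) {N : ℕ} (hb : ∀ j < N, b j ≠ 0) {ε : ℝ}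
    (hN : ∀ x y : H, ‖(S x - S y) - ∑ j ∈ Finset.range N, inner ℝ (e j) (S x - S y) • e j‖
      ≤ ε * (Real.exp (p x + p y) * ‖x - y‖)) {r : ℝ} (hr : 0 < r) :
    ∃ Λ : ℝ, 0 ≤ Λ ∧ SqueezingKick S p (P.map (η 0)) ε Λ r := by
  have hγ := hB.γ_pos 0
  have hξi : iIndepFun (fun j => ξ j 0) P :=
    h.ξ_indep.precomp (g := fun j => (j, 0)) (fun i j hij => (Prod.mk.inj hij).1)
  obtain ⟨J, hNJ, hJ⟩ := exists_small_tail (e := e) (b := b) (fun j => h.ξ_measurable j 0)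
    (h.η_measurable 0) (h.η_eq 0) N (half_pos hr)
  have hm := map_eq_joinModes (e := e) (fun j => h.ξ_measurable j 0) hξi (h.η_measurable 0)
    (h.η_eq 0) J
  have hlaw : ∀ j, P.map (ξ j 0) = densMeasure (dens j) := fun j => h.ξ_law j 0
  have hprob : ∀ j, IsProbabilityMeasure (densMeasure (dens j)) := fun j => by
    rw [← hlaw j]
    exact Measure.isProbabilityMeasure_map (h.ξ_measurable j 0).aemeasurable
  simp only [hlaw] at hm
  have htail : Measurable fun ω => η 0 ω - ∑ j ∈ Finset.range J, (b j * ξ j 0 ω) • e j := by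
    have := h.η_measurable 0
    have := fun j => h.ξ_measurable j 0
    fun_prop
  have hζ : IsProbabilityMeasure
      (P.map fun ω => η 0 ω - ∑ j ∈ Finset.range J, (b j * ξ j 0 ω) • e j) :=
    Measure.isProbabilityMeasure_map htail.aemeasurable
  obtain ⟨Λ, hΛ, hk⟩ := exists_shifted_part (fun j => e.orthonormal.1 j)
    (fun j => (h.dens_contDiff j).continuous) h.dens_pos h.dens_variation hprob hNJ hb _ hr hJ hm
  refine ⟨Λ * (γ 0)⁻¹, by positivity, fun L => ?_⟩
  obtain ⟨k, hk0, hk⟩ := hk ((γ 0)⁻¹ * L)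
  refine ⟨k, hk0, fun x y => ?_⟩
  have ht := hB.norm_sub_le x y
  obtain ⟨ν, h1, h2, h3, h4⟩ := hk (fun j => inner ℝ (e j) (S x - S y)) ‖S x - S y‖ (norm_nonneg _)
    (fun j _ => by
      have := abs_real_inner_le_norm (e j) (S x - S y)
      rwa [e.orthonormal.1 j, one_mul] at this)
  refine ⟨_, ν, h1, h2, hN x y, ?_, fun hL => h4 (ht.trans (by gcongr))⟩
  rw [mul_assoc]
  have := mul_le_mul_of_nonneg_left ht hΛ.le
  linarith

end Noise

theorem NoiseStructure.integrable_coe {H : Type*} [NormedAddCommGroup H]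
    [InnerProductSpace ℝ H] [MeasurableSpace H] [BorelSpace H] {Ω : Type*} [MeasurableSpace Ω]
    {P : Measure Ω} {Φ p : H → ℝ≥0} {γ : ℕ → ℝ} {e : HilbertBasis ℕ ℝ H}
    {η : ℕ → Ω → H} {b : ℕ → ℝ} {ξ : ℕ → ℕ → Ω → ℝ} {dens : ℕ → ℝ → ℝ}
    (h : NoiseStructure Φ p γ e P η b ξ dens) (hΦ : Continuous Φ) :
    Integrable (fun x => (Φ x : ℝ)) (P.map (η 0)) := by
  obtain ⟨δ, hδ, hfin⟩ := h.exp_moment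
  have hm : Measurable fun x => (Φ x : ℝ) := hΦ.measurable.coe_nnreal_real
  refine ⟨hm.aestronglyMeasurable, ?_⟩
  rw [hasFiniteIntegral_iff_ofReal (ae_of_all _ fun x => NNReal.coe_nonneg (Φ x))]
  calc ∫⁻ x, ENNReal.ofReal (Φ x) ∂(P.map (η 0))
      ≤ ∫⁻ x, ENNReal.ofReal δ⁻¹ * ENNReal.ofReal (Real.exp (δ * ((Φ x : ℝ) + p x)))
          ∂(P.map (η 0)) := by
        refine lintegral_mono fun x => ?_
        rw [← ENNReal.ofReal_mul (by positivity)]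
        refine ENNReal.ofReal_le_ofReal ?_
        rw [inv_mul_eq_div, le_div_iff₀ hδ]
        have h1 := Real.add_one_le_exp (δ * ((Φ x : ℝ) + p x))
        have h2 : (0 : ℝ) ≤ δ * p x := by positivity
        nlinarith
    _ < ∞ := by
        rw [lintegral_const_mul' _ _ ENNReal.ofReal_ne_top]
        exact ENNReal.mul_lt_top ENNReal.ofReal_lt_top hfin

section Mixing

variable {H : Type*} [NormedAddCommGroup H] {K s δ : ℝ} {W : H → ℝ}

/-- The weighted distance dominates the truncated norm distance. -/
theorem abs_sub_le_weightedDist (hs : 0 < s) (hs1 : s ≤ 1) (hK : 1 ≤ K) (hW : ∀ x, 1 ≤ W x)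
    {f : H → ℝ} (hf1 : ∀ x, |f x| ≤ 1) (hf : LipschitzWith 1 f) (x y : H) :
    |f x - f y| ≤ 2 * weightedDist K s W x y := by
  have h1 : |f x - f y| ≤ ‖x - y‖ := by
    have := hf.dist_le_mul x y
    rwa [NNReal.coe_one, one_mul, Real.dist_eq, dist_eq_norm] at this
  have h2 : |f x - f y| ≤ 2 := by
    have := abs_sub (f x) (f y)
    linarith [hf1 x, hf1 y]
  have h3 : (1 : ℝ) ≤ √(W x * W y) := by
    rw [Real.one_le_sqrt]
    nlinarith [hW x, hW y]
  have h4 : ‖x - y‖ ^ s ≤ K * (‖x - y‖ ^ s * √(W x * W y)) := by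
    have h5 : 0 ≤ ‖x - y‖ ^ s := by positivity
    nlinarith [mul_le_mul hK h3 zero_le_one (by linarith)]
  unfold weightedDist
  rcases le_total ‖x - y‖ 1 with hc | hc
  · have h5 := Real.self_le_rpow_of_le_one (norm_nonneg (x - y)) hc hs1
    rcases min_choice 1 (K * (‖x - y‖ ^ s * √(W x * W y))) with h6 | h6 <;> rw [h6]
    · linarith
    · linarith [norm_nonneg (x - y)]
  · have h5 := Real.one_le_rpow hc hs.le
    rw [min_eq_left (h5.trans h4)]
    linarith

/-- Points of a ball at a small norm distance have a small weighted distance. -/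
theorem exists_weightedDist_le {r₀ B : ℝ} (hs : 0 < s) (hK : 0 ≤ K)
    (hr₀ : 0 ≤ r₀) (hW0 : ∀ x, 0 ≤ W x) (hWB : ∀ x, ‖x‖ ≤ 3 * r₀ → W x ≤ B) :
    ∃ n : ℕ, ∀ x y, ‖x‖ ≤ r₀ → ‖y‖ ≤ 3 * r₀ → ‖x - y‖ ≤ 2 * r₀ * (1 / 2) ^ n →
      weightedDist K s W x y ≤ 1 / 2 := by
  have hB0 : 0 ≤ B := (hW0 0).trans (hWB 0 (by simpa using hr₀))
  have h1 : Tendsto (fun n : ℕ => K * ((2 * r₀ * (1 / 2 : ℝ) ^ n) ^ s * B)) atTop (𝓝 0) := by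
    have h2 := (tendsto_pow_atTop_nhds_zero_of_lt_one (r := (1 / 2 : ℝ)) (by norm_num)
      (by norm_num)).const_mul (2 * r₀)
    have h3 := ((h2.rpow_const (p := s) (Or.inr hs.le)).mul_const B).const_mul K
    simpa [Real.zero_rpow hs.ne'] using h3
  obtain ⟨n, hn⟩ := (h1.eventually (ge_mem_nhds (show (0 : ℝ) < 1 / 2 by norm_num))).exists
  refine ⟨n, fun x y hx hy hxy => (min_le_right _ _).trans (le_trans ?_ hn)⟩
  gcongr
  refine Real.sqrt_le_iff.mpr ⟨hB0, ?_⟩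
  rw [sq]
  exact mul_le_mul (hWB x (by linarith)) (hWB y hy) (hW0 y) hB0

variable [MeasurableSpace H] [BorelSpace H]

theorem continuous_markovOp_kickKernel [SecondCountableTopology H] {S : H → H} (hS : Continuous S)
    (m : Measure H) [IsProbabilityMeasure m] {f : H → ℝ} (hf : Continuous f) (hfb : BddMeas f) :
    Continuous (markovOp (kickKernel S hS m) f) := by
  obtain ⟨hfm, B, hB⟩ := hfb
  have h1 : markovOp (kickKernel S hS m) f = fun x => ∫ z, f (S x + z) ∂m := by
    funext x
    rw [markovOp, kickKernel_apply,
      integral_map (measurable_const_add _).aemeasurable hfm.aestronglyMeasurable]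
  rw [h1]
  refine continuous_of_dominated (bound := fun _ => B) (fun x => ?_)
    (fun x => ae_of_all _ fun z => ?_) (integrable_const B) (ae_of_all _ fun z => ?_)
  · exact (hfm.comp (measurable_const_add _)).aestronglyMeasurable
  · exact hB _
  · fun_prop

theorem dualLipDist_lawAt_le {κ : Kernel H H} [IsMarkovKernel κ] {Φ : H → ℝ≥0} {E a : ℝ}
    {μ lam : Measure H} [IsProbabilityMeasure lam] (k : ℕ)
    (hdecay : ∀ f : H → ℝ, (∀ x, |f x| ≤ 1) → LipschitzWith 1 f → ∀ (n : ℕ) (x : H),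
      |(markovOp κ)^[n] f x - ∫ y, f y ∂μ| ≤ E * Real.exp (-a * n) * Φ x) (hE : 0 < E) :
    dualLipDist (lawAt κ lam k) μ
      ≤ ENNReal.ofReal (E * Real.exp (-a * k)) * ∫⁻ x, (Φ x : ℝ≥0∞) ∂lam := by
  refine iSup₂_le fun f hf => ?_
  obtain ⟨M, L, hML, hfM, hfL⟩ := hf
  have hM : M ≤ 1 := le_self_add.trans hML
  have hL : L ≤ 1 := le_add_self.trans hML
  have hf1 : ∀ x, |f x| ≤ 1 := fun x => (hfM x).trans (by exact_mod_cast hM)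
  have hfb : BddMeas f := ⟨hfL.continuous.measurable, 1, hf1⟩
  have hi := (hfb.iterate (κ := κ) k).integrable lam
  rw [integral_lawAt lam hfb]
  have h1 : ∫ x, (markovOp κ)^[k] f x ∂lam - ∫ y, f y ∂μ
      = ∫ x, ((markovOp κ)^[k] f x - ∫ y, f y ∂μ) ∂lam := by
    rw [integral_sub hi (integrable_const _)]
    simp
  rw [h1, ← Real.norm_eq_abs, ofReal_norm,
    ← lintegral_const_mul' _ _ ENNReal.ofReal_ne_top]
  refine (enorm_integral_le_lintegral_enorm _).trans (lintegral_mono fun x => ?_)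
  rw [← ofReal_norm, ← ENNReal.ofReal_coe_nnreal, ← ENNReal.ofReal_mul (by positivity)]
  exact ENNReal.ofReal_le_ofReal (hdecay f hf1 (hfL.weaken hL) k x)

end Mixing

section Conclusion

variable {H : Type*} [NormedAddCommGroup H] [CompleteSpace H]
  [MeasurableSpace H] [BorelSpace H] [SecondCountableTopology H] {S : H → H} {hS : Continuous S}
  {m : Measure H} [IsProbabilityMeasure m] {p Φ : H → ℝ≥0} {q C F r ε Λ R₀ r₀ M : ℝ}

/-- A squeezing noise and a weight `W` which compensates the growth `exp (p x + p y)` of the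
increments make the chain exponentially mixing. -/
theorem exists_stationary_of_squeezing {W : H → ℝ} {δ A s : ℝ}
    (hΦc : Continuous Φ) (hΦ1 : ∀ x, 1 ≤ Φ x)
    (hΦ : ∀ x z, (Φ (S x + z) : ℝ) ≤ q * Φ x + C * Φ z) (hq : 0 < q) (hq1 : q < 1) (hC : 0 ≤ C)
    (hΦm : Integrable (fun x => (Φ x : ℝ)) m)
    (hΦb : ∀ R : ℝ, ∃ B : ℝ, ∀ x, ‖x‖ ≤ R → (Φ x : ℝ) ≤ B)
    (hF : ∀ z ∈ Metric.ball (0 : H) r, (Φ z : ℝ) ≤ F) (hR₀ : q * R₀ + C * F + (1 - q) ≤ R₀)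
    (hr₀ : ∀ x, (Φ x : ℝ) ≤ R₀ → ‖x‖ ≤ r₀) (hr₀0 : 0 ≤ r₀)
    (hM : ∀ x, ‖x‖ ≤ 3 * r₀ → (p x : ℝ) ≤ M) (hε : 0 ≤ ε) (hεM : ε * Real.exp (2 * M) ≤ 1 / 2)
    (hA : 0 ≤ A) (hs : 0 < s) (hs1 : s ≤ 1) (hsδ : s ≤ δ / 2) (hAε : A * ε ^ s ≤ 1 / 4)
    (hW1 : ∀ x, 1 ≤ W x) (hWp : ∀ x, Real.exp (δ * p x) ≤ W x) (hWm : Measurable W)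
    (hWb : ∀ R : ℝ, ∃ B : ℝ, ∀ x, ‖x‖ ≤ R → W x ≤ B)
    (hWκ : ∀ x, Integrable W (kickKernel S hS m x) ∧
      ∫ y, W y ∂kickKernel S hS m x ≤ A * Real.exp (-(δ * p x)) * W x)
    (hΛ : 0 ≤ Λ) (hkick : SqueezingKick S p m ε Λ r) :
    ∃ μ : ProbabilityMeasure H, (μ : Measure H).bind (kickKernel S hS m) = μ ∧
      (∀ ν : ProbabilityMeasure H, (ν : Measure H).bind (kickKernel S hS m) = ν → ν = μ) ∧
      ∃ E a : ℝ, 0 < E ∧ 0 < a ∧ ∀ f : H → ℝ, (∀ x, |f x| ≤ 1) → LipschitzWith 1 f →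
        ∀ (n : ℕ) (x : H), |(markovOp (kickKernel S hS m))^[n] f x - ∫ y, f y ∂(μ : Measure H)|
          ≤ E * Real.exp (-a * n) * Φ x := by
  have hΦmeas : Measurable fun x => (Φ x : ℝ) := hΦc.measurable.coe_nnreal_real
  have hV : IsLyapunov (kickKernel S hS m) (fun x => (Φ x : ℝ)) q (C * ∫ z, (Φ z : ℝ) ∂m) := by
    have hbd : ∀ x, Integrable (fun z => q * (Φ x : ℝ) + C * Φ z) m := fun x =>
      (integrable_const _).add (hΦm.const_mul C)
    have hsh : ∀ x, Integrable (fun z => (Φ (S x + z) : ℝ)) m := fun x =>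
      (hbd x).mono' (hΦmeas.comp (measurable_const_add _)).aestronglyMeasurable
        (ae_of_all _ fun z => by rw [Real.norm_of_nonneg (NNReal.coe_nonneg _)]; exact hΦ x z)
    refine ⟨hΦmeas, fun x => by exact_mod_cast hΦ1 x, fun x => ?_, fun x => ?_, hq, hq1,
      mul_nonneg hC (integral_nonneg fun z => NNReal.coe_nonneg _)⟩
    · rw [kickKernel_apply]
      exact (integrable_map_measure hΦmeas.aestronglyMeasurable
        (measurable_const_add _).aemeasurable).mpr (hsh x)
    · rw [kickKernel_apply, integral_map (measurable_const_add _).aemeasurable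
        hΦmeas.aestronglyMeasurable]
      refine (integral_mono (hsh x) (hbd x) (hΦ x)).trans (le_of_eq ?_)
      rw [integral_add (integrable_const _) (hΦm.const_mul C), integral_const_mul]
      simp [integral_const_mul]
  have hW0 : ∀ x, 0 ≤ W x := fun x => zero_le_one.trans (hW1 x)
  set K := 1 + 4 * Λ ^ s with hK
  have hK1 : 1 ≤ K := by
    have : 0 ≤ Λ ^ s := by positivity
    linarith
  have hd0 : ∀ x y, 0 ≤ weightedDist K s W x y := fun x y => le_min zero_le_one (by positivity)
  have hd1 : ∀ x y, weightedDist K s W x y ≤ 1 := fun x y => min_le_left _ _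
  obtain ⟨F', hF'⟩ := hΦb (3 * r₀)
  obtain ⟨B, hB⟩ := hWb (3 * r₀)
  obtain ⟨n, hn⟩ := smallAt_closed_ball hV hΦc hΦ hC hF (by linarith) hr₀ hr₀0 hM hε hεM hF' hd1
    (exists_weightedDist_le hs (zero_le_one.trans hK1) hr₀0 hW0 hB) hkick
  obtain ⟨E, a, hE, ha, hdecay⟩ := weak_harris hV (measurable_weightedDist K s hWm) hd0 hd1
    (fun x y hxy => exists_coupling_integral_le hA hs hs1 hsδ hWp hWm hWκ hε hΛ hAε
      (by rw [hK]; linarith) hkick hxy)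
    (smallAt_sublevel hV hΦc hΦ hC hF hR₀ hd1 hkick hn)
  obtain ⟨μ, h1, h2, E', hE', h3⟩ := exists_stationary_of_decay hV 0
    (fun f hf hfb => continuous_markovOp_kickKernel hS m hf hfb)
    (E := 2 * E) (by positivity) ha fun f hf1 hfL n x y => by
      have hfb : BddMeas fun x => 2⁻¹ * f x :=
        ⟨hfL.continuous.measurable.const_mul _, 2⁻¹, fun x => by
          rw [abs_mul, abs_of_pos (by norm_num)]
          linarith [hf1 x]⟩
      have h4 := hdecay _ hfb (fun x y => by
        rw [← mul_sub, abs_mul, abs_of_pos (by norm_num)]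
        linarith [abs_sub_le_weightedDist hs hs1 hK1 hW1 hf1 hfL x y]) n x y
      rw [iterate_const_mul, ← mul_sub, abs_mul, abs_of_pos (by norm_num)] at h4
      linarith
  exact ⟨μ, h1, h2, E', a, hE', ha, h3⟩

end Conclusion

end KickedRDS

theorem theorem1p1 {H : Type*} [NormedAddCommGroup H] [InnerProductSpace ℝ H]
    [CompleteSpace H] [TopologicalSpace.SeparableSpace H] [MeasurableSpace H] [BorelSpace H]
    (S : H → H) (hS : Continuous S)
    (Φ : H → ℝ≥0) (hA : KickedRDS.Dissipativity S Φ)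
    (p : H → ℝ≥0) (γ : ℕ → ℝ) (V : ℕ → Submodule ℝ H) [∀ N, FiniteDimensional ℝ (V N)]
    (hB : KickedRDS.Compactness S p γ V)
    (hU : S 0 ∈ KickedRDS.regularSpace γ V)
    (e : HilbertBasis ℕ ℝ H)
    (Q : ℝ≥0 → ℝ≥0) (c δ ρ : ℝ) (hρ : 0 < ρ)
    (hQ : ∀ x : H, (Q ‖x‖₊ : ℝ) ≤ Real.exp (ρ * Φ x)) :
    ∃ N : ℕ, 1 ≤ N ∧
      ∀ (Ω : Type*) [MeasurableSpace Ω] (P : Measure Ω) [IsProbabilityMeasure P]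
        (η : ℕ → Ω → H) (b : ℕ → ℝ) (ξ : ℕ → ℕ → Ω → ℝ) (dens : ℕ → ℝ → ℝ),
        KickedRDS.NoiseStructure Φ p γ e P η b ξ dens →
        KickedRDS.StabilisableWith S η P p Q c δ →
        (∀ j < N, b j ≠ 0) →
        ∃ μ : ProbabilityMeasure H,
          (KickedRDS.IsStationary S η P (μ : Measure H) ∧
            ∀ ν : ProbabilityMeasure H,
              KickedRDS.IsStationary S η P (ν : Measure H) → ν = μ) ∧
          ∃ κ C : ℝ, 0 < κ ∧ 0 < C ∧
            ∀ (lam : ProbabilityMeasure H) (k : ℕ),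
              KickedRDS.dualLipDist (KickedRDS.dualSemigroup S η P k (lam : Measure H))
                  (μ : Measure H)
                ≤ ENNReal.ofReal (C * Real.exp (-κ * k))
                  * ∫⁻ x, (Φ x : ℝ≥0∞) ∂(lam : Measure H) := by

  have : SecondCountableTopology H := UniformSpace.secondCountable_of_separable H
  obtain ⟨hΦc, α, β, C, q, hα, hβ, hC, hq, hq1, hΦ2, hΦ⟩ := hA
  have hq' : 0 < 1 - q := by linarith
  have hΦ1 : ∀ x, 1 ≤ Φ x := fun x => by
    have h1 := (hΦ2 x).1
    have h2 : 0 ≤ ‖x‖ ^ α := by positivity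
    exact_mod_cast (show (1 : ℝ) ≤ Φ x by linarith)
  -- the level `R₀` is chosen so that noise with `Φ ≤ Φ 0 + 1` preserves `{Φ ≤ R₀}`
  set F : ℝ := Φ 0 + 1 with hF
  set R₀ : ℝ := 1 + C * F / (1 - q) with hR₀
  have hR₀1 : q * R₀ + C * F + (1 - q) = R₀ := by
    rw [hR₀]
    field_simp
    ring
  have hR₀0 : 0 ≤ R₀ := by positivity
  set r₀ : ℝ := R₀ ^ α⁻¹ with hr₀
  have hr₀0 : 0 ≤ r₀ := by positivity
  have hball : ∀ x, (Φ x : ℝ) ≤ R₀ → ‖x‖ ≤ r₀ := fun x hx => by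
    rw [hr₀, Real.le_rpow_inv_iff_of_pos (norm_nonneg _) hR₀0 hα]
    linarith [(hΦ2 x).1]
  -- pairs meet inside the ball of radius `3 r₀`
  obtain ⟨M, hM⟩ := hB.p_bounded (3 * r₀)
  set s : ℝ := min (δ / 2) 1 with hs
  -- `δ` is known to be positive only for a noise for which `p` is stabilisable
  obtain ⟨ε, hε, hεM, hεs⟩ : ∃ ε : ℝ, 0 < ε ∧ ε * Real.exp (2 * M) ≤ 1 / 2 ∧
      (0 < δ → 2 * Real.exp c * ε ^ s ≤ 1 / 4) := by
    refine ⟨min ((8 * Real.exp c)⁻¹ ^ s⁻¹) (2 * Real.exp (2 * M))⁻¹, by positivity, ?_,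
      fun hδ => ?_⟩
    · calc _ ≤ (2 * Real.exp (2 * M))⁻¹ * Real.exp (2 * M) := by
            gcongr
            exact min_le_right _ _
        _ = 1 / 2 := by field_simp
    · have hs0 : 0 < s := lt_min (half_pos hδ) one_pos
      calc _ ≤ 2 * Real.exp c * ((8 * Real.exp c)⁻¹ ^ s⁻¹) ^ s := by
            gcongr
            exact min_le_left _ _
        _ = 1 / 4 := by
            rw [Real.rpow_inv_rpow (by positivity) hs0.ne']
            field_simp
            norm_num
  obtain ⟨r, hr, hFr⟩ : ∃ r : ℝ, 0 < r ∧ ∀ z ∈ Metric.ball (0 : H) r, (Φ z : ℝ) ≤ F := by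
    have h1 : Continuous fun x => (Φ x : ℝ) := by fun_prop
    have h2 : ∀ᶠ z in 𝓝 (0 : H), (Φ z : ℝ) ≤ F :=
      h1.continuousAt.eventually (ge_mem_nhds (by rw [hF]; linarith))
    obtain ⟨r, hr, h3⟩ := Metric.eventually_nhds_iff_ball.mp h2
    exact ⟨r, hr, h3⟩
  obtain ⟨N, hN1, hN⟩ := hB.exists_modes e hε
  refine ⟨N, hN1, fun Ω _ P _ η b ξ dens hnoise hstab hb => ?_⟩
  have hs0 : 0 < s := lt_min (half_pos hstab.δ_pos) one_pos
  set m := P.map (η 0) with hm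
  have hmp : IsProbabilityMeasure m :=
    Measure.isProbabilityMeasure_map (hnoise.η_measurable 0).aemeasurable
  have hpm : Measurable p := hB.p_continuous.measurable
  have hδ := hstab.δ_pos
  have hkick := hnoise.isKick hS
  obtain ⟨G, hGm, hG1, hGQ, hGκ⟩ := KickedRDS.exists_weight hS hkick hpm hstab
  obtain ⟨Λ, hΛ, hsq⟩ := hnoise.exists_squeezingKick hB hb hN hr
  have hWp : ∀ x, Real.exp (δ * p x) ≤ Real.exp (δ * p x) * G x := fun x =>
    le_mul_of_one_le_right (Real.exp_nonneg _) (hG1 x)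
  obtain ⟨μ, hμ, huniq, E, a, hE, ha, hdecay⟩ := KickedRDS.exists_stationary_of_squeezing
    (hS := hS) (W := fun x => Real.exp (δ * p x) * G x) (δ := δ) (s := s) (A := 2 * Real.exp c)
    hΦc hΦ1 hΦ hq hq1 hC.le (hnoise.integrable_coe hΦc)
    (fun R => ⟨C * (1 + |R|) ^ β, fun x hx => (hΦ2 x).2.trans (by
      have := hx.trans (le_abs_self R)
      gcongr)⟩)
    hFr hR₀1.le hball hr₀0 hM hε.le hεM (by positivity) hs0 (min_le_right _ _) (min_le_left _ _)
    (hεs hδ) (fun x => le_trans (Real.one_le_exp (by positivity)) (hWp x)) hWp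
    (by fun_prop)
    (fun R => by
      obtain ⟨M', hM'⟩ := hB.p_bounded R
      refine ⟨Real.exp (δ * M') * (1 + Q R.toNNReal), fun x hx => ?_⟩
      have h1 : Q ‖x‖₊ ≤ Q R.toNNReal := hstab.monotone (by
        rw [← norm_toNNReal]
        exact Real.toNNReal_le_toNNReal hx)
      have h2 := hM' x hx
      refine mul_le_mul (by gcongr) ((hGQ x).trans (by gcongr)) (by linarith [hG1 x])
        (Real.exp_nonneg _))
    (fun x => ⟨(hGκ x).1, (hGκ x).2.trans (le_of_eq (by
      rw [Real.exp_neg]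
      field_simp))⟩)
    hΛ hsq
  have hstat : ∀ ν : Measure H, KickedRDS.IsStationary S η P ν
      ↔ ν.bind (KickedRDS.kickKernel S hS m) = ν := fun ν => by
    rw [KickedRDS.IsStationary, hkick.dualSemigroup_eq hS, KickedRDS.lawAt_succ]
    rfl
  refine ⟨μ, ⟨(hstat _).mpr hμ, fun ν hν => huniq ν ((hstat _).mp hν)⟩, a, E, ha, hE,
    fun lam k => ?_⟩
  rw [hkick.dualSemigroup_eq hS]
  exact KickedRDS.dualLipDist_lawAt_le k hdecay hE
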